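/- **Theorem (vector control with commuting fields).** *Problem.* Let $(\Omega,\rho)$ be a complete separable metric space with a Borel probability measure $\mu$, let $t_0<T$, and let $U=\prod_{i=1}^m[u_{\min,i},u_{\max,i}]$ with $u_{\min,i}<u_{\max,i}$. Let $f_0,\dots,f_m:\mathbb R^n\times\Omega\to\mathbb R^n$ and $g:\mathbb R^n\times\Omega\to\mathbb R$ be measurable and let $\varphi\in L^2(\mu,\Omega;\mathbb R^n)$ (e.g. $\varphi\equiv x_0$). Put $f(x,u,\omega)=f_0(x,\omega)+\sum_{i=1}^m u_if_i(x,\omega)$. An admissible process $(u,x)$ consists of $u\in L^\infty(t_0,T;\mathbb R^m)$ with $u(t)\in U$ for a.e. $t$ and, for every $\omega\in\Omega$, the absolutely continuous solution of $x(t,\omega)=\varphi(\omega)+\int_{t_0}^t f(x(s,\omega),u(s),\omega)\,ds$ on $[t_0,T]$; its cost is $\int_\Omega g(x(T,\omega),\omega)\,d\mu(\omega)$. For vector fields, $[a,b]=b'a-a'b$. (H0) There are constants with $|f_i(x,\omega)|\le c_i(1+|x|)$, $|f_i(x,\omega)-f_i(x',\omega)|\le k_i|x-x'|$ $(0\le i\le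 m)$, $|g|\le M$, $|g(x,\omega)-g(x',\omega)|\le k_g|x-x'|$, for all $x,x',\omega$. *Minimizer.* Let $(\bar u,\bar x)$ be a $W^{1,1}$-local minimizer, in one of the following two senses: either (a) $\varphi$ is bounded on $\operatorname{supp}\mu$ and for some $\varepsilon>0$ the cost of $(\bar u,\bar x)$ is at most that of every admissible $(u,x)$ with $\|\bar x(\cdot,\omega)-x(\cdot,\omega)\|_{W^{1,1}([t_0,T];\mathbb R^n)}\le\varepsilon$ for all $\omega\in\operatorname{supp}\mu$; or (b) for some $\varepsilon>0$ the cost of $(\bar u,\bar x)$ is at most that of every admissible $(u,x)$ with $\|\bar x-x\|_{W^{1,1}([t_0,T];L^2(\mu,\Omega;\mathbb R^n))}\le\varepsilon$. (H1) For some $\delta>0$, writing $\mathbb B$ for the open unit ball: (i) there is a modulus of continuity $\theta_f$ with $\int_{t_0}^T\sup_{x\in\bar x(t,\omega)+\delta\mathbb B,\,u\in U}|f(x,u,\omega_1)-f(x,u,\omega_2)|\,dt\le\theta_f(\rho(\omega_1,\omega_2))$ for all $\omega,\omega_1,\omega_2$; (ii) $g(\cdot,\omega)$ is differentiable on $\bar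 x(T,\omega)+\delta\mathbb B$ for all $\omega$, $\nabla_xg$ is continuous there in $x$ and, for each fixed $x$, continuous in $\omega$ on $\{\omega:|x-\bar x(T,\omega)|<\delta\}$, and $|\nabla_xg(\bar x(T,\omega),\omega)|\le C_g$; (iii) $f(\cdot,u,\omega)$ is $C^1$ on $\bar x(t,\omega)+\delta\mathbb B$ for all $u\in U$, all $\omega$ and a.e. $t$, and $\nabla_xf(x,u,\omega)$ is continuous in $\omega$ uniformly in $t\in[t_0,T]$, $u\in U$ and $x$ in these balls; (iv) the $f_i$ are $C^2$ on $\bar x(t,\omega)+\delta\mathbb B$ for all $\omega$ and a.e. $t$, and for $k=1,2$, $|\partial_x^kf_i(\bar x(t,\omega),\omega)|<C^k_{f_i}$ for all $\omega\in\operatorname{supp}\mu$ and a.e. $t$. *Commutativity.* $[f_i,f_j]=0$ for $i,j=1,\dots,m$ (at least on all the balls $\bar x(t,\omega)+\delta\mathbb B$). *Adjoint state.* Let $p$ be the adjoint state, i.e. the solution of $-\dot p=\big[\tfrac{\partial f}{\partial x}(\bar x,\bar u)\big]^{\top}p$, $-p(T)=\nabla_xg(\bar x(T))$, either pathwise for every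 $\omega\in\operatorname{supp}\mu$ (with $p$ measurable), or in $W^{1,1}([t_0,T];L^2(\mu,\Omega;\mathbb R^n))$. Put $\Psi_i(t)=\int_\Omega p\cdot f_i\,d\mu$, $W_{ij}(t)=\int_\Omega p\cdot[f_i,[f_0,f_j]]\,d\mu$ $(i,j=0,\dots,m)$, evaluated along $\bar x$, and $$S(t)=\{i:u_{\min,i}<\bar u_i(t)<u_{\max,i}\},\quad B_{\min}(t)=\{i:\Psi_i(t)<0\},\quad B_{\max}(t)=\{i:\Psi_i(t)>0\}.$$ *Conclusion.* Let $(a,b)\subset[t_0,T]$ be a nonempty open interval on which, for a.e. $t$, $S(t)=S$, $B_{\min}(t)=B_{\min}$ and $B_{\max}(t)=B_{\max}$ are constant, with $S\cup B_{\min}\cup B_{\max}=\{1,\dots,m\}$ (every control component is singular or bang). Then for a.e. $t\in(a,b)$ the integrals $W_{ij}(t)$ converge absolutely and $$W_S(t)\,\bar u_S(t)+b_S(t)=0,$$ where $W_S=[W_{ij}]_{i,j\in S}$, $\bar u_S=(\bar u_i)_{i\in S}$, and for $i\in S$ $$b_i=W_{0i}+\sum_{j\in B_{\min}}W_{ij}\,u_{\min,j}+\sum_{j\in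 B_{\max}}W_{ij}\,u_{\max,j}.$$ -/

import Mathlib

open MeasureTheory Set Filter Topology
open scoped ENNReal

noncomputable section

namespace EnsembleControl

/-- The state space `ℝⁿ` with its Euclidean norm. -/
abbrev State (n : ℕ) : Type := EuclideanSpace ℝ (Fin n)

/-- The data of the averaged control-affine problem with box constraints
`minimize ∫ g(x(T,ω),ω) dμ(ω)` subject to `ẋ = f₀(x,ω) + ∑ uᵢ fᵢ(x,ω)`, `x(t₀,ω) = φ(ω)`,
`u(t) ∈ ∏ [uminᵢ, umaxᵢ]`.  The drift is `f 0`; the controlled fields are `f j.succ`. -/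
structure Problem (n m : ℕ) (Ω : Type*) [MeasurableSpace Ω] where
  t₀ : ℝ
  T : ℝ
  μ : Measure Ω
  f : Fin (m + 1) → State n → Ω → State n
  g : State n → Ω → ℝ
  φ : Ω → State n
  umin : Fin m → ℝ
  umax : Fin m → ℝ

namespace Problem

variable {n m : ℕ} {Ω : Type*} [MeasurableSpace Ω]

/-- The control box `U = ∏ [uminᵢ, umaxᵢ]`. -/
def box (P : Problem n m Ω) : Set (Fin m → ℝ) := Icc P.umin P.umax

/-- The dynamics `f(x,u,ω) = f₀(x,ω) + ∑ uᵢ fᵢ(x,ω)`. -/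
def dyn (P : Problem n m Ω) (x : State n) (u : Fin m → ℝ) (ω : Ω) : State n :=
  P.f 0 x ω + ∑ j : Fin m, u j • P.f j.succ x ω

/-- `u ∈ L^∞(t₀,T;ℝᵐ)` with `u(t) ∈ U` for a.e. `t`. -/
def IsControl (P : Problem n m Ω) (u : ℝ → Fin m → ℝ) : Prop :=
  MemLp u ∞ (volume.restrict (Icc P.t₀ P.T)) ∧
    ∀ᵐ t ∂(volume.restrict (Icc P.t₀ P.T)), u t ∈ P.box

/-- Admissible processes: an admissible control together with, for every `ω`, the
(absolutely continuous) solution of the integral equation. -/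
def IsAdmissible (P : Problem n m Ω) (u : ℝ → Fin m → ℝ) (x : ℝ → Ω → State n) : Prop :=
  P.IsControl u ∧ ∀ ω,
    ContinuousOn (fun t => x t ω) (Icc P.t₀ P.T) ∧
    ∀ t ∈ Icc P.t₀ P.T, x t ω = P.φ ω + ∫ s in P.t₀..t, P.dyn (x s ω) (u s) ω

/-- The averaged cost. -/
def cost (P : Problem n m Ω) (x : ℝ → Ω → State n) : ℝ := ∫ ω, P.g (x P.T ω) ω ∂P.μ

/-- `‖y - z‖` in `W^{1,1}([t₀,T]; ℝⁿ)` for two absolutely continuous arcs. -/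
def arcDist (P : Problem n m Ω) (y z : ℝ → State n) : ℝ≥0∞ :=
  (∫⁻ t in Icc P.t₀ P.T, ‖y t - z t‖ₑ) + ∫⁻ t in Icc P.t₀ P.T, ‖deriv y t - deriv z t‖ₑ

/-- `‖y - z‖` in `W^{1,1}([t₀,T]; L²(μ,Ω;ℝⁿ))` for two families of arcs. -/
def meanDist (P : Problem n m Ω) (y z : ℝ → Ω → State n) : ℝ≥0∞ :=
  (∫⁻ t in Icc P.t₀ P.T, eLpNorm (fun ω => y t ω - z t ω) 2 P.μ) +
    ∫⁻ t in Icc P.t₀ P.T,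
      eLpNorm (fun ω => deriv (fun s => y s ω) t - deriv (fun s => z s ω) t) 2 P.μ

/-- `W^{1,1}`-local minimizer: optimal among the admissible processes all of whose arcs, for
`ω ∈ supp μ`, are `ε`-close in `W^{1,1}([t₀,T]; ℝⁿ)`. -/
def IsLocalMinimizer [TopologicalSpace Ω] (P : Problem n m Ω)
    (u : ℝ → Fin m → ℝ) (x : ℝ → Ω → State n) : Prop :=
  P.IsAdmissible u x ∧ ∃ ε : ℝ, 0 < ε ∧ ∀ v y, P.IsAdmissible v y →
    (∀ ω ∈ P.μ.support, P.arcDist (fun t => x t ω) (fun t => y t ω) ≤ ENNReal.ofReal ε) →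
    P.cost x ≤ P.cost y

/-- `W^{1,1}`-local minimizer for `L²`-valued states: optimal among the admissible processes
whose state is `ε`-close in `W^{1,1}([t₀,T]; L²(μ,Ω;ℝⁿ))`. -/
def IsMeanLocalMinimizer (P : Problem n m Ω)
    (u : ℝ → Fin m → ℝ) (x : ℝ → Ω → State n) : Prop :=
  P.IsAdmissible u x ∧ ∃ ε : ℝ, 0 < ε ∧ ∀ v y, P.IsAdmissible v y →
    P.meanDist x y ≤ ENNReal.ofReal ε → P.cost x ≤ P.cost y

/-- Standing assumptions on the data (those on `U` hold automatically for a box). -/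
structure H0 (P : Problem n m Ω) : Prop where
  prob : IsProbabilityMeasure P.μ
  f_measurable : ∀ i, Measurable fun z : State n × Ω => P.f i z.1 z.2
  f_growth : ∀ i, ∃ c : ℝ, 0 < c ∧ ∀ x ω, ‖P.f i x ω‖ ≤ c * (1 + ‖x‖)
  f_lipschitz : ∀ i, ∃ k : ℝ, 0 < k ∧ ∀ x x' ω, ‖P.f i x ω - P.f i x' ω‖ ≤ k * ‖x - x'‖
  g_measurable : Measurable fun z : State n × Ω => P.g z.1 z.2
  g_bounded : ∃ M : ℝ, 0 < M ∧ ∀ x ω, |P.g x ω| ≤ M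
  g_lipschitz : ∃ k : ℝ, 1 ≤ k ∧ ∀ x x' ω, |P.g x ω - P.g x' ω| ≤ k * ‖x - x'‖

/-- A modulus of continuity on `[0,∞)`. -/
def IsModulus (θ : ℝ → ℝ) : Prop :=
  MonotoneOn θ (Ici 0) ∧ (∀ s, 0 ≤ s → 0 ≤ θ s) ∧ Tendsto θ (𝓝[>] 0) (𝓝 0)

/-- Regularity along the reference family of arcs `x`, in tubes of radius `δ`. -/
structure H1 [PseudoMetricSpace Ω] (P : Problem n m Ω) (x : ℝ → Ω → State n) (δ : ℝ) :
    Prop where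
  f_modulus : ∃ θ : ℝ → ℝ, IsModulus θ ∧ ∀ ω ω₁ ω₂,
    (∫⁻ t in Icc P.t₀ P.T, ⨆ y ∈ Metric.ball (x t ω) δ, ⨆ u ∈ P.box,
      ‖P.dyn y u ω₁ - P.dyn y u ω₂‖ₑ) ≤ ENNReal.ofReal (θ (dist ω₁ ω₂))
  g_differentiable : ∀ ω, ∀ y ∈ Metric.ball (x P.T ω) δ,
    DifferentiableAt ℝ (fun z => P.g z ω) y
  g_gradient_state : ∀ ω,
    ContinuousOn (fun y => gradient (fun z => P.g z ω) y) (Metric.ball (x P.T ω) δ)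
  g_gradient_param : ∀ y,
    ContinuousOn (fun ω => gradient (fun z => P.g z ω) y) {ω | y ∈ Metric.ball (x P.T ω) δ}
  g_gradient_bound : ∃ C : ℝ, 0 < C ∧ ∀ ω, ‖gradient (fun z => P.g z ω) (x P.T ω)‖ ≤ C
  f_contDiff : ∀ ω, ∀ᵐ t ∂(volume.restrict (Icc P.t₀ P.T)), ∀ u ∈ P.box,
    ContDiffOn ℝ 1 (fun y => P.dyn y u ω) (Metric.ball (x t ω) δ)
  f_fderiv_param : ∀ ω₀, ∀ ε : ℝ, 0 < ε → ∃ η : ℝ, 0 < η ∧ ∀ ω, dist ω ω₀ < η →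
    ∀ t ∈ Icc P.t₀ P.T, ∀ y ∈ Metric.ball (x t ω₀) δ ∩ Metric.ball (x t ω) δ, ∀ u ∈ P.box,
      ‖fderiv ℝ (fun z => P.dyn z u ω) y - fderiv ℝ (fun z => P.dyn z u ω₀) y‖ < ε
  f_contDiff_two : ∀ i ω, ∀ᵐ t ∂(volume.restrict (Icc P.t₀ P.T)),
    ContDiffOn ℝ 2 (fun y => P.f i y ω) (Metric.ball (x t ω) δ)
  f_deriv_bound : ∀ i, ∀ k ∈ ({1, 2} : Set ℕ), ∃ C : ℝ, 0 < C ∧ ∀ ω ∈ P.μ.support,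
    ∀ᵐ t ∂(volume.restrict (Icc P.t₀ P.T)),
      ‖iteratedFDeriv ℝ k (fun y => P.f i y ω) (x t ω)‖ < C

/-- The controlled fields commute: `[fᵢ,fⱼ] = 0` for `i,j ≥ 1`, at all points of the tubes on
which the fields are assumed to be differentiable. -/
def Commuting (P : Problem n m Ω) (x : ℝ → Ω → State n) (δ : ℝ) : Prop :=
  ∀ i j : Fin m, ∀ ω, ∀ t ∈ Icc P.t₀ P.T, ∀ y ∈ Metric.ball (x t ω) δ,
    VectorField.lieBracket ℝ (fun z => P.f i.succ z ω) (fun z => P.f j.succ z ω) y = 0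

/-- The vector `[∂f/∂x(x(t,ω),u(t),ω)]ᵀ q`. -/
def adjointField (P : Problem n m Ω) (u : ℝ → Fin m → ℝ) (x : ℝ → Ω → State n)
    (t : ℝ) (ω : Ω) (q : State n) : State n :=
  ContinuousLinearMap.adjoint (fderiv ℝ (fun y => P.dyn y (u t) ω) (x t ω)) q

/-- Pathwise adjoint state: for every `ω ∈ supp μ`, `p(·,ω)` is the absolutely continuous
solution of `-ṗ = [∂f/∂x]ᵀ p`, `-p(T,ω) = ∇ₓ g(x(T,ω),ω)`. -/
structure IsCostate [TopologicalSpace Ω] (P : Problem n m Ω) (u : ℝ → Fin m → ℝ)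
    (x : ℝ → Ω → State n) (p : ℝ → Ω → State n) : Prop where
  measurable : AEStronglyMeasurable (fun z : ℝ × Ω => p z.1 z.2)
    ((volume.restrict (Icc P.t₀ P.T)).prod P.μ)
  continuousOn : ∀ ω ∈ P.μ.support, ContinuousOn (fun t => p t ω) (Icc P.t₀ P.T)
  adjoint_eq : ∀ ω ∈ P.μ.support, ∀ t ∈ Icc P.t₀ P.T,
    p t ω = p P.T ω + ∫ s in t..P.T, P.adjointField u x s ω (p s ω)
  terminal : ∀ ω ∈ P.μ.support, -p P.T ω = gradient (fun z => P.g z ω) (x P.T ω)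

/-- `L²`-valued adjoint state: `t ↦ p(t,·)` is a curve `q` in
`W^{1,1}([t₀,T]; L²(μ,Ω;ℝⁿ))` with derivative `dq`, and `-q̇(t) = [∂f/∂x]^* q(t)` in `L²` for
a.e. `t`, `-q(T) = ∇ₓ g(x(T))` in `L²`. -/
def IsMeanCostate (P : Problem n m Ω) (u : ℝ → Fin m → ℝ)
    (x : ℝ → Ω → State n) (p : ℝ → Ω → State n) : Prop :=
  ∃ q dq : ℝ → Lp (State n) 2 P.μ,
    (∀ t ∈ Icc P.t₀ P.T, p t =ᵐ[P.μ] q t) ∧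
    IntervalIntegrable dq volume P.t₀ P.T ∧
    (∀ t ∈ Icc P.t₀ P.T, q t = q P.t₀ + ∫ s in P.t₀..t, dq s) ∧
    (∀ᵐ t ∂(volume.restrict (Icc P.t₀ P.T)), ∀ᵐ ω ∂P.μ,
      -(dq t ω) = P.adjointField u x t ω (q t ω)) ∧
    ∀ᵐ ω ∂P.μ, -(q P.T ω) = gradient (fun z => P.g z ω) (x P.T ω)

/-- The switching functions `Ψᵢ(t) = ∫ p(t,ω) · fᵢ(x(t,ω),ω) dμ(ω)`, `i = 1,…,m`. -/
def switching (P : Problem n m Ω) (x p : ℝ → Ω → State n) (i : Fin m) (t : ℝ) : ℝ :=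
  ∫ ω, inner ℝ (p t ω) (P.f i.succ (x t ω) ω) ∂P.μ

/-- The set `S(t)` of singular indices. -/
def singularSet (P : Problem n m Ω) (u : ℝ → Fin m → ℝ) (t : ℝ) : Finset (Fin m) :=
  Finset.univ.filter fun i => P.umin i < u t i ∧ u t i < P.umax i

/-- The set `B_min(t)` of lower bang indices. -/
def bangMin (P : Problem n m Ω) (x p : ℝ → Ω → State n) (t : ℝ) : Finset (Fin m) :=
  Finset.univ.filter fun i => P.switching x p i t < 0

/-- The set `B_max(t)` of upper bang indices. -/
def bangMax (P : Problem n m Ω) (x p : ℝ → Ω → State n) (t : ℝ) : Finset (Fin m) :=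
  Finset.univ.filter fun i => 0 < P.switching x p i t

/-- The integrand `p · [fᵢ,[f₀,fⱼ]]`, evaluated at `(x(t,ω),ω)`, for `i,j = 0,…,m`; the bracket
is `[a,b] = b'a - a'b`. -/
def bracketTerm (P : Problem n m Ω) (x p : ℝ → Ω → State n) (i j : Fin (m + 1))
    (t : ℝ) (ω : Ω) : ℝ :=
  inner ℝ (p t ω)
    (VectorField.lieBracket ℝ (fun y => P.f i y ω)
      (VectorField.lieBracket ℝ (fun y => P.f 0 y ω) (fun y => P.f j y ω)) (x t ω))

/-- `W_{ij}(t) = ∫ p · [fᵢ,[f₀,fⱼ]] dμ`, `i,j = 0,…,m`. -/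
def W (P : Problem n m Ω) (x p : ℝ → Ω → State n) (i j : Fin (m + 1)) (t : ℝ) : ℝ :=
  ∫ ω, P.bracketTerm x p i j t ω ∂P.μ

/-- The matrix `W_S(t) = [W_{ij}(t)]_{i,j ∈ S}`. -/
def WS (P : Problem n m Ω) (x p : ℝ → Ω → State n) (S : Finset (Fin m)) (t : ℝ) :
    Matrix S S ℝ :=
  Matrix.of fun i j => P.W x p i.1.succ j.1.succ t

/-- The vector `b_S(t)`:
`bᵢ = W_{0i} + ∑_{j ∈ B_min} W_{ij} umin_j + ∑_{j ∈ B_max} W_{ij} umax_j`. -/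
def bS (P : Problem n m Ω) (x p : ℝ → Ω → State n) (S Bmin Bmax : Finset (Fin m)) (t : ℝ) :
    S → ℝ :=
  fun i => P.W x p 0 i.1.succ t + ∑ j ∈ Bmin, P.W x p i.1.succ j.succ t * P.umin j +
    ∑ j ∈ Bmax, P.W x p i.1.succ j.succ t * P.umax j

end Problem

end EnsembleControl

end

/-! The whole argument rests on one identity: along a state arc and its adjoint arc, the product
rule gives `d/dt (p · G(x)) = p · [f(·,u), G](x)`, because the adjoint equation supplies exactly the
term `-D'G` of the bracket (`hasDerivAt_inner_lieBracket`).

For a singular index `i` the maximum principle forces `Ψ_i = 0` on the interval. Differentiating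
once with `G = f_i`, commutativity removes every bracket `[f_j, f_i]`, so the mean of `p · [f₀,
f_i]` vanishes and the control does not appear. Differentiating again brings it in linearly: `W_{0i}
+ ∑_j u_j W_{ji} = 0`. The Jacobi identity and `[f_i, f_j] = 0` give `W_{ij} = W_{ji}`; on bang
indices `u_j` is the known extreme value, and what is left is the linear system for `u_S`.

The maximum principle comes from convex variations `u + l (v - u)`. They move states and velocities
by `O(l)` (`exists_variation_bound`), so they stay in the neighbourhood of minimality, and the
derivative of the mean cost at `l = 0` is minus the double integral of `p · ∑_j (v_j - u_j) f_j`
(`tendsto_cost_quotient`). Taking `v` extreme wherever `Ψ_j ≠ 0` yields `ae_bang`.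

The remaining work is measure-theoretic. States are given pathwise without measurability in `ω`, and
the adjoint state may be pathwise or `L²`-valued; Picard iteration provides jointly measurable
versions of both, and Grönwall estimates identify them with the given ones. Means are differentiated
by integrating pathwise derivatives, exchanging integrals, and applying Lebesgue differentiation
(`ae_integral_deriv_eq_zero`). Domination holds because `p` is bounded, second brackets grow at most
quadratically, and `φ` is in `L²`. -/

namespace EnsembleControl

/-! ### Grönwall inequalities. -/

section Gronwall

/-- Grönwall's inequality in integral form. -/
theorem le_exp_of_le_add_integral {h : ℝ → ℝ} {a b C K : ℝ} (hh : ContinuousOn h (Icc a b))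
    (hK : 0 ≤ K) (hle : ∀ t ∈ Icc a b, h t ≤ C + K * ∫ s in a..t, h s) :
    ∀ t ∈ Icc a b, h t ≤ C * Real.exp (K * (t - a)) := by
  intro t ht
  have hab : a ≤ b := ht.1.trans ht.2
  -- Extending by the endpoint values makes the primitive differentiable at every real point, so the
  -- differential form of Grönwall applies to `C + K ∫ g`.
  set g : ℝ → ℝ := IccExtend hab ((Icc a b).domRestrict h) with hg
  have hgc : Continuous g := (continuousOn_iff_continuous_domRestrict.1 hh).Icc_extend'
  have hgh : ∀ s ∈ Icc a b, g s = h s := fun s hs => by rw [hg, IccExtend_of_mem _ _ hs]; rfl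
  have hint : ∀ s ∈ Icc a b, ∫ r in a..s, g r = ∫ r in a..s, h r := fun s hs => by
    refine intervalIntegral.integral_congr fun r hr => hgh r ?_
    rw [uIcc_of_le hs.1] at hr
    exact ⟨hr.1, hr.2.trans hs.2⟩
  have hder : ∀ s, HasDerivAt (fun s => C + K * ∫ r in a..s, g r) (K * g s) s := fun s =>
    ((intervalIntegral.integral_hasDerivAt_right (hgc.intervalIntegrable _ _)
      (hgc.stronglyMeasurableAtFilter _ _) hgc.continuousAt).const_mul K).const_add C
  have key := le_gronwallBound_of_liminf_deriv_right_le (f := fun s => C + K * ∫ r in a..s, g r)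
    (f' := fun s => K * g s) (δ := C) (K := K) (ε := 0) (a := a) (b := b)
    (fun s _ => (hder s).continuousAt.continuousWithinAt)
    (fun s _ r hr => (hder s).hasDerivWithinAt.liminf_right_slope_le hr) (by simp)
    (fun s hs => by
      have hs' : s ∈ Icc a b := Ico_subset_Icc_self hs
      have := hle s hs'
      rw [← hint s hs', ← hgh s hs'] at this
      simpa using mul_le_mul_of_nonneg_left this hK) t ht
  rw [gronwallBound_ε0] at key
  refine (hle t ht).trans ?_
  rw [← hint t ht]
  exact key

/-- Grönwall's inequality in integral form, backwards in time. -/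
theorem le_exp_of_le_add_integral_backward {h : ℝ → ℝ} {a b C K : ℝ}
    (hh : ContinuousOn h (Icc a b)) (hK : 0 ≤ K)
    (hle : ∀ t ∈ Icc a b, h t ≤ C + K * ∫ s in t..b, h s) :
    ∀ t ∈ Icc a b, h t ≤ C * Real.exp (K * (b - t)) := by
  have hm : ∀ t ∈ Icc a b, a + b - t ∈ Icc a b := fun t ht =>
    ⟨by linarith [ht.2], by linarith [ht.1]⟩
  intro t ht
  have := le_exp_of_le_add_integral (h := fun s => h (a + b - s)) (a := a) (b := b) (C := C)
    (hh.comp (by fun_prop) fun s hs => hm s hs) hK (fun s hs => by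
      refine (hle _ (hm s hs)).trans (le_of_eq ?_)
      rw [intervalIntegral.integral_comp_sub_left (fun r => h r) (a + b)]
      congr 3
      ring) (a + b - t) (hm t ht)
  simp only [sub_sub_cancel] at this
  convert this using 3
  ring

end Gronwall

/-! ### Arcs given by an integral equation. -/

section Arcs

variable {E : Type*} [NormedAddCommGroup E] [NormedSpace ℝ E]

theorem norm_sub_le_of_eq_add_integral {y v : ℝ → E} {a b M : ℝ}
    (hv : IntervalIntegrable v volume a b)
    (hM : ∀ᵐ s ∂volume.restrict (Icc a b), ‖v s‖ ≤ M)
    (hy : ∀ t ∈ Icc a b, y t = y a + ∫ s in a..t, v s) {s t : ℝ} (hs : s ∈ Icc a b)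
    (ht : t ∈ Icc a b) : ‖y t - y s‖ ≤ M * |t - s| := by
  have hab : a ≤ b := hs.1.trans hs.2
  have h1 : ∀ r ∈ Icc a b, IntervalIntegrable v volume a r := fun r hr =>
    hv.mono_set (by rw [uIcc_of_le hr.1, uIcc_of_le hab]; exact Icc_subset_Icc_right hr.2)
  rw [hy t ht, hy s hs, add_sub_add_left_eq_sub,
    intervalIntegral.integral_interval_sub_left (h1 t ht) (h1 s hs)]
  refine intervalIntegral.norm_integral_le_of_norm_le_const_ae ?_
  have := (ae_restrict_iff' measurableSet_Icc).1 hM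
  filter_upwards [this] with r hr hrm
  refine hr ⟨?_, ?_⟩
  · exact (le_min hs.1 ht.1).trans hrm.1.le
  · exact hrm.2.trans (max_le hs.2 ht.2)

theorem lipschitzOnWith_of_eq_add_integral {y v : ℝ → E} {a b M : ℝ}
    (hv : IntervalIntegrable v volume a b)
    (hM : ∀ᵐ s ∂volume.restrict (Icc a b), ‖v s‖ ≤ M)
    (hy : ∀ t ∈ Icc a b, y t = y a + ∫ s in a..t, v s) :
    LipschitzOnWith M.toNNReal y (Icc a b) := by
  refine LipschitzOnWith.of_dist_le_mul fun t ht s hs => ?_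
  rw [dist_eq_norm, Real.dist_eq]
  refine (norm_sub_le_of_eq_add_integral hv hM hy hs ht).trans ?_
  gcongr
  exact Real.le_coe_toNNReal M

theorem ae_mem_Ioo_restrict_Icc (a b : ℝ) :
    ∀ᵐ t ∂volume.restrict (Icc a b), t ∈ Ioo a b := by
  rw [restrict_Ioo_eq_restrict_Icc.symm]
  exact ae_restrict_mem measurableSet_Ioo

/-- Lebesgue differentiation of the primitive. The endpoints are discarded because the integral
identity holds only on `[a,b]`, while `HasDerivAt` is two-sided. -/
theorem ae_hasDerivAt_of_eq_add_integral [CompleteSpace E] {y v : ℝ → E} {a b : ℝ} (hab : a ≤ b)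
    (hv : IntervalIntegrable v volume a b)
    (hy : ∀ t ∈ Icc a b, y t = y a + ∫ s in a..t, v s) :
    ∀ᵐ t ∂volume.restrict (Icc a b), HasDerivAt y (v t) t := by
  filter_upwards [ae_mem_Ioo_restrict_Icc a b,
    ae_restrict_of_ae (s := Icc a b) hv.ae_hasDerivAt_integral] with t ht h
  rw [uIcc_of_le hab] at h
  refine ((h (Ioo_subset_Icc_self ht) a (left_mem_Icc.2 hab)).const_add (y a)).congr_of_eventuallyEq ?_
  filter_upwards [Ioo_mem_nhds ht.1 ht.2] with s hs
  exact hy s (Ioo_subset_Icc_self hs)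

/-- The fundamental theorem of calculus for a Lipschitz function whose derivative is known almost
everywhere. -/
theorem integral_eq_sub_of_lipschitzOnWith {h h' : ℝ → ℝ} {a b : ℝ} {K : NNReal}
    (hL : LipschitzOnWith K h (Icc a b))
    (hd : ∀ᵐ t ∂volume.restrict (Icc a b), HasDerivAt h (h' t) t) {s t : ℝ} (hs : s ∈ Icc a b)
    (ht : t ∈ Icc a b) :
    IntervalIntegrable h' volume s t ∧ ∫ r in s..t, h' r = h t - h s := by
  have hsub : uIcc s t ⊆ Icc a b := uIcc_subset_Icc hs ht
  have hAC : AbsolutelyContinuousOnInterval h s t := (hL.mono hsub).absolutelyContinuousOnInterval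
  have hcongr : deriv h =ᵐ[volume.restrict (uIoc s t)] h' :=
    (ae_restrict_of_ae_restrict_of_subset (uIoc_subset_uIcc.trans hsub) hd).mono
      fun r hr => hr.deriv
  refine ⟨hAC.intervalIntegrable_deriv.congr_ae hcongr, ?_⟩
  rw [← hAC.integral_deriv_eq_sub]
  refine intervalIntegral.integral_congr_ae_restrict hcongr.symm

end Arcs

end EnsembleControl

namespace EnsembleControl

/-! ### Carathéodory equations with measurable dependence on a parameter. -/

section Caratheodory

set_option linter.unusedSectionVars false

variable {Z E : Type*} [MeasurableSpace Z] [NormedAddCommGroup E] [NormedSpace ℝ E]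
  [CompleteSpace E] [SecondCountableTopology E] [MeasurableSpace E] [BorelSpace E]

/-- The moving endpoint is absorbed into the indicator of a measurable set, leaving an ordinary
parametric integral. -/
theorem measurable_setIntegral_Ioc {G : ℝ × Z → E} (hG : Measurable G) (a : ℝ) :
    Measurable fun q : ℝ × Z => ∫ s in Ioc a q.1, G (s, q.2) := by
  have h1 : (fun q : ℝ × Z => ∫ s in Ioc a q.1, G (s, q.2)) = fun q : ℝ × Z =>
      ∫ s, {r : (ℝ × Z) × ℝ | r.2 ∈ Ioc a r.1.1}.indicator
        (fun r : (ℝ × Z) × ℝ => G (r.2, r.1.2)) (q, s) := by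
    funext q
    rw [← integral_indicator measurableSet_Ioc]
    rfl
  rw [h1]
  have hS : MeasurableSet {r : (ℝ × Z) × ℝ | r.2 ∈ Ioc a r.1.1} :=
    (measurableSet_lt measurable_const measurable_snd).inter
      (measurableSet_le measurable_snd (measurable_fst.comp measurable_fst))
  have hGm : Measurable fun r : (ℝ × Z) × ℝ => G (r.2, r.1.2) :=
    hG.comp (measurable_snd.prodMk (measurable_snd.comp measurable_fst))
  exact (StronglyMeasurable.integral_prod_right (ν := volume)
    (f := fun q s => {r : (ℝ × Z) × ℝ | r.2 ∈ Ioc a r.1.1}.indicator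
      (fun r : (ℝ × Z) × ℝ => G (r.2, r.1.2)) (q, s))
    (hGm.indicator hS).stronglyMeasurable).measurable

/-- Picard iterates for `ẋ = F(t,z,x)`, `x(a) = ξ(z)`. -/
noncomputable def picardIter (a : ℝ) (F : ℝ → Z → E → E) (ξ : Z → E) : ℕ → ℝ × Z → E
  | 0 => fun q => ξ q.2
  | k + 1 => fun q => ξ q.2 + ∫ s in Ioc a q.1, F s q.2 (picardIter a F ξ k (s, q.2))

variable {a b K : ℝ} {F : ℝ → Z → E → E} {C : Z → ℝ} {ξ : Z → E}

theorem measurable_picardIter (hF : Measurable fun q : ℝ × Z × E => F q.1 q.2.1 q.2.2)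
    (hξ : Measurable ξ) (k : ℕ) : Measurable (picardIter a F ξ k) := by
  induction k with
  | zero => exact hξ.comp measurable_snd
  | succ k ih =>
    refine (hξ.comp measurable_snd).add
      (measurable_setIntegral_Ioc (G := fun q => F q.1 q.2 (picardIter a F ξ k q)) ?_ a)
    exact hF.comp (measurable_fst.prodMk (measurable_snd.prodMk ih))

theorem integrableOn_caratheodory (hF : Measurable fun q : ℝ × Z × E => F q.1 q.2.1 q.2.2)
    (hK : 0 ≤ K)
    (hL : ∀ t z x y, ‖F t z x - F t z y‖ ≤ K * ‖x - y‖) (hC : ∀ t z, ‖F t z 0‖ ≤ C z)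
    {z : Z} {y : ℝ → E} {D : ℝ} (hy : AEStronglyMeasurable y (volume.restrict (Icc a b)))
    (hD : ∀ s ∈ Icc a b, ‖y s‖ ≤ D) :
    IntegrableOn (fun s => F s z (y s)) (Icc a b) := by
  refine Integrable.of_bound (C := K * D + C z) ?_ ?_
  · exact (hF.comp_aemeasurable (aemeasurable_id.prodMk ((aemeasurable_const (b := z)).prodMk
      hy.aemeasurable))).aestronglyMeasurable
  · filter_upwards [ae_restrict_mem measurableSet_Icc] with s hs
    have h1 := hL s z (y s) 0
    rw [sub_zero] at h1
    calc ‖F s z (y s)‖ = ‖(F s z (y s) - F s z 0) + F s z 0‖ := by rw [sub_add_cancel]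
      _ ≤ K * ‖y s‖ + C z := (norm_add_le _ _).trans (add_le_add h1 (hC s z))
      _ ≤ K * D + C z := by gcongr; exact hD s hs

/-- Existence goes through explicit Picard iterates because joint measurability in time and
parameter then passes to the limit. The weight `exp(2K(t-a))` makes the iteration contract by `1/2`
on the whole interval, whatever its length; no uniformity in `z` of the bound `C z` is needed. -/
theorem exists_caratheodory_solution (hab : a ≤ b)
    (hF : Measurable fun q : ℝ × Z × E => F q.1 q.2.1 q.2.2) (hK : 0 < K)
    (hL : ∀ t z x y, ‖F t z x - F t z y‖ ≤ K * ‖x - y‖) (hC : ∀ t z, ‖F t z 0‖ ≤ C z)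
    (hξ : Measurable ξ) :
    ∃ X : ℝ → Z → E, (Measurable fun q : ℝ × Z => X q.1 q.2) ∧ (∀ z, Continuous fun t => X t z) ∧
      ∀ z, ∀ t ∈ Icc a b, X t z = ξ z + ∫ s in a..t, F s z (X s z) := by
  set x := picardIter a F ξ with hx
  have hxm : ∀ k, Measurable (x k) := measurable_picardIter hF hξ
  have hxmz : ∀ k z, Measurable fun s => x k (s, z) := fun k z =>
    (hxm k).comp (measurable_id.prodMk measurable_const)
  -- iterates are bounded
  have hbd : ∀ k z, ∃ D, ∀ s ∈ Icc a b, ‖x k (s, z)‖ ≤ D := by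
    intro k z
    induction k with
    | zero => exact ⟨‖ξ z‖, fun s _ => le_rfl⟩
    | succ k ih =>
      obtain ⟨D, hD⟩ := ih
      have hi := integrableOn_caratheodory (z := z) hF hK.le hL hC (hxmz k z).aestronglyMeasurable hD
      refine ⟨‖ξ z‖ + ∫ s in Icc a b, ‖F s z (x k (s, z))‖, fun s hs => ?_⟩
      refine (norm_add_le _ _).trans (add_le_add le_rfl ?_)
      refine (norm_integral_le_integral_norm _).trans ?_
      refine setIntegral_mono_set hi.norm (Eventually.of_forall fun _ => norm_nonneg _) ?_
      exact (Ioc_subset_Icc_self.trans (Icc_subset_Icc_right hs.2)).eventuallyLE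
  have hint : ∀ k z, IntegrableOn (fun s => F s z (x k (s, z))) (Icc a b) := fun k z =>
    integrableOn_caratheodory hF hK.le hL hC (hxmz k z).aestronglyMeasurable (hbd k z).choose_spec
  have hstep : ∀ k z t, t ∈ Icc a b → x (k + 1) (t, z) = ξ z + ∫ s in a..t, F s z (x k (s, z)) :=
    fun k z t ht => by rw [intervalIntegral.integral_of_le ht.1, hx]; rfl
  have hii : ∀ (y : ℝ → E) t, t ∈ Icc a b → IntegrableOn y (Icc a b) →
      IntervalIntegrable y volume a t := fun y t ht h =>
    (intervalIntegrable_iff_integrableOn_Ioc_of_le ht.1).2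
      (h.mono_set (Ioc_subset_Icc_self.trans (Icc_subset_Icc_right ht.2)))
  -- geometric convergence in a weighted norm
  have hgeo : ∀ z, ∃ M, 0 ≤ M ∧ ∀ k, ∀ t ∈ Icc a b,
      ‖x (k + 1) (t, z) - x k (t, z)‖ ≤ M * (1 / 2) ^ k * Real.exp (2 * K * (t - a)) := by
    intro z
    obtain ⟨D, hD⟩ := hbd 1 z
    refine ⟨|D| + ‖ξ z‖, by positivity, fun k => ?_⟩
    induction k with
    | zero =>
      intro t ht
      have h1 : (1 : ℝ) ≤ Real.exp (2 * K * (t - a)) :=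
        Real.one_le_exp (mul_nonneg (by positivity) (by linarith [ht.1]))
      calc ‖x (0 + 1) (t, z) - x 0 (t, z)‖ ≤ ‖x 1 (t, z)‖ + ‖x 0 (t, z)‖ := norm_sub_le _ _
        _ ≤ |D| + ‖ξ z‖ := add_le_add ((hD t ht).trans (le_abs_self D)) le_rfl
        _ ≤ (|D| + ‖ξ z‖) * (1 / 2) ^ 0 * Real.exp (2 * K * (t - a)) := by
          rw [pow_zero, mul_one]; exact le_mul_of_one_le_right (by positivity) h1
    | succ k ih =>
      intro t ht
      set M := |D| + ‖ξ z‖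
      -- The Lipschitz factor `K` against the exponential rate `2K` produces the ratio `1/2`.
      have hexp : ∀ s, HasDerivAt (fun s => M * (1 / 2) ^ (k + 1) * Real.exp (2 * K * (s - a)))
          (K * (M * (1 / 2) ^ k * Real.exp (2 * K * (s - a)))) s := by
        intro s
        have := (((((hasDerivAt_id s).sub_const a).const_mul (2 * K)).exp).const_mul
          (M * (1 / 2) ^ (k + 1)))
        exact this.congr_deriv (by simp only [id]; ring)
      have hcont : Continuous fun s => K * (M * (1 / 2) ^ k * Real.exp (2 * K * (s - a))) := by
        fun_prop
      rw [hstep (k + 1) z t ht, hstep k z t ht, add_sub_add_left_eq_sub,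
        ← intervalIntegral.integral_sub (hii _ t ht (hint (k + 1) z)) (hii _ t ht (hint k z))]
      calc _ ≤ ∫ s in a..t, K * (M * (1 / 2) ^ k * Real.exp (2 * K * (s - a))) := by
            refine intervalIntegral.norm_integral_le_of_norm_le ht.1 ?_
              (hcont.intervalIntegrable _ _)
            refine Eventually.of_forall fun s hs => (hL _ _ _ _).trans ?_
            gcongr
            exact ih s ⟨hs.1.le, hs.2.trans ht.2⟩
        _ = M * (1 / 2) ^ (k + 1) * Real.exp (2 * K * (t - a)) -
            M * (1 / 2) ^ (k + 1) * Real.exp (2 * K * (a - a)) :=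
          intervalIntegral.integral_eq_sub_of_hasDerivAt (fun s _ => hexp s)
            (hcont.intervalIntegrable _ _)
        _ ≤ _ := by
          rw [sub_le_self_iff]; positivity
  choose M hM0 hM using hgeo
  have hdist : ∀ z, ∀ t ∈ Icc a b, ∀ k, dist (x k (t, z)) (x (k + 1) (t, z)) ≤
      M z * Real.exp (2 * K * (b - a)) * (1 / 2) ^ k := fun z t ht k => by
    rw [dist_comm, dist_eq_norm]
    refine (hM z k t ht).trans ?_
    rw [mul_right_comm]
    have := hM0 z
    gcongr
    exact ht.2
  -- Clamping time to `[a,b]` makes the limit exist for every real `t`, so the solution is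
  -- measurable and continuous globally.
  set c : ℝ → ℝ := fun t => max a (min b t) with hc
  have hcI : ∀ t, c t ∈ Icc a b := fun t =>
    ⟨le_max_left _ _, max_le hab (min_le_left _ _)⟩
  have hcc : Continuous c := by fun_prop
  have hcid : ∀ t ∈ Icc a b, c t = t := fun t ht => by simp [hc, ht.1, ht.2]
  have hlim : ∀ t z, ∃ l, Tendsto (fun k => x k (c t, z)) atTop (𝓝 l) := fun t z =>
    cauchySeq_tendsto_of_complete
      (cauchySeq_of_le_geometric (1 / 2) _ (by norm_num) (hdist z (c t) (hcI t)))
  choose X hX using hlim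
  have hXm : Measurable fun q : ℝ × Z => X q.1 q.2 :=
    measurable_of_tendsto_metrizable (f := fun k (q : ℝ × Z) => x k (c q.1, q.2))
      (fun k => (hxm k).comp ((hcc.measurable.comp measurable_fst).prodMk measurable_snd))
      (tendsto_pi_nhds.2 fun q => hX q.1 q.2)
  have hXd : ∀ z, ∀ t ∈ Icc a b, ∀ k, ‖x k (t, z) - X t z‖ ≤
      M z * Real.exp (2 * K * (b - a)) * (1 / 2) ^ k / (1 - 1 / 2) := fun z t ht k => by
    rw [← dist_eq_norm]
    have h := hX t z
    rw [hcid t ht] at h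
    exact dist_le_of_le_geometric_of_tendsto (1 / 2) _ (by norm_num) (hdist z t ht) h k
  have hXmz : ∀ z, Measurable fun s => X s z := fun z =>
    hXm.comp (measurable_id.prodMk measurable_const)
  have hXint : ∀ z, IntegrableOn (fun s => F s z (X s z)) (Icc a b) := fun z => by
    refine integrableOn_caratheodory hF hK.le hL hC (hXmz z).aestronglyMeasurable
      (D := ‖ξ z‖ + M z * Real.exp (2 * K * (b - a)) * (1 / 2) ^ 0 / (1 - 1 / 2)) fun s hs => ?_
    have h1 : x 0 (s, z) = ξ z := rfl
    have h2 := hXd z s hs 0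
    rw [h1, norm_sub_rev] at h2
    calc ‖X s z‖ = ‖ξ z + (X s z - ξ z)‖ := by rw [add_sub_cancel]
      _ ≤ _ := (norm_add_le _ _).trans (add_le_add le_rfl h2)
  have heq : ∀ z, ∀ t ∈ Icc a b, X t z = ξ z + ∫ s in a..t, F s z (X s z) := by
    intro z t ht
    have h1 : Tendsto (fun k => x (k + 1) (t, z)) atTop (𝓝 (X t z)) := by
      have h := hX t z
      rw [hcid t ht] at h
      exact h.comp (tendsto_add_atTop_nat 1)
    refine tendsto_nhds_unique h1 ?_
    rw [tendsto_iff_norm_sub_tendsto_zero]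
    have hlim0 : Tendsto (fun k : ℕ => K * (M z * Real.exp (2 * K * (b - a)) * (1 / 2) ^ k /
        (1 - 1 / 2)) * |t - a|) atTop (𝓝 0) := by
      have := (tendsto_pow_atTop_nhds_zero_of_lt_one (r := (1 / 2 : ℝ)) (by norm_num)
        (by norm_num)).const_mul (K * (M z * Real.exp (2 * K * (b - a))) / (1 - 1 / 2) * |t - a|)
      rw [mul_zero] at this
      refine this.congr fun k => by ring
    refine squeeze_zero (fun _ => norm_nonneg _) (fun k => ?_) hlim0
    rw [hstep k z t ht, add_sub_add_left_eq_sub,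
      ← intervalIntegral.integral_sub (hii _ t ht (hint k z)) (hii _ t ht (hXint z))]
    refine intervalIntegral.norm_integral_le_of_norm_le_const fun s hs => ?_
    rw [uIoc_of_le ht.1] at hs
    refine (hL _ _ _ _).trans ?_
    gcongr
    exact hXd z s ⟨hs.1.le, hs.2.trans ht.2⟩ k
  refine ⟨X, hXm, fun z => ?_, heq⟩
  have h1 : ∀ t, X t z = ξ z + ∫ s in a..c t, F s z (X s z) := fun t => by
    have h2 : X t z = X (c t) z := by
      have h := hX (c t) z
      rw [hcid _ (hcI t)] at h
      exact tendsto_nhds_unique (hX t z) h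
    rw [h2, heq z (c t) (hcI t)]
  have h3 : ContinuousOn (fun t => ∫ s in a..t, F s z (X s z)) (Icc a b) := by
    have := intervalIntegral.continuousOn_primitive_interval' (a := a) (b₁ := a) (b₂ := b)
      (hii _ b ⟨hab, le_rfl⟩ (hXint z)) left_mem_uIcc
    rwa [uIcc_of_le hab] at this
  have h4 : Continuous fun t => ∫ s in a..c t, F s z (X s z) :=
    h3.comp_continuous hcc hcI
  exact (continuous_const.add h4).congr fun t => (h1 t).symm

/-- Measurable dependence for terminal value problems. -/
theorem exists_caratheodory_solution_backward (hab : a ≤ b)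
    (hF : Measurable fun q : ℝ × Z × E => F q.1 q.2.1 q.2.2) (hK : 0 < K)
    (hL : ∀ t z x y, ‖F t z x - F t z y‖ ≤ K * ‖x - y‖) (hC : ∀ t z, ‖F t z 0‖ ≤ C z)
    (hξ : Measurable ξ) :
    ∃ X : ℝ → Z → E, (Measurable fun q : ℝ × Z => X q.1 q.2) ∧ (∀ z, Continuous fun t => X t z) ∧
      ∀ z, ∀ t ∈ Icc a b, X t z = ξ z + ∫ s in t..b, F s z (X s z) := by
  obtain ⟨X, hXm, hXc, hX⟩ := exists_caratheodory_solution (F := fun s => F (a + b - s)) (C := C)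
    hab (hF.comp ((measurable_const.sub measurable_fst).prodMk measurable_snd)) hK
    (fun t => hL (a + b - t)) (fun t => hC (a + b - t)) hξ
  refine ⟨fun t => X (a + b - t),
    hXm.comp ((measurable_const.sub measurable_fst).prodMk measurable_snd),
    fun z => (hXc z).comp (by fun_prop), fun z t ht => ?_⟩
  beta_reduce
  rw [hX z (a + b - t) ⟨by linarith [ht.2], by linarith [ht.1]⟩]
  have := intervalIntegral.integral_comp_sub_left (a := a) (b := a + b - t)
    (fun r => F r z (X (a + b - r) z)) (a + b)
  simp only [sub_sub_cancel, add_sub_cancel_left] at this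
  rw [this]

/-- Uniqueness for Lipschitz Carathéodory equations. -/
theorem eqOn_of_caratheodory {G : ℝ → E → E} {y z : ℝ → E} {η : E} (hK : 0 ≤ K)
    (hL : ∀ᵐ t ∂volume.restrict (Icc a b), ‖G t (y t) - G t (z t)‖ ≤ K * ‖y t - z t‖)
    (hyc : ContinuousOn y (Icc a b)) (hzc : ContinuousOn z (Icc a b))
    (hyi : IntervalIntegrable (fun s => G s (y s)) volume a b)
    (hzi : IntervalIntegrable (fun s => G s (z s)) volume a b)
    (hy : ∀ t ∈ Icc a b, y t = η + ∫ s in a..t, G s (y s))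
    (hz : ∀ t ∈ Icc a b, z t = η + ∫ s in a..t, G s (z s)) : EqOn y z (Icc a b) := by
  intro t ht
  have hab : a ≤ b := ht.1.trans ht.2
  have hsub : ∀ s ∈ Icc a b, uIcc a s ⊆ uIcc a b := fun s hs => by
    rw [uIcc_of_le hs.1, uIcc_of_le hab]; exact Icc_subset_Icc_right hs.2
  have key := le_exp_of_le_add_integral (h := fun t => ‖y t - z t‖) (C := 0) (K := K)
    (hyc.sub hzc).norm hK (fun s hs => by
      rw [hy s hs, hz s hs, add_sub_add_left_eq_sub, zero_add,
        ← intervalIntegral.integral_sub (hyi.mono_set (hsub s hs)) (hzi.mono_set (hsub s hs)),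
        ← intervalIntegral.integral_const_mul]
      refine intervalIntegral.norm_integral_le_of_norm_le hs.1 ?_ ?_
      · filter_upwards [(ae_restrict_iff' measurableSet_Icc).1 hL] with r hr hrm
        exact hr ⟨hrm.1.le, hrm.2.trans hs.2⟩
      · refine ContinuousOn.intervalIntegrable ?_
        rw [uIcc_of_le hs.1]
        exact ((hyc.sub hzc).norm.const_smul K).mono (Icc_subset_Icc_right hs.2)) t ht
  simp only [zero_mul, norm_le_zero_iff, sub_eq_zero] at key
  exact key

end Caratheodory

end EnsembleControl

namespace EnsembleControl

set_option linter.unusedSectionVars false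

/-! ### Measurable versions of derivatives and brackets. -/

section DirectionalDerivative

variable {Z E F : Type*} [MeasurableSpace Z] [NormedAddCommGroup E] [NormedSpace ℝ E]
  [SecondCountableTopology E] [MeasurableSpace E] [BorelSpace E]
  [NormedAddCommGroup F] [NormedSpace ℝ F] [CompleteSpace F]
  [SecondCountableTopology F] [MeasurableSpace F] [BorelSpace F]

/-- The derivative of `V(·,z)` in direction `d`, as a limit of a sequence of difference
quotients. -/
noncomputable def seqDirDeriv (V : E × Z → F) (d : E × Z → E) (q : E × Z) : F :=
  limUnder atTop fun k : ℕ =>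
    ((k : ℝ) + 1) • (V (q.1 + ((k : ℝ) + 1)⁻¹ • d q, q.2) - V q)

/-- A fixed sequence of step sizes keeps the limit countable, and `limUnder` is measurable also
where the quotients diverge; no differentiability is required. -/
theorem measurable_seqDirDeriv {V : E × Z → F} {d : E × Z → E} (hV : Measurable V)
    (hd : Measurable d) : Measurable (seqDirDeriv V d) := by
  refine (StronglyMeasurable.limUnder (l := atTop) (f := fun (k : ℕ) (q : E × Z) =>
    ((k : ℝ) + 1) • (V (q.1 + ((k : ℝ) + 1)⁻¹ • d q, q.2) - V q)) fun k => ?_).measurable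
  refine Measurable.stronglyMeasurable ?_
  refine Measurable.const_smul ?_ ((k : ℝ) + 1)
  exact (hV.comp ((measurable_fst.add (hd.const_smul _)).prodMk measurable_snd)).sub hV

theorem tendsto_quotient_of_hasFDerivAt {f : E → F} {f' : E →L[ℝ] F} {y v : E}
    (hf : HasFDerivAt f f' y) :
    Tendsto (fun k : ℕ => ((k : ℝ) + 1) • (f (y + ((k : ℝ) + 1)⁻¹ • v) - f y)) atTop
      (𝓝 (f' v)) := by
  have hc : Tendsto (fun k : ℕ => ‖(k : ℝ) + 1‖) atTop atTop :=
    tendsto_norm_atTop_atTop.comp (tendsto_natCast_atTop_atTop.atTop_add tendsto_const_nhds)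
  exact hf.lim v hc

theorem seqDirDeriv_eq {V : E × Z → F} {d : E × Z → E} {y : E} {z : Z}
    (h : DifferentiableAt ℝ (fun y => V (y, z)) y) :
    seqDirDeriv V d (y, z) = fderiv ℝ (fun y => V (y, z)) y (d (y, z)) :=
  (tendsto_quotient_of_hasFDerivAt h.hasFDerivAt).limUnder_eq

end DirectionalDerivative

section Bracket

variable {Z E : Type*} [MeasurableSpace Z] [NormedAddCommGroup E] [NormedSpace ℝ E]
  [CompleteSpace E] [SecondCountableTopology E] [MeasurableSpace E] [BorelSpace E]

/-- A measurable version of the Lie bracket of parametrized vector fields. -/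
noncomputable def seqBracket (V W : E × Z → E) (q : E × Z) : E :=
  seqDirDeriv W V q - seqDirDeriv V W q

theorem measurable_seqBracket {V W : E × Z → E} (hV : Measurable V) (hW : Measurable W) :
    Measurable (seqBracket V W) :=
  (measurable_seqDirDeriv hW hV).sub (measurable_seqDirDeriv hV hW)

theorem seqBracket_eq {V W : E × Z → E} {y : E} {z : Z}
    (hV : DifferentiableAt ℝ (fun y => V (y, z)) y)
    (hW : DifferentiableAt ℝ (fun y => W (y, z)) y) :
    seqBracket V W (y, z) =
      VectorField.lieBracket ℝ (fun y => V (y, z)) (fun y => W (y, z)) y := by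
  rw [seqBracket, seqDirDeriv_eq hV, seqDirDeriv_eq hW]
  rfl

/-- The outer bracket differentiates the inner one, so agreement of the inner versions at `y` alone
is not enough; it holds on a neighbourhood because being `C²` is an open condition. -/
theorem seqBracket_seqBracket_eq {U V W : E × Z → E} {y : E} {z : Z}
    (hU : DifferentiableAt ℝ (fun y => U (y, z)) y)
    (hV : ContDiffAt ℝ 2 (fun y => V (y, z)) y) (hW : ContDiffAt ℝ 2 (fun y => W (y, z)) y) :
    seqBracket U (seqBracket V W) (y, z) =
      VectorField.lieBracket ℝ (fun y => U (y, z))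
        (VectorField.lieBracket ℝ (fun y => V (y, z)) (fun y => W (y, z))) y := by
  have he : (fun y => seqBracket V W (y, z)) =ᶠ[𝓝 y]
      VectorField.lieBracket ℝ (fun y => V (y, z)) (fun y => W (y, z)) := by
    filter_upwards [hV.eventually (by simp), hW.eventually (by simp)] with w hv hw
    exact seqBracket_eq (hv.differentiableAt (by simp)) (hw.differentiableAt (by simp))
  have hd : DifferentiableAt ℝ (fun y => seqBracket V W (y, z)) y :=
    ((ContDiffAt.lieBracket_vectorField hV hW (m := 1) (by norm_num)).differentiableAt
      (by simp)).congr_of_eventuallyEq he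
  rw [seqBracket_eq hU hd]
  exact (EventuallyEq.refl _ _).lieBracket_vectorField_eq he

end Bracket

/-! ### Expansions, density and exchange of null sets. -/

section Remainder

variable {E F : Type*} [NormedAddCommGroup E] [NormedSpace ℝ E] [NormedAddCommGroup F]
  [NormedSpace ℝ F]

/-- First order expansion along bounded, possibly non-convergent, directions. -/
theorem tendsto_expansion_of_hasFDerivAt {f : E → F} {f' : E →L[ℝ] F} {x : E}
    (hf : HasFDerivAt f f' x) {l : ℕ → ℝ} (hl0 : ∀ k, 0 < l k) (hl : Tendsto l atTop (𝓝 0))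
    {y : ℕ → E} {C : ℝ} (hy : ∀ k, ‖y k - x‖ ≤ l k * C) :
    Tendsto (fun k => (l k)⁻¹ • (f (y k) - f x - f' (y k - x))) atTop (𝓝 0) := by
  have hyx : Tendsto y atTop (𝓝 x) := by
    rw [tendsto_iff_norm_sub_tendsto_zero]
    refine squeeze_zero (fun _ => norm_nonneg _) hy ?_
    simpa using hl.mul_const C
  have h1 := hf.isLittleO.comp_tendsto hyx
  have h2 : (fun k => y k - x) =O[atTop] l :=
    Asymptotics.IsBigO.of_bound C (Eventually.of_forall fun k => by
      rw [Real.norm_of_nonneg (hl0 k).le, mul_comm]; exact hy k)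
  have h3 := (h1.trans_isBigO h2)
  have h4 := h3.norm_left.tendsto_div_nhds_zero
  rw [tendsto_zero_iff_norm_tendsto_zero]
  refine h4.congr fun k => ?_
  rw [norm_smul, norm_inv, Real.norm_of_nonneg (hl0 k).le, div_eq_inv_mul]
  rfl

end Remainder

section Density

/-- Every relative neighbourhood of `t` has positive measure. This upgrades regularity known for
a.e. time to every time, by continuity of the arcs. -/
theorem frequently_nhdsWithin_of_ae {a b : ℝ} (hab : a < b) {q : ℝ → Prop}
    (hq : ∀ᵐ s ∂volume.restrict (Icc a b), q s) {t : ℝ} (ht : t ∈ Icc a b) :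
    ∃ᶠ s in 𝓝[Icc a b] t, q s := by
  intro hn
  rw [eventually_nhdsWithin_iff] at hn
  have hcl : t ∈ closure (Ioo a b) := by rwa [closure_Ioo hab.ne]
  obtain ⟨O, hO, hOo, htO⟩ := eventually_nhds_iff.1 hn
  obtain ⟨r, hrO, hr⟩ := mem_closure_iff.1 hcl O hOo htO
  have hpos : 0 < volume (O ∩ Ioo a b) := (hOo.inter isOpen_Ioo).measure_pos _ ⟨r, hrO, hr⟩
  rw [ae_restrict_iff' measurableSet_Icc, ae_iff] at hq
  refine hpos.ne' (measure_mono_null (fun s hs => ?_) hq)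
  simp only [mem_ofPred_eq, Classical.not_imp]
  exact ⟨Ioo_subset_Icc_self hs.2, hO s hs.1 (Ioo_subset_Icc_self hs.2)⟩

end Density

section DerivativeSwap

variable {Z E : Type*} [MeasurableSpace Z] [NormedAddCommGroup E] [NormedSpace ℝ E]
  [SecondCountableTopology E] [MeasurableSpace E] [BorelSpace E]

/-- For continuous `y` the difference estimate is a closed condition in `s`, so rational tests
suffice. Differentiability becomes a countable combination of inequalities, hence a measurable
condition. -/
theorem hasDerivAt_iff_rat {y : ℝ → E} (hy : Continuous y) {d : E} {t : ℝ} :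
    HasDerivAt y d t ↔ ∀ e : ℚ, 0 < e → ∃ r : ℚ, 0 < r ∧ ∀ s : ℚ, |(s : ℝ)| < r →
      ‖y (t + s) - y t - (s : ℝ) • d‖ ≤ e * |(s : ℝ)| := by
  rw [hasDerivAt_iff_isLittleO_nhds_zero, Asymptotics.isLittleO_iff]
  constructor
  · intro h e he
    obtain ⟨r, hr, hr'⟩ := Metric.eventually_nhds_iff.1 (h (c := e) (by exact_mod_cast he))
    obtain ⟨r₁, hr1, hr2⟩ := exists_rat_btwn hr
    refine ⟨r₁, by exact_mod_cast hr1, fun s hs => ?_⟩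
    exact hr' (by rw [dist_zero_right, Real.norm_eq_abs]; exact hs.trans hr2)
  · intro h c hc
    obtain ⟨e, he0, hec⟩ := exists_rat_btwn hc
    obtain ⟨r, hr, hr'⟩ := h e (by exact_mod_cast he0)
    refine Metric.eventually_nhds_iff.2 ⟨r, by exact_mod_cast hr, fun s hs => ?_⟩
    rw [dist_zero_right, Real.norm_eq_abs] at hs
    have hcl : s ∈ closure ((fun q : ℚ => (q : ℝ)) '' {q : ℚ | |(q : ℝ)| < r}) := by
      rw [mem_closure_iff]
      intro O hO hsO
      obtain ⟨q, hq⟩ := Rat.denseRange_cast (𝕜 := ℝ).exists_mem_open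
        (hO.inter (isOpen_lt continuous_abs continuous_const : IsOpen {x : ℝ | |x| < r})) ⟨s, hsO, hs⟩
      exact ⟨q, hq.1, q, hq.2, rfl⟩
    have hclosed : IsClosed {s : ℝ | ‖y (t + s) - y t - s • d‖ ≤ e * |s|} :=
      isClosed_le (by fun_prop) (by fun_prop)
    have := hclosed.closure_subset_iff.2 (by rintro _ ⟨q, hq, rfl⟩; exact hr' q hq) hcl
    refine le_trans this ?_
    rw [Real.norm_eq_abs]
    gcongr

/-- Exchanging the two "almost every" quantifiers needs measurability of the set of
differentiability, which the rational criterion provides. -/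
theorem ae_ae_hasDerivAt_comm {ν : Measure Z} [SFinite ν] {m : Measure ℝ} [SFinite m]
    {X d : ℝ → Z → E} (hX : Measurable fun q : ℝ × Z => X q.1 q.2)
    (hXc : ∀ z, Continuous fun t => X t z) (hd : Measurable fun q : ℝ × Z => d q.1 q.2)
    (h : ∀ᵐ z ∂ν, ∀ᵐ t ∂m, HasDerivAt (fun s => X s z) (d t z) t) :
    ∀ᵐ t ∂m, ∀ᵐ z ∂ν, HasDerivAt (fun s => X s z) (d t z) t := by
  refine (Measure.ae_ae_comm (p := fun t z => HasDerivAt (fun s => X s z) (d t z) t) ?_).2 h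
  have : {q : ℝ × Z | HasDerivAt (fun s => X s q.2) (d q.1 q.2) q.1} =
      ⋂ (e : ℚ) (_ : 0 < e), ⋃ (r : ℚ) (_ : 0 < r), ⋂ (s : ℚ) (_ : |(s : ℝ)| < r),
        {q | ‖X (q.1 + s) q.2 - X q.1 q.2 - (s : ℝ) • d q.1 q.2‖ ≤ e * |(s : ℝ)|} := by
    ext q
    simp only [mem_ofPred_eq, mem_iInter, mem_iUnion, exists_prop, hasDerivAt_iff_rat (hXc q.2)]
  rw [this]
  refine MeasurableSet.iInter fun e => MeasurableSet.iInter fun _ => MeasurableSet.iUnion fun r =>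
    MeasurableSet.iUnion fun _ => MeasurableSet.iInter fun s => MeasurableSet.iInter fun _ => ?_
  refine measurableSet_le (Measurable.norm ?_) measurable_const
  refine ((Measurable.sub ?_ hX)).sub (hd.const_smul (s : ℝ))
  exact hX.comp ((measurable_fst.add_const _).prodMk measurable_snd)

end DerivativeSwap

/-! ### Differentiating a mean. -/

section MeanDerivative

variable {Ω : Type*} [MeasurableSpace Ω] {μ : Measure Ω}

/-- If the mean of a family of Lipschitz arcs vanishes almost everywhere on an interval, so does
the mean of the derivatives. -/
theorem ae_integral_deriv_eq_zero [SFinite μ] {t₀ T a b : ℝ} (ha : t₀ ≤ a) (hab : a < b) (hb : b ≤ T)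
    {h k : ℝ → Ω → ℝ} {B : Ω → ℝ} (hB : Integrable B μ)
    (hhi : ∀ t ∈ Icc t₀ T, Integrable (h t) μ)
    (hlip : ∀ᵐ ω ∂μ, ∃ L, LipschitzOnWith L (fun t => h t ω) (Icc t₀ T))
    (hder : ∀ᵐ ω ∂μ, ∀ᵐ t ∂volume.restrict (Icc t₀ T), HasDerivAt (fun s => h s ω) (k t ω) t)
    (hkm : AEStronglyMeasurable (fun q : ℝ × Ω => k q.1 q.2)
      ((volume.restrict (Icc t₀ T)).prod μ))
    (hkB : ∀ᵐ q ∂(volume.restrict (Icc t₀ T)).prod μ, |k q.1 q.2| ≤ B q.2)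
    (hzero : ∀ᵐ t ∂volume.restrict (Ioo a b), ∫ ω, h t ω ∂μ = 0) :
    ∀ᵐ t ∂volume.restrict (Ioo a b), ∫ ω, k t ω ∂μ = 0 := by
  have hT : t₀ ≤ T := ha.trans (hab.le.trans hb)
  have hki : Integrable (fun q : ℝ × Ω => k q.1 q.2) ((volume.restrict (Icc t₀ T)).prod μ) :=
    (hB.comp_snd (volume.restrict (Icc t₀ T))).mono' hkm hkB
  have hsub : Ioo a b ⊆ Icc t₀ T :=
    Ioo_subset_Icc_self.trans (Icc_subset_Icc ha hb)
  set κ : ℝ → ℝ := fun t => ∫ ω, k t ω ∂μ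
  have hκ : IntegrableOn κ (Icc t₀ T) := hki.integral_prod_left
  have hκi : IntervalIntegrable κ volume t₀ T :=
    (intervalIntegrable_iff_integrableOn_Icc_of_le hT).2 hκ
  -- Pathwise fundamental theorem of calculus followed by Fubini: the mean is a primitive of the
  -- mean derivative `κ`.
  have hincr : ∀ s ∈ Icc t₀ T, ∀ t ∈ Icc t₀ T, s ≤ t →
      (∫ ω, h t ω ∂μ) - ∫ ω, h s ω ∂μ = ∫ r in s..t, κ r := by
    intro s hs t ht hst
    rw [← integral_sub (hhi t ht) (hhi s hs)]
    have h1 : ∀ᵐ ω ∂μ, h t ω - h s ω = ∫ r in Ioc s t, k r ω := by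
      filter_upwards [hlip, hder] with ω ⟨L, hL⟩ hd
      rw [← intervalIntegral.integral_of_le hst, (integral_eq_sub_of_lipschitzOnWith hL hd hs ht).2]
    rw [integral_congr_ae h1, intervalIntegral.integral_of_le hst]
    have hsub2 : Ioc s t ⊆ Icc t₀ T := Ioc_subset_Icc_self.trans (Icc_subset_Icc hs.1 ht.2)
    have hki2 : Integrable (fun q : ℝ × Ω => k q.1 q.2) ((volume.restrict (Ioc s t)).prod μ) :=
      hki.mono_measure (Measure.prod_mono (Measure.restrict_mono_set _ hsub2) le_rfl)
    exact integral_integral_swap (f := fun ω r => k r ω) hki2.swap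
  have hI0 : ∀ᵐ s ∂volume.restrict (Ioo a b), s ∈ Ioo a b := ae_restrict_mem measurableSet_Ioo
  -- The interval has positive measure, which supplies a base point `c` where the mean vanishes.
  have : NeZero (volume.restrict (Ioo a b)) :=
    ⟨by rw [Ne, Measure.restrict_eq_zero]; simpa using hab⟩
  obtain ⟨c, hc, hcm⟩ := (hzero.and hI0).exists
  have hcT := hsub hcm
  have hcont : ContinuousOn (fun t => ∫ r in c..t, κ r) (Icc t₀ T) := by
    have := intervalIntegral.continuousOn_primitive_interval' hκi (by rwa [uIcc_of_le hT])
    rwa [uIcc_of_le hT] at this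
  have hz : ∀ᵐ t ∂volume.restrict (Ioo a b), ∫ r in c..t, κ r = 0 := by
    filter_upwards [hzero, hI0] with t h0 htm
    rcases le_total c t with hle | hle
    · rw [← hincr c hcT t (hsub htm) hle, h0, hc, sub_zero]
    · rw [intervalIntegral.integral_symm, ← hincr t (hsub htm) c hcT hle, h0, hc]; simp
  -- The primitive of `κ` is continuous, so its vanishing a.e. is vanishing everywhere; Lebesgue
  -- differentiation then gives `κ = 0` a.e.
  have hz' : ∀ t ∈ Ioo a b, ∫ r in c..t, κ r = 0 := by
    refine fun t ht => Measure.eqOn_open_of_ae_eq (μ := volume) (f := fun t => ∫ r in c..t, κ r) (g := fun _ => 0)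
      hz isOpen_Ioo (hcont.mono hsub) continuousOn_const ht
  have hL := ae_restrict_of_ae (s := Ioo a b) hκi.ae_hasDerivAt_integral
  filter_upwards [hL, hI0] with t ht htm
  rw [uIcc_of_le hT] at ht
  have h1 := ht (hsub htm) c hcT
  have h2 : (fun t => ∫ r in c..t, κ r) =ᶠ[𝓝 t] fun _ => 0 := by
    filter_upwards [Ioo_mem_nhds htm.1 htm.2] with s hs using hz' s hs
  exact (h1.congr_of_eventuallyEq h2.symm).unique (hasDerivAt_const t (0 : ℝ))

end MeanDerivative

end EnsembleControl

namespace EnsembleControl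

/-! ### Uniform constants, arcs, and their response to control variations. -/

namespace Problem

set_option linter.unusedSectionVars false

variable {n m : ℕ} {Ω : Type*} [MeasurableSpace Ω] {P : Problem n m Ω}

/-- A single constant `K` for all growth and Lipschitz estimates. -/
structure HasBound (P : Problem n m Ω) (K : ℝ) : Prop where
  pos : 0 < K
  f_lip : ∀ i x x' ω, ‖P.f i x ω - P.f i x' ω‖ ≤ K * ‖x - x'‖
  f_growth : ∀ i x ω, ‖P.f i x ω‖ ≤ K * (1 + ‖x‖)
  dyn_lip : ∀ u ∈ P.box, ∀ x x' ω, ‖P.dyn x u ω - P.dyn x' u ω‖ ≤ K * ‖x - x'‖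
  dyn_growth : ∀ u ∈ P.box, ∀ x ω, ‖P.dyn x u ω‖ ≤ K * (1 + ‖x‖)
  diff_growth : ∀ u ∈ P.box, ∀ v ∈ P.box, ∀ x ω,
    ‖∑ j, (v j - u j) • P.f j.succ x ω‖ ≤ K * (1 + ‖x‖)
  diff_lip : ∀ u ∈ P.box, ∀ v ∈ P.box, ∀ x x' ω,
    ‖∑ j, (v j - u j) • (P.f j.succ x ω - P.f j.succ x' ω)‖ ≤ K * ‖x - x'‖
  g_lip : ∀ x x' ω, |P.g x ω - P.g x' ω| ≤ K * ‖x - x'‖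

theorem norm_sum_smul_le {E : Type*} [NormedAddCommGroup E] [NormedSpace ℝ E] {w : Fin m → ℝ}
    {v : Fin m → E} {ρ A : ℝ} (hw : ∀ j, |w j| ≤ ρ) (hv : ∀ j, ‖v j‖ ≤ A) :
    ‖∑ j, w j • v j‖ ≤ m * (ρ * A) := by
  calc ‖∑ j, w j • v j‖ ≤ ∑ _j : Fin m, ρ * A := norm_sum_le_of_le _ fun j _ => by
        rw [norm_smul, Real.norm_eq_abs]
        exact mul_le_mul (hw j) (hv j) (norm_nonneg _) ((abs_nonneg _).trans (hw j))
    _ = m * (ρ * A) := by simp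

theorem abs_le_of_mem_box {u : Fin m → ℝ} (hu : u ∈ P.box) (j : Fin m) :
    |u j| ≤ ∑ i, (|P.umin i| + |P.umax i|) := by
  have h1 : |u j| ≤ |P.umin j| + |P.umax j| := by
    have h1 := hu.1 j
    have h2 := hu.2 j
    rw [abs_le]
    constructor
    · linarith [neg_abs_le (P.umin j), abs_nonneg (P.umax j)]
    · linarith [le_abs_self (P.umax j), abs_nonneg (P.umin j)]
  exact h1.trans (Finset.single_le_sum (f := fun i => |P.umin i| + |P.umax i|)
    (fun i _ => by positivity) (Finset.mem_univ j))

theorem H0.exists_hasBound (h0 : P.H0) : ∃ K, P.HasBound K := by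
  choose c hc hc' using h0.f_growth
  choose k hk hk' using h0.f_lipschitz
  obtain ⟨kg, hkg, hkg'⟩ := h0.g_lipschitz
  set R := ∑ i, (|P.umin i| + |P.umax i|) with hR
  have hR0 : 0 ≤ R := Finset.sum_nonneg fun i _ => by positivity
  set L := ∑ i, (c i + k i) + kg with hL
  have hLc : ∀ i, c i + k i ≤ L := fun i => by
    have := Finset.single_le_sum (f := fun i => c i + k i)
      (fun i _ => by linarith [hc i, hk i]) (Finset.mem_univ i)
    beta_reduce at this
    linarith
  have hL1 : kg ≤ L := by
    have := Finset.sum_nonneg (s := Finset.univ) (f := fun i => c i + k i)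
      (fun i _ => by linarith [hc i, hk i])
    linarith
  have hL0 : 0 < L := by linarith
  -- One field of constant `L` for the drift, plus `m` controlled fields with weights at most `2R`:
  -- components of a control are bounded by `R`, differences of controls by `2R`.
  set K := L + m * ((2 * R) * L) with hK
  have hLK : L ≤ K := by have : 0 ≤ m * ((2 * R) * L) := by positivity
                         linarith
  have hgr : ∀ i x ω, ‖P.f i x ω‖ ≤ L * (1 + ‖x‖) := fun i x ω => by
    refine (hc' i x ω).trans ?_
    gcongr
    linarith [hLc i, hk i]
  have hlip : ∀ i x x' ω, ‖P.f i x ω - P.f i x' ω‖ ≤ L * ‖x - x'‖ := fun i x x' ω => by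
    refine (hk' i x x' ω).trans ?_
    gcongr
    linarith [hLc i, hc i]
  have hdiff : ∀ u ∈ P.box, ∀ v ∈ P.box, ∀ j, |v j - u j| ≤ 2 * R := fun u hu v hv j => by
    have := abs_sub (v j) (u j)
    linarith [abs_le_of_mem_box hu j, abs_le_of_mem_box hv j]
  have hRR : R ≤ 2 * R := by linarith
  refine ⟨K, by linarith, fun i x x' ω => ?_, fun i x ω => ?_, fun u hu x x' ω => ?_,
    fun u hu x ω => ?_, fun u hu v hv x ω => ?_, fun u hu v hv x x' ω => ?_, fun x x' ω => ?_⟩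
  · exact (hlip i x x' ω).trans (by gcongr)
  · exact (hgr i x ω).trans (by gcongr)
  · have h1 : P.dyn x u ω - P.dyn x' u ω = (P.f 0 x ω - P.f 0 x' ω) +
        ∑ j, u j • (P.f j.succ x ω - P.f j.succ x' ω) := by
      simp only [dyn, smul_sub, Finset.sum_sub_distrib]
      abel
    rw [h1, hK, add_mul]
    refine (norm_add_le _ _).trans (add_le_add (hlip 0 x x' ω) ?_)
    refine (norm_sum_smul_le (fun j => (abs_le_of_mem_box hu j).trans hRR)
      (fun j => hlip j.succ x x' ω)).trans (le_of_eq (by ring))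
  · rw [dyn, hK, add_mul]
    refine (norm_add_le _ _).trans (add_le_add (hgr 0 x ω) ?_)
    refine (norm_sum_smul_le (fun j => (abs_le_of_mem_box hu j).trans hRR)
      (fun j => hgr j.succ x ω)).trans (le_of_eq (by ring))
  · refine (norm_sum_smul_le (hdiff u hu v hv) (fun j => hgr j.succ x ω)).trans ?_
    have : 0 ≤ L * (1 + ‖x‖) := by positivity
    rw [hK, add_mul]
    linarith
  · refine (norm_sum_smul_le (hdiff u hu v hv) (fun j => hlip j.succ x x' ω)).trans ?_
    have : 0 ≤ L * ‖x - x'‖ := by positivity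
    rw [hK, add_mul]
    linarith
  · exact (hkg' x x' ω).trans (by gcongr; linarith)

/-- Measurable controls with values in the box everywhere. -/
structure IsBoxControl (P : Problem n m Ω) (u : ℝ → Fin m → ℝ) : Prop where
  measurable : Measurable u
  mem : ∀ t, u t ∈ P.box

/-- A measurable representative is projected onto the box. Changing the control on a null set alters
no integral, so the arcs stay the same. -/
theorem IsControl.exists_isBoxControl {u : ℝ → Fin m → ℝ} (hu : P.IsControl u)
    (hbox : ∀ i, P.umin i ≤ P.umax i) :
    ∃ u', P.IsBoxControl u' ∧ u' =ᵐ[volume.restrict (Icc P.t₀ P.T)] u := by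
  obtain ⟨h1, h2⟩ := hu
  set w := h1.aestronglyMeasurable.mk u
  have hw : Measurable w := h1.aestronglyMeasurable.stronglyMeasurable_mk.measurable
  refine ⟨fun t j => max (P.umin j) (min (P.umax j) (w t j)), ⟨?_, fun t => ⟨fun j => ?_, fun j => ?_⟩⟩, ?_⟩
  · refine measurable_pi_lambda _ fun j => ?_
    exact measurable_const.max (measurable_const.min ((measurable_pi_apply j).comp hw))
  · exact le_max_left _ _
  · exact max_le (hbox j) (min_le_left _ _)
  · filter_upwards [h1.aestronglyMeasurable.ae_eq_mk, h2] with t ht htb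
    funext j
    rw [← show u t = w t from ht, min_eq_right (htb.2 j), max_eq_right (htb.1 j)]

theorem IsBoxControl.isControl {u : ℝ → Fin m → ℝ} (hu : P.IsBoxControl u) : P.IsControl u := by
  refine ⟨memLp_top_of_bound hu.measurable.aestronglyMeasurable
    (∑ i, (|P.umin i| + |P.umax i|)) (Eventually.of_forall fun t => ?_),
    Eventually.of_forall hu.mem⟩
  refine (pi_norm_le_iff_of_nonneg (Finset.sum_nonneg fun i _ => by positivity)).2 fun j => ?_
  exact abs_le_of_mem_box (hu.mem t) j

/-- Continuous solutions of the state equation for the parameter `ω` and initial value `ξ`. -/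
def IsArc (P : Problem n m Ω) (u : ℝ → Fin m → ℝ) (ω : Ω) (ξ : State n) (y : ℝ → State n) :
    Prop :=
  ContinuousOn y (Icc P.t₀ P.T) ∧
    ∀ t ∈ Icc P.t₀ P.T, y t = ξ + ∫ s in P.t₀..t, P.dyn (y s) (u s) ω

theorem IsArc.congr_control {u w : ℝ → Fin m → ℝ} {ω : Ω} {ξ : State n} {y : ℝ → State n}
    (hy : P.IsArc u ω ξ y) (hw : w =ᵐ[volume.restrict (Icc P.t₀ P.T)] u) : P.IsArc w ω ξ y := by
  refine ⟨hy.1, fun t ht => ?_⟩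
  rw [hy.2 t ht]
  congr 1
  refine intervalIntegral.integral_congr_ae ?_
  rw [uIoc_of_le ht.1]
  filter_upwards [(ae_restrict_iff' measurableSet_Icc).1 hw] with s hs hsm
  rw [hs ⟨hsm.1.le, hsm.2.trans ht.2⟩]

theorem IsArc.initial {u : ℝ → Fin m → ℝ} {ω : Ω} {ξ : State n} {y : ℝ → State n}
    (ht : P.t₀ ≤ P.T) (hy : P.IsArc u ω ξ y) : y P.t₀ = ξ := by
  rw [hy.2 P.t₀ ⟨le_rfl, ht⟩]; simp

theorem IsArc.eq_add {u : ℝ → Fin m → ℝ} {ω : Ω} {ξ : State n} {y : ℝ → State n}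
    (hy : P.IsArc u ω ξ y) :
    ∀ t ∈ Icc P.t₀ P.T, y t = y P.t₀ + ∫ s in P.t₀..t, P.dyn (y s) (u s) ω := by
  intro t ht
  rw [hy.initial (ht.1.trans ht.2)]
  exact hy.2 t ht

theorem measurable_dyn (h0 : P.H0) :
    Measurable fun q : State n × (Fin m → ℝ) × Ω => P.dyn q.1 q.2.1 q.2.2 := by
  have hf : ∀ i, Measurable fun q : State n × (Fin m → ℝ) × Ω => P.f i q.1 q.2.2 := fun i =>
    (h0.f_measurable i).comp (measurable_fst.prodMk (measurable_snd.comp measurable_snd))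
  refine (hf 0).add (Finset.measurable_sum _ fun j _ => ?_)
  exact Measurable.smul ((measurable_pi_apply j).comp (measurable_fst.comp measurable_snd))
    (hf j.succ)

/-- The initial value is part of the parameter: the flow is then measurable in `(t, ω, ξ)` even
though `φ` is only almost everywhere measurable. -/
theorem IsBoxControl.exists_flow {u : ℝ → Fin m → ℝ} (hu : P.IsBoxControl u) {K : ℝ}
    (hK : P.HasBound K) (h0 : P.H0) (ht : P.t₀ ≤ P.T) :
    ∃ Y : ℝ → Ω × State n → State n, (Measurable fun q : ℝ × Ω × State n => Y q.1 q.2) ∧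
      (∀ z, Continuous fun t => Y t z) ∧ ∀ z, P.IsArc u z.1 z.2 fun t => Y t z := by
  obtain ⟨Y, hYm, hYc, hY⟩ := exists_caratheodory_solution (Z := Ω × State n) (E := State n)
    (F := fun t z x => P.dyn x (u t) z.1) (C := fun _ => K) (ξ := Prod.snd) ht
    ((measurable_dyn h0).comp ((measurable_snd.comp measurable_snd).prodMk
      ((hu.measurable.comp measurable_fst).prodMk
        (measurable_fst.comp (measurable_fst.comp measurable_snd)))))
    hK.pos (fun t z x y => hK.dyn_lip _ (hu.mem t) x y z.1)
    (fun t z => by simpa using hK.dyn_growth _ (hu.mem t) 0 z.1) measurable_snd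
  exact ⟨Y, hYm, hYc, fun z => ⟨(hYc z).continuousOn, hY z⟩⟩

section Estimates

variable {K : ℝ} (hK : P.HasBound K) (h0 : P.H0) (ht : P.t₀ ≤ P.T)
include hK h0 ht

theorem IsBoxControl.intervalIntegrable_dyn {u : ℝ → Fin m → ℝ} (hu : P.IsBoxControl u) {ω : Ω}
    {y : ℝ → State n} (hy : ContinuousOn y (Icc P.t₀ P.T)) :
    IntervalIntegrable (fun s => P.dyn (y s) (u s) ω) volume P.t₀ P.T := by
  rw [intervalIntegrable_iff_integrableOn_Icc_of_le ht]
  obtain ⟨D, hD⟩ := isCompact_Icc.exists_bound_of_continuousOn hy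
  refine Integrable.of_bound (C := K * (1 + D)) ?_ ?_
  · exact ((measurable_dyn h0).comp_aemeasurable
      ((hy.aestronglyMeasurable measurableSet_Icc).aemeasurable.prodMk
        (hu.measurable.aemeasurable.prodMk (aemeasurable_const (b := ω))))).aestronglyMeasurable
  · filter_upwards [ae_restrict_mem measurableSet_Icc] with s hs
    refine (hK.dyn_growth _ (hu.mem s) _ _).trans ?_
    have := hK.pos
    gcongr
    exact hD s hs

theorem IsArc.unique {u : ℝ → Fin m → ℝ} (hu : P.IsBoxControl u) {ω : Ω} {ξ : State n}
    {y z : ℝ → State n} (hy : P.IsArc u ω ξ y) (hz : P.IsArc u ω ξ z) :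
    EqOn y z (Icc P.t₀ P.T) :=
  eqOn_of_caratheodory (G := fun s x => P.dyn x (u s) ω) hK.pos.le
    (Eventually.of_forall fun t => hK.dyn_lip _ (hu.mem t) _ _ _) hy.1 hz.1
    (hu.intervalIntegrable_dyn hK h0 ht hy.1) (hu.intervalIntegrable_dyn hK h0 ht hz.1) hy.2 hz.2

/-- For `1 + ‖y‖` the linear growth bound is homogeneous, so Grönwall applies directly. -/
theorem IsArc.one_add_norm_le {u : ℝ → Fin m → ℝ} (hu : P.IsBoxControl u) {ω : Ω} {ξ : State n}
    {y : ℝ → State n} (hy : P.IsArc u ω ξ y) {t : ℝ} (htm : t ∈ Icc P.t₀ P.T) :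
    1 + ‖y t‖ ≤ (1 + ‖ξ‖) * Real.exp (K * (P.T - P.t₀)) := by
  have key := le_exp_of_le_add_integral (h := fun t => 1 + ‖y t‖) (C := 1 + ‖ξ‖) (K := K)
    (continuousOn_const.add hy.1.norm) hK.pos.le (fun s hs => by
      rw [hy.2 s hs, add_assoc, ← intervalIntegral.integral_const_mul]
      gcongr
      refine (norm_add_le _ _).trans (add_le_add le_rfl ?_)
      refine intervalIntegral.norm_integral_le_of_norm_le hs.1
        (Eventually.of_forall fun r _ => hK.dyn_growth _ (hu.mem r) _ _) ?_
      refine ContinuousOn.intervalIntegrable ?_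
      rw [uIcc_of_le hs.1]
      exact ((continuousOn_const.add hy.1.norm).const_smul K).mono (Icc_subset_Icc_right hs.2))
    t htm
  refine key.trans ?_
  have := hK.pos
  gcongr
  exact htm.2

theorem IsArc.lipschitzOnWith {u : ℝ → Fin m → ℝ} (hu : P.IsBoxControl u) {ω : Ω} {ξ : State n}
    {y : ℝ → State n} (hy : P.IsArc u ω ξ y) :
    ∃ L, LipschitzOnWith L y (Icc P.t₀ P.T) := by
  refine ⟨_, lipschitzOnWith_of_eq_add_integral
    (M := K * ((1 + ‖ξ‖) * Real.exp (K * (P.T - P.t₀)))) (hu.intervalIntegrable_dyn hK h0 ht hy.1)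
    ?_ hy.eq_add⟩
  filter_upwards [ae_restrict_mem measurableSet_Icc] with s hs
  refine (hK.dyn_growth _ (hu.mem s) _ _).trans ?_
  have := hK.pos
  gcongr
  exact hy.one_add_norm_le hK h0 ht hu hs

theorem IsArc.ae_hasDerivAt {u : ℝ → Fin m → ℝ} (hu : P.IsBoxControl u) {ω : Ω} {ξ : State n}
    {y : ℝ → State n} (hy : P.IsArc u ω ξ y) :
    ∀ᵐ t ∂volume.restrict (Icc P.t₀ P.T), HasDerivAt y (P.dyn (y t) (u t) ω) t :=
  ae_hasDerivAt_of_eq_add_integral ht (hu.intervalIntegrable_dyn hK h0 ht hy.1) hy.eq_add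

end Estimates

/-- The control `u + l (v - u)`. -/
def mix (u v : ℝ → Fin m → ℝ) (l : ℝ) (t : ℝ) : Fin m → ℝ := u t + l • (v t - u t)

theorem IsBoxControl.mix {u v : ℝ → Fin m → ℝ} (hu : P.IsBoxControl u) (hv : P.IsBoxControl v)
    {l : ℝ} (hl : l ∈ Icc (0 : ℝ) 1) : P.IsBoxControl (mix u v l) := by
  refine ⟨hu.measurable.add ((hv.measurable.sub hu.measurable).const_smul l), fun t => ?_⟩
  exact (convex_Icc P.umin P.umax).add_smul_sub_mem (hu.mem t) (hv.mem t) hl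

theorem dyn_mix (u v : ℝ → Fin m → ℝ) (l t : ℝ) (y : State n) (ω : Ω) :
    P.dyn y (mix u v l t) ω = P.dyn y (u t) ω + l • ∑ j, (v t j - u t j) • P.f j.succ y ω := by
  simp only [dyn, mix, Pi.add_apply, Pi.smul_apply, Pi.sub_apply, smul_eq_mul, add_smul,
    Finset.sum_add_distrib, Finset.smul_sum, mul_smul, add_assoc]

section Variation

variable {K : ℝ} (hK : P.HasBound K) (h0 : P.H0) (ht : P.t₀ ≤ P.T)
include hK h0 ht

theorem norm_dyn_mix_sub_le {u v : ℝ → Fin m → ℝ} (hu : P.IsBoxControl u)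
    (hv : P.IsBoxControl v) {l : ℝ} (hl : l ∈ Icc (0 : ℝ) 1) {ω : Ω} (s : ℝ) (x y : State n) :
    ‖P.dyn y (mix u v l s) ω - P.dyn x (u s) ω‖ ≤ K * ‖y - x‖ + l * (K * (1 + ‖x‖)) := by
  have h1 : P.dyn y (mix u v l s) ω - P.dyn x (u s) ω =
      (P.dyn y (mix u v l s) ω - P.dyn x (mix u v l s) ω) +
        l • ∑ j, (v s j - u s j) • P.f j.succ x ω := by
    rw [dyn_mix u v l s x]; abel
  rw [h1]
  refine (norm_add_le _ _).trans (add_le_add (hK.dyn_lip _ ((hu.mix hv hl).mem s) _ _ _) ?_)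
  rw [norm_smul, Real.norm_of_nonneg hl.1]
  exact mul_le_mul_of_nonneg_left (hK.diff_growth _ (hu.mem s) _ (hv.mem s) _ _) hl.1

/-- Grönwall on the difference of the arcs; the constant depends on neither controls nor `ω`, and
enters only through `1 + ‖ξ‖`. The velocity bound is what keeps varied processes inside a `W^{1,1}`
ball, the state bound what dominates the cost quotients. -/
theorem exists_variation_bound : ∃ C, 0 ≤ C ∧ ∀ {u v : ℝ → Fin m → ℝ}, P.IsBoxControl u →
    P.IsBoxControl v → ∀ {l : ℝ}, l ∈ Icc (0 : ℝ) 1 → ∀ {ω : Ω} {ξ : State n} {x y : ℝ → State n},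
    P.IsArc u ω ξ x → P.IsArc (mix u v l) ω ξ y → ∀ t ∈ Icc P.t₀ P.T,
      ‖y t - x t‖ ≤ l * (C * (1 + ‖ξ‖)) ∧
      ‖P.dyn (y t) (mix u v l t) ω - P.dyn (x t) (u t) ω‖ ≤ l * (C * (1 + ‖ξ‖)) := by
  have hK0 := hK.pos
  set Λ := Real.exp (K * (P.T - P.t₀)) with hΛ
  have hΛ0 : 0 < Λ := Real.exp_pos _
  have hT : 0 ≤ P.T - P.t₀ := sub_nonneg.2 ht
  -- One factor `Λ` bounds the growth of `x` in the source term, the other comes from Grönwall for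
  -- `y - x`.
  set C₁ := K * (P.T - P.t₀) * Λ * Λ with hC₁
  have hC₁0 : 0 ≤ C₁ := by positivity
  refine ⟨C₁ + (K * C₁ + K * Λ), by positivity, ?_⟩
  intro u v hu hv l hl ω ξ x y hx hy t htm
  have hw := hu.mix hv hl
  have hl0 := hl.1
  have hvel : ∀ s ∈ Icc P.t₀ P.T, ‖P.dyn (y s) (mix u v l s) ω - P.dyn (x s) (u s) ω‖ ≤
      K * ‖y s - x s‖ + l * (K * ((1 + ‖ξ‖) * Λ)) := fun s hs => by
    refine (norm_dyn_mix_sub_le hK h0 ht hu hv hl s (x s) (y s)).trans ?_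
    gcongr
    exact hx.one_add_norm_le hK h0 ht hu hs
  have hdiff : ∀ s ∈ Icc P.t₀ P.T, ‖y s - x s‖ ≤ l * (C₁ * (1 + ‖ξ‖)) := by
    intro s hs
    have hcs : ∀ r ∈ Icc P.t₀ P.T, ContinuousOn (fun s => ‖y s - x s‖) (uIcc P.t₀ r) :=
      fun r hr => by
        rw [uIcc_of_le hr.1]
        exact (hy.1.sub hx.1).norm.mono (Icc_subset_Icc_right hr.2)
    have key := le_exp_of_le_add_integral (h := fun t => ‖y t - x t‖)
      (C := l * (K * ((1 + ‖ξ‖) * Λ)) * (P.T - P.t₀)) (K := K) (hy.1.sub hx.1).norm hK0.le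
      (fun r hr => by
        have hsub : uIcc P.t₀ r ⊆ uIcc P.t₀ P.T := by
          rw [uIcc_of_le hr.1, uIcc_of_le ht]; exact Icc_subset_Icc_right hr.2
        have hci := (hcs r hr).intervalIntegrable (μ := volume)
        rw [hy.2 r hr, hx.2 r hr, add_sub_add_left_eq_sub,
          ← intervalIntegral.integral_sub ((hw.intervalIntegrable_dyn hK h0 ht hy.1).mono_set hsub)
            ((hu.intervalIntegrable_dyn hK h0 ht hx.1).mono_set hsub)]
        calc _ ≤ ∫ s in P.t₀..r, (K * ‖y s - x s‖ + l * (K * ((1 + ‖ξ‖) * Λ))) := by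
              refine intervalIntegral.norm_integral_le_of_norm_le hr.1 ?_
                ((hci.const_mul K).add intervalIntegrable_const)
              exact Eventually.of_forall fun s hs => hvel s ⟨hs.1.le, hs.2.trans hr.2⟩
          _ = l * (K * ((1 + ‖ξ‖) * Λ)) * (r - P.t₀) + K * ∫ s in P.t₀..r, ‖y s - x s‖ := by
            rw [intervalIntegral.integral_add (hci.const_mul K) intervalIntegrable_const,
              intervalIntegral.integral_const_mul, intervalIntegral.integral_const, smul_eq_mul]
            ring
          _ ≤ _ := by gcongr; exact hr.2) s hs
    refine key.trans ?_
    have h1 : Real.exp (K * (s - P.t₀)) ≤ Λ := by rw [hΛ]; gcongr; exact hs.2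
    calc _ ≤ l * (K * ((1 + ‖ξ‖) * Λ)) * (P.T - P.t₀) * Λ := by gcongr
      _ = _ := by rw [hC₁]; ring
  constructor
  · refine (hdiff t htm).trans ?_
    gcongr
    have : 0 ≤ K * C₁ + K * Λ := by positivity
    linarith
  · refine (hvel t htm).trans ?_
    calc _ ≤ K * (l * (C₁ * (1 + ‖ξ‖))) + l * (K * ((1 + ‖ξ‖) * Λ)) := by
          gcongr; exact hdiff t htm
      _ = l * ((K * C₁ + K * Λ) * (1 + ‖ξ‖)) := by ring
      _ ≤ _ := by gcongr l * (?_ * _); linarith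

end Variation

end Problem

end EnsembleControl

namespace EnsembleControl

/-! ### Lie brackets: bounds and the adjoint identity. -/

section BracketEstimates

variable {E : Type*} [NormedAddCommGroup E] [NormedSpace ℝ E]

open VectorField

theorem norm_lieBracket_le {V W : E → E} {y : E} {k A l B : ℝ} (hV : ‖fderiv ℝ V y‖ ≤ k)
    (hVA : ‖V y‖ ≤ A) (hW : ‖fderiv ℝ W y‖ ≤ l) (hWA : ‖W y‖ ≤ B) :
    ‖lieBracket ℝ V W y‖ ≤ l * A + k * B :=
  (norm_sub_le _ _).trans (add_le_add
    (((fderiv ℝ W y).le_opNorm _).trans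
      (mul_le_mul hW hVA (norm_nonneg _) ((norm_nonneg _).trans hW)))
    (((fderiv ℝ V y).le_opNorm _).trans
      (mul_le_mul hV hWA (norm_nonneg _) ((norm_nonneg _).trans hV))))

theorem norm_fderiv_fderiv_eq {V : E → E} {y : E} :
    ‖fderiv ℝ (fderiv ℝ V) y‖ = ‖iteratedFDeriv ℝ 2 V y‖ := by
  rw [← norm_iteratedFDeriv_fderiv, norm_iteratedFDeriv_one]

theorem norm_fderiv_fderiv_apply_le {V W : E → E} {y : E} {k A l C : ℝ}
    (hV : DifferentiableAt ℝ V y) (hW : ContDiffAt ℝ 2 W y) (hVk : ‖fderiv ℝ V y‖ ≤ k)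
    (hVA : ‖V y‖ ≤ A) (hWl : ‖fderiv ℝ W y‖ ≤ l) (hWC : ‖iteratedFDeriv ℝ 2 W y‖ ≤ C) :
    ‖fderiv ℝ (fun z => fderiv ℝ W z (V z)) y‖ ≤ l * k + C * A := by
  have hW' : DifferentiableAt ℝ (fderiv ℝ W) y :=
    (hW.fderiv_right (m := 1) (by norm_num)).differentiableAt (by simp)
  rw [fderiv_clm_apply hW' hV]
  refine (norm_add_le _ _).trans (add_le_add ?_ ?_)
  · exact (ContinuousLinearMap.opNorm_comp_le _ _).trans
      (mul_le_mul hWl hVk (norm_nonneg _) ((norm_nonneg _).trans hWl))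
  · rw [← norm_fderiv_fderiv_eq] at hWC
    refine (ContinuousLinearMap.le_opNorm _ _).trans ?_
    rw [ContinuousLinearMap.opNorm_flip]
    exact mul_le_mul hWC hVA (norm_nonneg _) ((norm_nonneg _).trans hWC)

/-- Only `V` and `W` are differentiated twice. With `A` of linear growth, the term `C * A * A` makes
the whole bound quadratic in the state. -/
theorem norm_lieBracket_lieBracket_le {U V W : E → E} {y : E} {k A C : ℝ}
    (hV : ContDiffAt ℝ 2 V y) (hW : ContDiffAt ℝ 2 W y)
    (hUk : ‖fderiv ℝ U y‖ ≤ k) (hVk : ‖fderiv ℝ V y‖ ≤ k) (hWk : ‖fderiv ℝ W y‖ ≤ k)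
    (hUA : ‖U y‖ ≤ A) (hVA : ‖V y‖ ≤ A) (hWA : ‖W y‖ ≤ A)
    (hVC : ‖iteratedFDeriv ℝ 2 V y‖ ≤ C) (hWC : ‖iteratedFDeriv ℝ 2 W y‖ ≤ C) :
    ‖lieBracket ℝ U (lieBracket ℝ V W) y‖ ≤ 2 * (k * k + C * A) * A + k * (2 * (k * A)) := by
  have hVd : DifferentiableAt ℝ V y := hV.differentiableAt (by simp)
  have hWd : DifferentiableAt ℝ W y := hW.differentiableAt (by simp)
  have hW' : DifferentiableAt ℝ (fderiv ℝ W) y :=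
    (hW.fderiv_right (m := 1) (by norm_num)).differentiableAt (by simp)
  have hV' : DifferentiableAt ℝ (fderiv ℝ V) y :=
    (hV.fderiv_right (m := 1) (by norm_num)).differentiableAt (by simp)
  refine norm_lieBracket_le hUk hUA ?_ ((norm_lieBracket_le hVk hVA hWk hWA).trans (le_of_eq (by ring)))
  have h1 : lieBracket ℝ V W = fun z => fderiv ℝ W z (V z) - fderiv ℝ V z (W z) := rfl
  rw [h1, fderiv_fun_sub (hW'.clm_apply hVd) (hV'.clm_apply hWd)]
  refine (norm_sub_le _ _).trans ?_
  have h2 := norm_fderiv_fderiv_apply_le hVd hW hVk hVA hWk hWC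
  have h3 := norm_fderiv_fderiv_apply_le hWd hV hWk hWA hVk hVC
  linarith

/-- Product rule: `-⟨D'ᵀp, G⟩ + ⟨p, G'D⟩ = ⟨p, G'D - D'G⟩`. Here `D` is the dynamics with the
control frozen at its value at time `t`; only the velocities at that instant matter. -/
theorem hasDerivAt_inner_lieBracket {E : Type*} [NormedAddCommGroup E] [InnerProductSpace ℝ E]
    [CompleteSpace E] {D G : E → E} {p x : ℝ → E} {t : ℝ} (hG : DifferentiableAt ℝ G (x t))
    (hx : HasDerivAt x (D (x t)) t)
    (hp : HasDerivAt p (-(ContinuousLinearMap.adjoint (fderiv ℝ D (x t)) (p t))) t) :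
    HasDerivAt (fun s => inner ℝ (p s) (G (x s))) (inner ℝ (p t) (lieBracket ℝ D G (x t))) t := by
  have h := hp.inner ℝ (hG.hasFDerivAt.comp_hasDerivAt t hx)
  refine h.congr_deriv ?_
  rw [lieBracket_eq]
  simp only [Function.comp_apply, inner_neg_left, ContinuousLinearMap.adjoint_inner_left,
    inner_sub_right]
  ring

end BracketEstimates

namespace Problem

set_option linter.unusedSectionVars false

variable {n m : ℕ} {Ω : Type*} [MeasurableSpace Ω] {P : Problem n m Ω}

/-- The Lipschitz constant bounds `fderiv` at every point, since `fderiv` is zero where the field is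
not differentiable. -/
theorem HasBound.norm_fderiv_f_le {K : ℝ} (hK : P.HasBound K) (i : Fin (m + 1)) (ω : Ω)
    (y : State n) : ‖fderiv ℝ (fun y => P.f i y ω) y‖ ≤ K := by
  have : LipschitzWith K.toNNReal (fun y => P.f i y ω) :=
    LipschitzWith.of_dist_le_mul fun a b => by
      rw [dist_eq_norm, dist_eq_norm, Real.coe_toNNReal _ hK.pos.le]; exact hK.f_lip i a b ω
  simpa [Real.coe_toNNReal _ hK.pos.le] using norm_fderiv_le_of_lipschitz ℝ this (x₀ := y)

theorem HasBound.norm_fderiv_dyn_le {K : ℝ} (hK : P.HasBound K) {u : Fin m → ℝ} (hu : u ∈ P.box)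
    (ω : Ω) (y : State n) : ‖fderiv ℝ (fun y => P.dyn y u ω) y‖ ≤ K := by
  have : LipschitzWith K.toNNReal (fun y => P.dyn y u ω) :=
    LipschitzWith.of_dist_le_mul fun a b => by
      rw [dist_eq_norm, dist_eq_norm, Real.coe_toNNReal _ hK.pos.le]; exact hK.dyn_lip u hu a b ω
  simpa [Real.coe_toNNReal _ hK.pos.le] using norm_fderiv_le_of_lipschitz ℝ this (x₀ := y)

/-! ### Regularity of the fields in the tube, at every time. -/

section Regularity

variable [PseudoMetricSpace Ω] {x : ℝ → Ω → State n} {δ : ℝ}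

/-- The hypothesis concerns a.e. time only, but a point of the ball at time `t` also lies in the
balls at nearby times, some of which are good; the fields themselves do not depend on time. -/
theorem H1.contDiffAt (h1 : P.H1 x δ) (ht : P.t₀ < P.T) {ω : Ω}
    (hx : ContinuousOn (fun t => x t ω) (Icc P.t₀ P.T)) {t : ℝ} (htm : t ∈ Icc P.t₀ P.T)
    {y : State n} (hy : y ∈ Metric.ball (x t ω) δ) (i : Fin (m + 1)) :
    ContDiffAt ℝ 2 (fun y => P.f i y ω) y := by
  have hfr := frequently_nhdsWithin_of_ae ht (h1.f_contDiff_two i ω) htm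
  have hev : ∀ᶠ s in 𝓝[Icc P.t₀ P.T] t, y ∈ Metric.ball (x s ω) δ := by
    have hc : ContinuousWithinAt (fun s => dist y (x s ω)) (Icc P.t₀ P.T) t :=
      continuousWithinAt_const.dist (hx t htm)
    exact hc.eventually_lt continuousWithinAt_const hy
  obtain ⟨s, hs, hsy⟩ := (hfr.and_eventually hev).exists
  exact hs.contDiffAt (Metric.isOpen_ball.mem_nhds hsy)

theorem H1.differentiableAt_f (h1 : P.H1 x δ) (hδ : 0 < δ) (ht : P.t₀ < P.T) {ω : Ω}
    (hx : ContinuousOn (fun t => x t ω) (Icc P.t₀ P.T)) {t : ℝ} (htm : t ∈ Icc P.t₀ P.T)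
    (i : Fin (m + 1)) : DifferentiableAt ℝ (fun y => P.f i y ω) (x t ω) :=
  (h1.contDiffAt ht hx htm (Metric.mem_ball_self hδ) i).differentiableAt (by simp)

theorem differentiableAt_dyn {ω : Ω} {y : State n}
    (h : ∀ i, DifferentiableAt ℝ (fun y => P.f i y ω) y) (u : Fin m → ℝ) :
    DifferentiableAt ℝ (fun y => P.dyn y u ω) y :=
  (h 0).add (DifferentiableAt.fun_sum fun j _ => (h j.succ).const_smul (u j))

theorem lieBracket_dyn {ω : Ω} {y : State n}
    (h : ∀ i, DifferentiableAt ℝ (fun y => P.f i y ω) y) (u : Fin m → ℝ) (G : State n → State n) :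
    VectorField.lieBracket ℝ (fun y => P.dyn y u ω) G y =
      VectorField.lieBracket ℝ (fun y => P.f 0 y ω) G y +
        ∑ j, u j • VectorField.lieBracket ℝ (fun y => P.f j.succ y ω) G y := by
  have h1 : fderiv ℝ (fun y => P.dyn y u ω) y = fderiv ℝ (fun y => P.f 0 y ω) y +
      ∑ j, u j • fderiv ℝ (fun y => P.f j.succ y ω) y := by
    have := (h 0).hasFDerivAt.add (HasFDerivAt.fun_sum (u := Finset.univ)
      fun j _ => (h (Fin.succ j)).hasFDerivAt.const_smul (u j))
    exact this.fderiv
  simp only [VectorField.lieBracket_eq]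
  rw [h1]
  simp only [dyn, map_add, map_sum, map_smul, smul_sub, Finset.sum_sub_distrib, add_apply,
    sum_apply, smul_apply]
  abel

/-- The second derivative is continuous along the arc, so exceeding the bound at one time would mean
exceeding it at all nearby times. -/
theorem H1.exists_norm_iteratedFDeriv_two_le (h1 : P.H1 x δ) (hδ : 0 < δ) (ht : P.t₀ < P.T)
    (hx : ∀ ω, ContinuousOn (fun t => x t ω) (Icc P.t₀ P.T)) :
    ∃ C, 0 ≤ C ∧ ∀ i, ∀ ω ∈ P.μ.support, ∀ t ∈ Icc P.t₀ P.T,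
      ‖iteratedFDeriv ℝ 2 (fun y => P.f i y ω) (x t ω)‖ ≤ C := by
  choose C hC0 hC using fun i => h1.f_deriv_bound i 2 (by simp)
  refine ⟨∑ i, C i, Finset.sum_nonneg fun i _ => (hC0 i).le, fun i ω hω t htm => ?_⟩
  refine le_trans ?_ (Finset.single_le_sum (f := C) (fun i _ => (hC0 i).le) (Finset.mem_univ i))
  have hfr := frequently_nhdsWithin_of_ae ht (hC i ω hω) htm
  by_contra! hlt
  have hc : ContinuousWithinAt (fun s => ‖iteratedFDeriv ℝ 2 (fun y => P.f i y ω) (x s ω)‖)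
      (Icc P.t₀ P.T) t := by
    refine ContinuousWithinAt.norm ?_
    have h2 : ContinuousAt (iteratedFDeriv ℝ 2 (fun y => P.f i y ω)) (x t ω) :=
      ((h1.contDiffAt ht (hx ω) htm (Metric.mem_ball_self hδ) i).iteratedFDeriv_right
        (m := 0) (i := 2) (by norm_num)).continuousAt
    exact ContinuousAt.comp_continuousWithinAt (f := fun s => x s ω) h2 (hx ω t htm)
  obtain ⟨s, hs, hs'⟩ := (hfr.and_eventually
    (continuousWithinAt_const.eventually_lt hc hlt)).exists
  exact absurd hs (not_lt.2 hs'.le)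

/-- `ω`-wise bound of the second order brackets along the reference arcs. -/
theorem H1.exists_norm_lieBracket_lieBracket_le (h1 : P.H1 x δ) (hδ : 0 < δ) (ht : P.t₀ < P.T)
    {K : ℝ} (hK : P.HasBound K) (hx : ∀ ω, ContinuousOn (fun t => x t ω) (Icc P.t₀ P.T)) :
    ∃ B, 0 ≤ B ∧ ∀ i j k, ∀ ω ∈ P.μ.support, ∀ t ∈ Icc P.t₀ P.T,
      ‖VectorField.lieBracket ℝ (fun y => P.f i y ω) (VectorField.lieBracket ℝ
        (fun y => P.f j y ω) (fun y => P.f k y ω)) (x t ω)‖ ≤ B * (1 + ‖x t ω‖) ^ 2 := by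
  obtain ⟨C, hC0, hC⟩ := h1.exists_norm_iteratedFDeriv_two_le hδ ht hx
  have hK0 := hK.pos
  refine ⟨2 * (K * K + C * K) * K + K * (2 * (K * K)), by positivity,
    fun i j k ω hω t htm => ?_⟩
  refine (norm_lieBracket_lieBracket_le
    (h1.contDiffAt ht (hx ω) htm (Metric.mem_ball_self hδ) j)
    (h1.contDiffAt ht (hx ω) htm (Metric.mem_ball_self hδ) k)
    (hK.norm_fderiv_f_le i ω _) (hK.norm_fderiv_f_le j ω _) (hK.norm_fderiv_f_le k ω _)
    (hK.f_growth i _ ω) (hK.f_growth j _ ω) (hK.f_growth k _ ω) (hC j ω hω t htm)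
    (hC k ω hω t htm)).trans ?_
  have h2 : 1 ≤ 1 + ‖x t ω‖ := by linarith [norm_nonneg (x t ω)]
  set a := 1 + ‖x t ω‖
  have h3 : a ≤ a ^ 2 := by nlinarith
  calc _ = (4 * (K * K * K)) * a + 2 * (C * K * K) * a ^ 2 := by ring
    _ ≤ (4 * (K * K * K)) * a ^ 2 + 2 * (C * K * K) * a ^ 2 := by gcongr
    _ = _ := by ring

end Regularity

end Problem

end EnsembleControl

namespace EnsembleControl

/-! ### Measurable versions of the states and of the adjoint equation. -/

namespace Problem

set_option linter.unusedSectionVars false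

variable {n m : ℕ} {Ω : Type*} [MetricSpace Ω] [MeasurableSpace Ω] {P : Problem n m Ω}

/-- Reference process with a control that is measurable and box-valued everywhere, and a jointly
measurable version `X` of the states. -/
structure IsReference (P : Problem n m Ω) (u : ℝ → Fin m → ℝ) (x X : ℝ → Ω → State n) (δ K : ℝ) :
    Prop where
  data : P.H0
  lt : P.t₀ < P.T
  bound : P.HasBound K
  control : P.IsBoxControl u
  initial : MemLp P.φ 2 P.μ
  arc : ∀ ω, P.IsArc u ω (P.φ ω) fun t => x t ω
  pos : 0 < δ
  regular : P.H1 x δ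
  measurable : Measurable fun q : ℝ × Ω => X q.1 q.2
  continuous : ∀ ω, Continuous fun t => X t ω
  eq : ∀ᵐ ω ∂P.μ, ∀ t ∈ Icc P.t₀ P.T, x t ω = X t ω

/-- A measurable representative of `φ` is inserted into the flow; for every `ω` where it equals `φ`,
uniqueness identifies the result with the given arc. -/
theorem IsBoxControl.exists_measurable_version {u : ℝ → Fin m → ℝ} {x : ℝ → Ω → State n} {K : ℝ}
    (hu : P.IsBoxControl u) (hK : P.HasBound K) (h0 : P.H0) (ht : P.t₀ ≤ P.T)
    (hφ : MemLp P.φ 2 P.μ) (hx : ∀ ω, P.IsArc u ω (P.φ ω) fun t => x t ω) :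
    ∃ X : ℝ → Ω → State n, (Measurable fun q : ℝ × Ω => X q.1 q.2) ∧
      (∀ ω, Continuous fun t => X t ω) ∧ ∀ᵐ ω ∂P.μ, ∀ t ∈ Icc P.t₀ P.T, x t ω = X t ω := by
  obtain ⟨Y, hYm, hYc, hY⟩ := hu.exists_flow hK h0 ht
  set φ' := hφ.1.mk P.φ
  have hφ' : Measurable φ' := hφ.1.stronglyMeasurable_mk.measurable
  refine ⟨fun t ω => Y t (ω, φ' ω), ?_, fun ω => hYc _, ?_⟩
  · exact hYm.comp (measurable_fst.prodMk (measurable_snd.prodMk (hφ'.comp measurable_snd)))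
  · filter_upwards [hφ.1.ae_eq_mk] with ω hω t htm
    have h2 := hY (ω, φ' ω)
    rw [← show P.φ ω = φ' ω from hω] at h2 ⊢
    exact (hx ω).unique hK h0 ht hu h2 htm

theorem exists_isReference {u : ℝ → Fin m → ℝ} {x : ℝ → Ω → State n} {δ : ℝ} (h0 : P.H0)
    (ht : P.t₀ < P.T) (hφ : MemLp P.φ 2 P.μ) (hu : P.IsBoxControl u)
    (hx : ∀ ω, P.IsArc u ω (P.φ ω) fun t => x t ω) (hδ : 0 < δ) (h1 : P.H1 x δ) :
    ∃ X K, P.IsReference u x X δ K := by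
  obtain ⟨K, hK⟩ := h0.exists_hasBound
  obtain ⟨X, hXm, hXc, hX⟩ := hu.exists_measurable_version hK h0 ht.le hφ hx
  exact ⟨X, K, h0, ht, hK, hu, hφ, hx, hδ, h1, hXm, hXc, hX⟩

namespace IsReference

variable {u : ℝ → Fin m → ℝ} {x X : ℝ → Ω → State n} {δ K : ℝ}

theorem differentiableAt_f (R : P.IsReference u x X δ K) (i : Fin (m + 1)) (ω : Ω) {t : ℝ}
    (ht : t ∈ Icc P.t₀ P.T) : DifferentiableAt ℝ (fun y => P.f i y ω) (x t ω) :=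
  R.regular.differentiableAt_f R.pos R.lt (R.arc ω).1 ht i

theorem differentiableAt_dyn (R : P.IsReference u x X δ K) (v : Fin m → ℝ) (ω : Ω) {t : ℝ}
    (ht : t ∈ Icc P.t₀ P.T) : DifferentiableAt ℝ (fun y => P.dyn y v ω) (x t ω) :=
  Problem.differentiableAt_dyn (fun i => R.differentiableAt_f i ω ht) v

/-- Expanding in an orthonormal basis leaves only directional derivatives, which have measurable
versions. -/
theorem adjointField_eq_sum (v : ℝ → Fin m → ℝ) (t : ℝ) (ω : Ω) (q : State n) :
    P.adjointField v x t ω q = ∑ i, inner ℝ (fderiv ℝ (fun y => P.dyn y (v t) ω) (x t ω)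
      (EuclideanSpace.basisFun (Fin n) ℝ i)) q • EuclideanSpace.basisFun (Fin n) ℝ i := by
  rw [← (EuclideanSpace.basisFun (Fin n) ℝ).sum_repr' (P.adjointField v x t ω q)]
  simp only [adjointField, ContinuousLinearMap.adjoint_inner_right]

theorem gradient_eq_sum {g : State n → ℝ} {y : State n} (hg : DifferentiableAt ℝ g y) :
    gradient g y = ∑ i, fderiv ℝ g y (EuclideanSpace.basisFun (Fin n) ℝ i) •
      EuclideanSpace.basisFun (Fin n) ℝ i := by
  rw [← (EuclideanSpace.basisFun (Fin n) ℝ).sum_repr' (gradient g y)]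
  refine Finset.sum_congr rfl fun i _ => ?_
  rw [real_inner_comm, hg.hasGradientAt.hasFDerivAt.fderiv]
  rfl

theorem norm_adjointField_le (R : P.IsReference u x X δ K) (t : ℝ) (ω : Ω) (q : State n) :
    ‖P.adjointField u x t ω q‖ ≤ K * ‖q‖ := by
  refine (ContinuousLinearMap.le_opNorm _ _).trans ?_
  rw [LinearIsometryEquiv.norm_map]
  gcongr
  exact R.bound.norm_fderiv_dyn_le (R.control.mem t) ω _

/-- A jointly measurable, globally Lipschitz version of the adjoint field. -/
theorem exists_measurable_adjointField (R : P.IsReference u x X δ K) :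
    ∃ (F : ℝ → Ω → State n → State n) (L : ℝ), 0 < L ∧
      (Measurable fun q : ℝ × Ω × State n => F q.1 q.2.1 q.2.2) ∧
      (∀ t ω q q', ‖F t ω q - F t ω q'‖ ≤ L * ‖q - q'‖) ∧ (∀ t ω, F t ω 0 = 0) ∧
      ∀ᵐ ω ∂P.μ, ∀ t ∈ Icc P.t₀ P.T, ∀ q, P.adjointField u x t ω q = F t ω q := by
  set e := EuclideanSpace.basisFun (Fin n) ℝ with he
  let V : State n × (ℝ × Ω) → State n := fun q => P.dyn q.1 (u q.2.1) q.2.2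
  have hV : Measurable V := (measurable_dyn R.data).comp (measurable_fst.prodMk
    ((R.control.measurable.comp (measurable_fst.comp measurable_snd)).prodMk
      (measurable_snd.comp measurable_snd)))
  let D : Fin n → ℝ × Ω → State n := fun i q => seqDirDeriv V (fun _ => e i) (X q.1 q.2, q)
  have hD : ∀ i, Measurable (D i) := fun i =>
    (measurable_seqDirDeriv hV measurable_const).comp (R.measurable.prodMk measurable_id)
  -- Where `X` differs from `x` the sequential derivative is uncontrolled. Truncating at level `K`
  -- gives a globally Lipschitz field without changing it on the relevant set.
  let D' : Fin n → ℝ × Ω → State n := fun i => {q | ‖D i q‖ ≤ K}.indicator (D i)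
  have hD' : ∀ i, Measurable (D' i) := fun i =>
    (hD i).indicator (measurableSet_le (hD i).norm measurable_const)
  have hD'K : ∀ i q, ‖D' i q‖ ≤ K := fun i q => by
    by_cases h : q ∈ {q | ‖D i q‖ ≤ K}
    · simp only [D', indicator_of_mem h]; exact h
    · simp only [D', indicator_of_notMem h, norm_zero]; exact R.bound.pos.le
  -- The summand `1` keeps the Lipschitz constant positive when `n = 0`.
  refine ⟨fun t ω q => ∑ i, inner ℝ (D' i (t, ω)) q • e i, n * K + 1,
    by have := R.bound.pos; positivity, ?_, ?_, ?_, ?_⟩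
  · refine Finset.measurable_sum _ fun i _ => Measurable.smul_const ?_ _
    exact ((hD' i).comp (measurable_fst.prodMk (measurable_fst.comp measurable_snd))).inner
      (measurable_snd.comp measurable_snd)
  · intro t ω q q'
    rw [← Finset.sum_sub_distrib]
    calc _ ≤ ∑ _i : Fin n, K * ‖q - q'‖ := norm_sum_le_of_le _ fun i _ => by
          rw [← sub_smul, ← inner_sub_right, norm_smul, e.norm_eq_one, mul_one]
          refine (norm_inner_le_norm _ _).trans ?_
          gcongr
          exact hD'K i _
      _ = n * K * ‖q - q'‖ := by simp [mul_assoc]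
      _ ≤ _ := by gcongr; linarith
  · intro t ω
    simp
  · filter_upwards [R.eq] with ω hω t ht q
    rw [adjointField_eq_sum]
    refine Finset.sum_congr rfl fun i _ => ?_
    have h1 : D i (t, ω) = fderiv ℝ (fun y => P.dyn y (u t) ω) (x t ω) (e i) := by
      have h2 : DifferentiableAt ℝ (fun y => V (y, (t, ω))) (X t ω) := by
        rw [← hω t ht]; exact R.differentiableAt_dyn (u t) ω ht
      simp only [D]
      rw [seqDirDeriv_eq h2, hω t ht]
    have h3 : (t, ω) ∈ {q | ‖D i q‖ ≤ K} := by
      rw [mem_ofPred_eq, h1]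
      refine (ContinuousLinearMap.le_opNorm _ _).trans ?_
      rw [e.norm_eq_one, mul_one]
      exact R.bound.norm_fderiv_dyn_le (R.control.mem t) ω _
    simp only [D', indicator_of_mem h3, h1]
    rfl

theorem exists_measurable_gradient (R : P.IsReference u x X δ K) :
    ∃ η : Ω → State n, Measurable η ∧
      ∀ᵐ ω ∂P.μ, gradient (fun z => P.g z ω) (x P.T ω) = η ω := by
  set e := EuclideanSpace.basisFun (Fin n) ℝ with he
  refine ⟨fun ω => ∑ i, seqDirDeriv (fun q : State n × Ω => P.g q.1 q.2) (fun _ => e i)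
    (X P.T ω, ω) • e i, ?_, ?_⟩
  · refine Finset.measurable_sum _ fun i _ => Measurable.smul_const ?_ _
    refine (measurable_seqDirDeriv R.data.g_measurable measurable_const).comp ?_
    exact (R.measurable.comp (measurable_const.prodMk measurable_id)).prodMk measurable_id
  · filter_upwards [R.eq] with ω hω
    have hT : P.T ∈ Icc P.t₀ P.T := ⟨R.lt.le, le_rfl⟩
    have hd := R.regular.g_differentiable ω (x P.T ω) (Metric.mem_ball_self R.pos)
    rw [gradient_eq_sum hd]
    refine Finset.sum_congr rfl fun i _ => ?_
    rw [hω _ hT] at hd ⊢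
    rw [seqDirDeriv_eq hd]

end IsReference

/-- Jointly measurable, bounded version of the adjoint state. -/
structure IsRegularCostate (P : Problem n m Ω) (u : ℝ → Fin m → ℝ) (x p : ℝ → Ω → State n)
    (C : ℝ) : Prop where
  measurable : Measurable fun q : ℝ × Ω => p q.1 q.2
  continuous : ∀ ω, Continuous fun t => p t ω
  bound : ∀ᵐ ω ∂P.μ, ∀ t ∈ Icc P.t₀ P.T, ‖p t ω‖ ≤ C
  integrable : ∀ᵐ ω ∂P.μ,
    IntervalIntegrable (fun s => P.adjointField u x s ω (p s ω)) volume P.t₀ P.T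
  adjoint_eq : ∀ᵐ ω ∂P.μ, ∀ t ∈ Icc P.t₀ P.T,
    p t ω = p P.T ω + ∫ s in t..P.T, P.adjointField u x s ω (p s ω)
  terminal : ∀ᵐ ω ∂P.μ, -p P.T ω = gradient (fun z => P.g z ω) (x P.T ω)

namespace IsReference

variable {u : ℝ → Fin m → ℝ} {x X : ℝ → Ω → State n} {δ K : ℝ}

theorem intervalIntegrable_field {F : ℝ → Ω → State n → State n} {L a b : ℝ} (hab : a ≤ b)
    (hF : Measurable fun q : ℝ × Ω × State n => F q.1 q.2.1 q.2.2) (hL : 0 < L)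
    (hFL : ∀ t ω q q', ‖F t ω q - F t ω q'‖ ≤ L * ‖q - q'‖) (hF0 : ∀ t ω, F t ω 0 = 0)
    {q : ℝ → State n} (hq : ContinuousOn q (Icc a b)) (ω : Ω) :
    IntervalIntegrable (fun s => F s ω (q s)) volume a b := by
  obtain ⟨D, hD⟩ := isCompact_Icc.exists_bound_of_continuousOn hq
  exact (intervalIntegrable_iff_integrableOn_Icc_of_le hab).2
    (integrableOn_caratheodory hF hL.le (fun t z => hFL t z) (C := fun _ => 0)
      (fun t z => by rw [hF0, norm_zero]) (hq.aestronglyMeasurable measurableSet_Icc) hD)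

/-- The measurable field is solved backwards from the terminal gradient. As that gradient is bounded
uniformly in `ω`, so is the adjoint state, and this bound dominates every later integrand. -/
theorem exists_regularCostate (R : P.IsReference u x X δ K) :
    ∃ p C, P.IsRegularCostate u x p C := by
  obtain ⟨F, L, hL, hFm, hFL, hF0, hF⟩ := R.exists_measurable_adjointField
  obtain ⟨η, hη, hη'⟩ := R.exists_measurable_gradient
  obtain ⟨C, hC0, hC⟩ := R.regular.g_gradient_bound
  have hTm : P.T ∈ Icc P.t₀ P.T := ⟨R.lt.le, le_rfl⟩
  obtain ⟨p, hpm, hpc, hp⟩ := exists_caratheodory_solution_backward (a := P.t₀) (b := P.T)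
    (F := F) (C := fun _ => 0) (ξ := fun ω => -η ω) R.lt.le hFm hL (fun t z => hFL t z)
    (fun t z => by rw [hF0, norm_zero]) hη.neg
  have hpT : ∀ ω, p P.T ω = -η ω := fun ω => by rw [hp ω P.T hTm]; simp
  have hcongr : ∀ ω, (∀ t ∈ Icc P.t₀ P.T, ∀ q, P.adjointField u x t ω q = F t ω q) →
      ∀ t ∈ Icc P.t₀ P.T, ∫ s in t..P.T, P.adjointField u x s ω (p s ω) =
        ∫ s in t..P.T, F s ω (p s ω) := fun ω h t ht =>
    intervalIntegral.integral_congr fun s hs => by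
      rw [uIcc_of_le ht.2] at hs
      exact h s ⟨ht.1.trans hs.1, hs.2⟩ _
  have hadj : ∀ᵐ ω ∂P.μ, ∀ t ∈ Icc P.t₀ P.T,
      p t ω = p P.T ω + ∫ s in t..P.T, P.adjointField u x s ω (p s ω) := by
    filter_upwards [hF] with ω h t ht
    rw [hcongr ω h t ht, hpT, ← hp ω t ht]
  refine ⟨p, C * Real.exp (L * (P.T - P.t₀)), hpm, hpc, ?_, ?_, hadj, ?_⟩
  · filter_upwards [hη'] with ω h t ht
    have key := le_exp_of_le_add_integral_backward (h := fun t => ‖p t ω‖) (a := P.t₀)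
      (b := P.T) (C := C) (K := L) (hpc ω).norm.continuousOn hL.le (fun s hs => by
        rw [hp ω s hs, ← intervalIntegral.integral_const_mul]
        refine (norm_add_le _ _).trans (add_le_add ?_ ?_)
        · rw [norm_neg, ← h]; exact hC ω
        · refine intervalIntegral.norm_integral_le_of_norm_le hs.2
            (Eventually.of_forall fun r _ => ?_) (((hpc ω).norm.const_smul L).intervalIntegrable _ _)
          simpa [hF0] using hFL r ω (p r ω) 0) t ht
    refine key.trans ?_
    gcongr
    exact ht.1
  · filter_upwards [hF] with ω h
    refine (intervalIntegrable_congr fun s hs => ?_).1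
      (intervalIntegrable_field R.lt.le hFm hL hFL hF0 (hpc ω).continuousOn ω)
    rw [uIoc_of_le R.lt.le] at hs
    exact (h s (Ioc_subset_Icc_self hs) _).symm
  · filter_upwards [hη'] with ω h
    rw [hpT, neg_neg, h]

end IsReference

end Problem

end EnsembleControl

namespace EnsembleControl

/-! ### Both notions of adjoint state agree with the regular version. -/

namespace Problem

set_option linter.unusedSectionVars false

variable {n m : ℕ} {Ω : Type*} [MetricSpace Ω] [MeasurableSpace Ω] {P : Problem n m Ω}
  {u : ℝ → Fin m → ℝ} {x X : ℝ → Ω → State n} {δ K : ℝ}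

namespace IsReference

theorem adjointField_congr {u₀ : ℝ → Fin m → ℝ} (hu : u =ᵐ[volume.restrict (Icc P.t₀ P.T)] u₀)
    {F : ℝ → Ω → State n → State n} {ω : Ω} (y : ℝ → State n)
    (hF : ∀ t ∈ Icc P.t₀ P.T, ∀ q, P.adjointField u x t ω q = F t ω q) {t : ℝ}
    (ht : t ∈ Icc P.t₀ P.T) :
    ∫ s in t..P.T, P.adjointField u₀ x s ω (y s) = ∫ s in t..P.T, F s ω (y s) := by
  refine intervalIntegral.integral_congr_ae ?_
  rw [uIoc_of_le ht.2]
  filter_upwards [(ae_restrict_iff' measurableSet_Icc).1 hu] with s hs hsm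
  have hs' : s ∈ Icc P.t₀ P.T := ⟨ht.1.trans hsm.1.le, hsm.2⟩
  rw [← hF s hs']
  simp only [adjointField, hs hs']

/-- Pathwise backward Grönwall from the common terminal value; the support carries full measure
because the space is hereditarily Lindelöf. -/
theorem ae_eq_of_isCostate [OpensMeasurableSpace Ω] [HereditarilyLindelofSpace Ω] (R : P.IsReference u x X δ K) {u₀ : ℝ → Fin m → ℝ}
    (hu : u =ᵐ[volume.restrict (Icc P.t₀ P.T)] u₀) {p p' : ℝ → Ω → State n} {C : ℝ}
    (hp : P.IsCostate u₀ x p) (hp' : P.IsRegularCostate u x p' C) :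
    ∀ᵐ ω ∂P.μ, ∀ t ∈ Icc P.t₀ P.T, p t ω = p' t ω := by
  obtain ⟨F, L, hL, hFm, hFL, hF0, hF⟩ := R.exists_measurable_adjointField
  filter_upwards [hF, hp'.adjoint_eq, hp'.terminal, P.μ.support_mem_ae] with ω hω h2 h3 hsupp t ht
  have hc := hp.continuousOn ω hsupp
  have hc' := (hp'.continuous ω).continuousOn (s := Icc P.t₀ P.T)
  have hi := intervalIntegrable_field R.lt.le hFm hL hFL hF0 hc ω
  have hi' := intervalIntegrable_field R.lt.le hFm hL hFL hF0 hc' ω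
  have hTT : p P.T ω = p' P.T ω := by
    rw [← neg_inj, hp.terminal ω hsupp, h3]
  have key := le_exp_of_le_add_integral_backward (h := fun t => ‖p t ω - p' t ω‖) (a := P.t₀)
    (b := P.T) (C := 0) (K := L) (hc.sub hc').norm hL.le (fun s hs => by
      have hsub : uIcc s P.T ⊆ uIcc P.t₀ P.T := by
        rw [uIcc_of_le hs.2, uIcc_of_le R.lt.le]; exact Icc_subset_Icc_left hs.1
      rw [hp.adjoint_eq ω hsupp s hs, h2 s hs, hTT, add_sub_add_left_eq_sub, zero_add,
        adjointField_congr hu _ hω hs, adjointField_congr (EventuallyEq.refl _ u) _ hω hs,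
        ← intervalIntegral.integral_sub (hi.mono_set hsub) (hi'.mono_set hsub),
        ← intervalIntegral.integral_const_mul]
      refine intervalIntegral.norm_integral_le_of_norm_le hs.2
        (Eventually.of_forall fun r _ => hFL r ω _ _) (ContinuousOn.intervalIntegrable ?_)
      rw [uIcc_of_le hs.2]
      exact ((hc.sub hc').norm.const_smul L).mono (Icc_subset_Icc_left hs.1)) t ht
  simp only [zero_mul, norm_le_zero_iff, sub_eq_zero] at key
  exact key

theorem memLp_regularCostate (R : P.IsReference u x X δ K) {p : ℝ → Ω → State n} {C : ℝ}
    (hp : P.IsRegularCostate u x p C) {t : ℝ} (ht : t ∈ Icc P.t₀ P.T) : MemLp (p t) 2 P.μ := by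
  have := R.data.prob
  refine (memLp_top_of_bound ?_ C ?_).mono_exponent le_top
  · exact (hp.measurable.comp measurable_prodMk_left).aestronglyMeasurable
  · filter_upwards [hp.bound] with ω h using h t ht

/-- An `L²`-valued solution has no distinguished paths, so the comparison is made in `L²`: the
difference `q - Q` satisfies `‖q - Q‖(t) ≤ L ∫_t^T ‖q - Q‖` and vanishes at `T`. -/
theorem ae_eq_of_isMeanCostate (R : P.IsReference u x X δ K) {u₀ : ℝ → Fin m → ℝ}
    (hu : u =ᵐ[volume.restrict (Icc P.t₀ P.T)] u₀) {p p' : ℝ → Ω → State n} {C : ℝ}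
    (hp : P.IsMeanCostate u₀ x p) (hp' : P.IsRegularCostate u x p' C) :
    ∀ t ∈ Icc P.t₀ P.T, p t =ᵐ[P.μ] p' t := by
  have := R.data.prob
  obtain ⟨F, L, hL, hFm, hFL, hF0, hF⟩ := R.exists_measurable_adjointField
  obtain ⟨q, dq, hpq, hdq, hq, hadj, hterm⟩ := hp
  have hle := R.lt.le
  have hTm : P.T ∈ Icc P.t₀ P.T := ⟨hle, le_rfl⟩
  have hsub : ∀ s ∈ Icc P.t₀ P.T, uIcc s P.T ⊆ uIcc P.t₀ P.T := fun s hs => by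
    rw [uIcc_of_le hs.2, uIcc_of_le hle]; exact Icc_subset_Icc_left hs.1
  classical
  -- `L²`-valued curve of the regular costate
  let Q : ℝ → Lp (State n) 2 P.μ := fun t =>
    if ht : t ∈ Icc P.t₀ P.T then (R.memLp_regularCostate hp' ht).toLp else 0
  have hQ : ∀ t ∈ Icc P.t₀ P.T, Q t =ᵐ[P.μ] p' t := fun t ht => by
    simp only [Q, dif_pos ht]; exact MemLp.coeFn_toLp _
  have hFint : ∀ᵐ ω ∂P.μ, IntervalIntegrable (fun s => F s ω (p' s ω)) volume P.t₀ P.T :=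
    Eventually.of_forall fun ω => intervalIntegrable_field hle hFm hL hFL hF0
      (hp'.continuous ω).continuousOn ω
  have hFbd : ∀ᵐ ω ∂P.μ, ∀ s ∈ Icc P.t₀ P.T, ‖F s ω (p' s ω)‖ ≤ L * C := by
    filter_upwards [hp'.bound] with ω h s hs
    have h1 := hFL s ω (p' s ω) 0
    rw [hF0, sub_zero, sub_zero] at h1
    exact h1.trans (by gcongr; exact h s hs)
  have hp'eq : ∀ᵐ ω ∂P.μ, ∀ t ∈ Icc P.t₀ P.T,
      p' t ω = p' P.T ω + ∫ s in t..P.T, F s ω (p' s ω) := by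
    filter_upwards [hF, hp'.adjoint_eq] with ω hω h t ht
    rw [h t ht, adjointField_congr (EventuallyEq.refl _ u) _ hω ht]
  have hQlip : ∀ s ∈ Icc P.t₀ P.T, ∀ t ∈ Icc P.t₀ P.T, ‖Q t - Q s‖ ≤ L * C * |t - s| := by
    intro s hs t ht
    have hC0 : 0 ≤ L * C := by
      obtain ⟨ω, h⟩ := hFbd.exists
      exact (norm_nonneg _).trans (h s hs)
    refine (Lp.norm_le_of_ae_bound (C := L * C * |t - s|) (by positivity) ?_).trans
      (by simp [measureUnivNNReal])
    filter_upwards [Lp.coeFn_sub (Q t) (Q s), hQ t ht, hQ s hs, hFbd, hFint, hp'eq]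
      with ω h1 h2 h3 h4 h5 h6
    rw [h1, Pi.sub_apply, h2, h3, h6 t ht, h6 s hs, add_sub_add_left_eq_sub,
      intervalIntegral.integral_symm P.T t, intervalIntegral.integral_symm P.T s, neg_sub_neg,
      intervalIntegral.integral_interval_sub_left (h5.mono_set (hsub s hs)).symm
        (h5.mono_set (hsub t ht)).symm, abs_sub_comm]
    refine intervalIntegral.norm_integral_le_of_norm_le_const fun r hr => h4 r ?_
    exact ⟨(le_min ht.1 hs.1).trans hr.1.le, hr.2.trans (max_le ht.2 hs.2)⟩
  have hqc : ContinuousOn q (Icc P.t₀ P.T) := by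
    have h1 := intervalIntegral.continuousOn_primitive_interval' hdq left_mem_uIcc
    rw [uIcc_of_le hle] at h1
    exact (continuousOn_const.add h1).congr hq
  have hQc : ContinuousOn Q (Icc P.t₀ P.T) :=
    (LipschitzOnWith.of_dist_le_mul (K := (L * C).toNNReal) fun t ht s hs => by
      rw [dist_eq_norm, Real.dist_eq]
      refine (hQlip s hs t ht).trans ?_
      gcongr
      exact Real.le_coe_toNNReal _).continuousOn
  have hrT : q P.T - Q P.T = 0 := by
    rw [sub_eq_zero]
    refine Lp.ext ?_
    filter_upwards [hQ _ hTm, hterm, hp'.terminal] with ω h1 h2 h3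
    rw [h1, ← neg_inj, h2, h3]
  -- pointwise form of the `L²` equation
  have hadj' : ∀ᵐ s ∂volume.restrict (Icc P.t₀ P.T), ∀ᵐ ω ∂P.μ, -(dq s ω) = F s ω (q s ω) := by
    filter_upwards [hadj, hu, ae_restrict_mem measurableSet_Icc] with s h1 h2 hs
    filter_upwards [h1, hF] with ω h3 h4
    rw [h3, ← h4 s hs]
    simp only [adjointField, h2]
  have hFmem : ∀ s ∈ Icc P.t₀ P.T, MemLp (fun ω => F s ω (p' s ω)) 2 P.μ := fun s hs => by
    refine (memLp_top_of_bound ?_ (L * C) ?_).mono_exponent le_top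
    · exact (hFm.comp (measurable_const.prodMk (measurable_id.prodMk
        (hp'.measurable.comp measurable_prodMk_left)))).aestronglyMeasurable
    · filter_upwards [hFbd] with ω h using h s hs
  -- The difference is tested against its own value `w` at the fixed time `t`. This makes the
  -- identities scalar, and Fubini replaces an `L²`-valued integral equation for `Q`.
  have hineq : ∀ t ∈ Icc P.t₀ P.T, ‖q t - Q t‖ ≤ 0 + L * ∫ s in t..P.T, ‖q s - Q s‖ := by
    intro t ht
    set w := q t - Q t with hw
    have hrc : IntervalIntegrable (fun s => ‖q s - Q s‖) volume t P.T := by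
      refine ContinuousOn.intervalIntegrable ?_
      rw [uIcc_of_le ht.2]
      exact (hqc.sub hQc).norm.mono (Icc_subset_Icc_left ht.1)
    have hdt : IntervalIntegrable dq volume t P.T := hdq.mono_set (hsub t ht)
    have h1 : inner ℝ w (q t) = inner ℝ w (q P.T) - ∫ s in t..P.T, inner ℝ w (dq s) := by
      have h2 : ∫ s in t..P.T, inner ℝ w (dq s) = inner ℝ w (∫ s in t..P.T, dq s) :=
        (innerSL ℝ w).intervalIntegral_comp_comm hdt
      have h3 : ∫ s in t..P.T, dq s = q P.T - q t := by
        rw [hq _ hTm, hq t ht, add_sub_add_left_eq_sub,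
          intervalIntegral.integral_interval_sub_left hdq]
        refine hdq.mono_set ?_
        rw [uIcc_of_le ht.1, uIcc_of_le hle]; exact Icc_subset_Icc_right ht.2
      rw [h2, h3, inner_sub_right, sub_sub_cancel]
    have hwF : Integrable (fun z : ℝ × Ω => inner ℝ (w z.2) (F z.1 z.2 (p' z.1 z.2)))
        ((volume.restrict (Ioc t P.T)).prod P.μ) := by
      have hw1 : Integrable (fun ω => ‖w ω‖ * (L * C)) P.μ :=
        ((Lp.memLp w).integrable (by norm_num)).norm.mul_const _
      refine (hw1.comp_snd (volume.restrict (Ioc t P.T))).mono' ?_ ?_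
      · refine AEStronglyMeasurable.inner (𝕜 := ℝ) ?_ ?_
        · exact (Lp.aestronglyMeasurable w).comp_snd
        · exact (hFm.comp (measurable_fst.prodMk (measurable_snd.prodMk
            hp'.measurable))).aestronglyMeasurable
      · have h2 : ∀ᵐ z ∂(volume.restrict (Ioc t P.T)).prod P.μ,
            ∀ s ∈ Icc P.t₀ P.T, ‖F s z.2 (p' s z.2)‖ ≤ L * C :=
          Measure.quasiMeasurePreserving_snd.ae hFbd
        have h3 : ∀ᵐ z ∂(volume.restrict (Ioc t P.T)).prod P.μ, z.1 ∈ Ioc t P.T :=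
          Measure.quasiMeasurePreserving_fst.ae (ae_restrict_mem measurableSet_Ioc)
        filter_upwards [h2, h3] with z h4 h5
        refine (norm_inner_le_norm _ _).trans ?_
        gcongr
        exact h4 _ ⟨ht.1.trans h5.1.le, h5.2⟩
    have h4 : inner ℝ w (Q t) = inner ℝ w (Q P.T) +
        ∫ s in t..P.T, ∫ ω, inner ℝ (w ω) (F s ω (p' s ω)) ∂P.μ := by
      rw [intervalIntegral.integral_of_le ht.2, integral_integral_swap hwF, ← sub_eq_iff_eq_add',
        ← inner_sub_right, L2.inner_def]
      refine integral_congr_ae ?_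
      filter_upwards [Lp.coeFn_sub (Q t) (Q P.T), hQ t ht, hQ _ hTm, hp'eq, hFint]
        with ω h5 h6 h7 h8 h9
      rw [h5, Pi.sub_apply, h6, h7, h8 t ht, add_sub_cancel_left,
        ← intervalIntegral.integral_of_le ht.2]
      exact ((innerSL ℝ (w ω)).intervalIntegral_comp_comm (h9.mono_set (hsub t ht))).symm
    have hI1 : IntervalIntegrable (fun s => inner ℝ w (dq s)) volume t P.T :=
      ⟨(innerSL ℝ w).integrable_comp hdt.1, (innerSL ℝ w).integrable_comp hdt.2⟩
    have hI2 : IntervalIntegrable (fun s => ∫ ω, inner ℝ (w ω) (F s ω (p' s ω)) ∂P.μ)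
        volume t P.T :=
      (intervalIntegrable_iff_integrableOn_Ioc_of_le ht.2).2 hwF.integral_prod_left
    have h5 : inner ℝ w w = ∫ s in t..P.T, (-inner ℝ w (dq s) -
        ∫ ω, inner ℝ (w ω) (F s ω (p' s ω)) ∂P.μ) := by
      have h6 : inner ℝ w (q P.T) = inner ℝ w (Q P.T) := by rw [sub_eq_zero.1 hrT]
      have hI1' : IntervalIntegrable (fun s => -inner ℝ w (dq s)) volume t P.T := hI1.neg
      rw [intervalIntegral.integral_sub hI1' hI2, intervalIntegral.integral_neg]
      nth_rw 2 [hw]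
      rw [inner_sub_right, h1, h4, h6]
      ring
    have h7 : ‖w‖ * ‖w‖ ≤ ∫ s in t..P.T, ‖w‖ * (L * ‖q s - Q s‖) := by
      rw [← real_inner_self_eq_norm_mul_norm, h5]
      refine (Real.le_norm_self _).trans ?_
      refine intervalIntegral.norm_integral_le_of_norm_le ht.2 ?_
        ((hrc.const_mul L).const_mul ‖w‖)
      filter_upwards [(ae_restrict_iff' measurableSet_Icc).1 hadj'] with s h8 hs
      have hs' : s ∈ Icc P.t₀ P.T := ⟨ht.1.trans hs.1.le, hs.2⟩
      specialize h8 hs'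
      -- By the `L²` equation, `e` represents `F(q) - F(p')`, which the Lipschitz bound controls by
      -- `q - Q`.
      set e : Lp (State n) 2 P.μ := -(dq s) - (hFmem s hs').toLp with he
      have h9 : -inner ℝ w (dq s) - ∫ ω, inner ℝ (w ω) (F s ω (p' s ω)) ∂P.μ = inner ℝ w e := by
        rw [he, inner_sub_right, inner_neg_right]
        congr 1
        rw [L2.inner_def]
        refine integral_congr_ae ?_
        filter_upwards [(hFmem s hs').coeFn_toLp] with ω h10
        rw [h10]
      have h11 : ‖e‖ ≤ L * ‖q s - Q s‖ := by
        refine Lp.norm_le_mul_norm_of_ae_le_mul ?_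
        filter_upwards [Lp.coeFn_sub (-(dq s)) (hFmem s hs').toLp, Lp.coeFn_neg (dq s),
          (hFmem s hs').coeFn_toLp, h8, Lp.coeFn_sub (q s) (Q s), hQ s hs']
          with ω g1 g2 g3 g4 g5 g6
        rw [g1, g5, Pi.sub_apply, Pi.sub_apply, g2, Pi.neg_apply, g3, g4, g6]
        exact hFL s ω _ _
      rw [h9]
      refine (norm_inner_le_norm _ _).trans ?_
      gcongr
    rw [intervalIntegral.integral_const_mul, intervalIntegral.integral_const_mul] at h7
    rw [zero_add]
    rcases (norm_nonneg w).eq_or_lt with h0 | h0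
    · rw [← h0]
      have : 0 ≤ ∫ s in t..P.T, ‖q s - Q s‖ :=
        intervalIntegral.integral_nonneg ht.2 fun _ _ => norm_nonneg _
      positivity
    · exact le_of_mul_le_mul_left h7 h0
  intro t ht
  have key := le_exp_of_le_add_integral_backward (h := fun t => ‖q t - Q t‖)
    (hqc.sub hQc).norm hL.le hineq t ht
  simp only [zero_mul, norm_le_zero_iff, sub_eq_zero] at key
  exact (hpq t ht).trans (by rw [key]; exact hQ t ht)

theorem ae_eq_regularCostate [OpensMeasurableSpace Ω] [HereditarilyLindelofSpace Ω]
    (R : P.IsReference u x X δ K) {u₀ : ℝ → Fin m → ℝ}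
    (hu : u =ᵐ[volume.restrict (Icc P.t₀ P.T)] u₀) {p p' : ℝ → Ω → State n} {C : ℝ}
    (hp : P.IsCostate u₀ x p ∨ P.IsMeanCostate u₀ x p) (hp' : P.IsRegularCostate u x p' C) :
    ∀ t ∈ Icc P.t₀ P.T, p t =ᵐ[P.μ] p' t := by
  rcases hp with hp | hp
  · intro t ht
    filter_upwards [R.ae_eq_of_isCostate hu hp hp'] with ω h using h t ht
  · exact R.ae_eq_of_isMeanCostate hu hp hp'

end IsReference

end Problem

end EnsembleControl

/-! ### First variation of the cost of one arc. -/

namespace EnsembleControl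

set_option linter.unusedSectionVars false

theorem exists_lipschitzOnWith_inner {E : Type*} [NormedAddCommGroup E] [InnerProductSpace ℝ E]
    {p z : ℝ → E} {a b : ℝ} {L M : NNReal} (hp : LipschitzOnWith L p (Icc a b))
    (hz : LipschitzOnWith M z (Icc a b)) :
    ∃ N, LipschitzOnWith N (fun t => inner ℝ (p t) (z t)) (Icc a b) := by
  obtain ⟨A, hA⟩ := isCompact_Icc.exists_bound_of_continuousOn hp.continuousOn
  obtain ⟨B, hB⟩ := isCompact_Icc.exists_bound_of_continuousOn hz.continuousOn
  refine ⟨(L * |B| + |A| * M).toNNReal, LipschitzOnWith.of_dist_le_mul fun t ht s hs => ?_⟩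
  rw [Real.coe_toNNReal _ (by positivity), Real.dist_eq]
  have h1 := hp.dist_le_mul t ht s hs
  have h2 := hz.dist_le_mul t ht s hs
  rw [dist_eq_norm] at h1 h2
  have h3 : inner ℝ (p t) (z t) - inner ℝ (p s) (z s) =
      inner ℝ (p t - p s) (z t) + inner ℝ (p s) (z t - z s) := by
    rw [inner_sub_left, inner_sub_right]; ring
  rw [h3, add_mul]
  refine (abs_add_le _ _).trans (add_le_add ?_ ?_)
  · refine (abs_real_inner_le_norm _ _).trans ?_
    calc _ ≤ (L * dist t s) * |B| :=
          mul_le_mul h1 ((hB t ht).trans (le_abs_self B)) (norm_nonneg _) (by positivity)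
      _ = _ := by ring
  · refine (abs_real_inner_le_norm _ _).trans ?_
    calc _ ≤ |A| * (M * dist t s) :=
          mul_le_mul ((hA s hs).trans (le_abs_self A)) h2 (norm_nonneg _) (by positivity)
      _ = _ := by ring

theorem integrable_prod_of_ae_bound {Ω : Type*} [MeasurableSpace Ω] {μ : Measure Ω} [SFinite μ]
    {a b : ℝ} {k : ℝ → Ω → ℝ} {B : Ω → ℝ}
    (hk : AEStronglyMeasurable (fun q : ℝ × Ω => k q.1 q.2) ((volume.restrict (Icc a b)).prod μ))
    (hB : Integrable B μ) (hkB : ∀ᵐ ω ∂μ, ∀ t ∈ Icc a b, |k t ω| ≤ B ω) :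
    Integrable (fun q : ℝ × Ω => k q.1 q.2) ((volume.restrict (Icc a b)).prod μ) := by
  refine (hB.comp_snd (volume.restrict (Icc a b))).mono' hk ?_
  filter_upwards [Measure.quasiMeasurePreserving_snd.ae hkB,
    Measure.quasiMeasurePreserving_fst.ae (ae_restrict_mem measurableSet_Icc)] with q h1 h2
  exact h1 q.1 h2

namespace Problem

variable {n m : ℕ} {Ω : Type*} [MetricSpace Ω] [MeasurableSpace Ω] {P : Problem n m Ω}
  {u : ℝ → Fin m → ℝ} {x X : ℝ → Ω → State n} {δ K : ℝ}

namespace IsReference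

/-- Rewriting the terminal-value equation from the initial time puts it in the form to which
Lebesgue differentiation applies. -/
theorem costate_arc (R : P.IsReference u x X δ K) {p : ℝ → Ω → State n} {C : ℝ}
    (hp : P.IsRegularCostate u x p C) :
    ∀ᵐ ω ∂P.μ, (∃ L, LipschitzOnWith L (fun t => p t ω) (Icc P.t₀ P.T)) ∧
      ∀ᵐ t ∂volume.restrict (Icc P.t₀ P.T),
        HasDerivAt (fun t => p t ω) (-P.adjointField u x t ω (p t ω)) t := by
  filter_upwards [hp.bound, hp.integrable, hp.adjoint_eq] with ω h1 h2 h3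
  have hle := R.lt.le
  have h4 : ∀ t ∈ Icc P.t₀ P.T,
      p t ω = p P.t₀ ω + ∫ s in P.t₀..t, -P.adjointField u x s ω (p s ω) := fun t ht => by
    have h5 : IntervalIntegrable (fun s => P.adjointField u x s ω (p s ω)) volume P.t₀ t :=
      h2.mono_set (by rw [uIcc_of_le ht.1, uIcc_of_le hle]; exact Icc_subset_Icc_right ht.2)
    have h6 : IntervalIntegrable (fun s => P.adjointField u x s ω (p s ω)) volume t P.T :=
      h2.mono_set (by rw [uIcc_of_le ht.2, uIcc_of_le hle]; exact Icc_subset_Icc_left ht.1)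
    rw [h3 t ht, h3 P.t₀ ⟨le_rfl, hle⟩, intervalIntegral.integral_neg,
      ← intervalIntegral.integral_add_adjacent_intervals h5 h6]
    abel
  refine ⟨⟨_, lipschitzOnWith_of_eq_add_integral (M := K * C) h2.neg ?_ h4⟩,
    ae_hasDerivAt_of_eq_add_integral hle h2.neg h4⟩
  filter_upwards [ae_restrict_mem measurableSet_Icc] with s hs
  rw [Pi.neg_apply, norm_neg]
  refine (R.norm_adjointField_le s ω _).trans ?_
  have := R.bound.pos
  gcongr
  exact h1 s hs

/-- Directional derivative of the terminal cost of a single arc under convex variations of the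
control, expressed through the adjoint state. -/
theorem tendsto_cost_quotient (R : P.IsReference u x X δ K) {v : ℝ → Fin m → ℝ}
    (hv : P.IsBoxControl v) {ω : Ω} {p : ℝ → State n} (hpc : ContinuousOn p (Icc P.t₀ P.T))
    (hpl : ∃ L, LipschitzOnWith L p (Icc P.t₀ P.T))
    (hpd : ∀ᵐ t ∂volume.restrict (Icc P.t₀ P.T),
      HasDerivAt p (-P.adjointField u x t ω (p t)) t)
    (hpT : -p P.T = gradient (fun z => P.g z ω) (x P.T ω))
    {l : ℕ → ℝ} (hl0 : ∀ k, 0 < l k) (hl1 : ∀ k, l k ≤ 1) (hl : Tendsto l atTop (𝓝 0))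
    {y : ℕ → ℝ → State n} (hy : ∀ k, P.IsArc (mix u v (l k)) ω (P.φ ω) (y k)) :
    Tendsto (fun k => (l k)⁻¹ * (P.g (y k P.T) ω - P.g (x P.T ω) ω)) atTop
      (𝓝 (-∫ t in P.t₀..P.T, inner ℝ (p t) (∑ j, (v t j - u t j) • P.f j.succ (x t ω) ω))) := by
  have hle := R.lt.le
  have hTm : P.T ∈ Icc P.t₀ P.T := ⟨hle, le_rfl⟩
  have h0m : P.t₀ ∈ Icc P.t₀ P.T := ⟨le_rfl, hle⟩
  have hlI : ∀ k, l k ∈ Icc (0 : ℝ) 1 := fun k => ⟨(hl0 k).le, hl1 k⟩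
  obtain ⟨C₀, hC₀, hvar⟩ := exists_variation_bound R.bound R.data hle
  set C := C₀ * (1 + ‖P.φ ω‖) with hC
  have hvar' := fun k => hvar R.control hv (hlI k) (R.arc ω) (hy k)
  obtain ⟨A, hA⟩ := isCompact_Icc.exists_bound_of_continuousOn hpc
  have hA0 : 0 ≤ A := (norm_nonneg _).trans (hA _ h0m)
  -- the scalar functions whose increments are computed in two ways
  let D : ℝ → State n →L[ℝ] State n := fun t => fderiv ℝ (fun z => P.dyn z (u t) ω) (x t ω)
  let h' : ℕ → ℝ → ℝ := fun k t => inner ℝ (p t)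
    (P.dyn (y k t) (mix u v (l k) t) ω - P.dyn (x t ω) (u t) ω - D t (y k t - x t ω))
  -- The adjoint equation cancels the linear part of the velocity difference. Both arcs start at `φ
  -- ω`, so the remainder integrates to the terminal pairing.
  have hftc : ∀ k, IntervalIntegrable (h' k) volume P.t₀ P.T ∧
      ∫ t in P.t₀..P.T, h' k t = inner ℝ (p P.T) (y k P.T - x P.T ω) := by
    intro k
    have hw := R.control.mix hv (hlI k)
    obtain ⟨L, hL⟩ := hpl
    obtain ⟨L₁, hL₁⟩ := (R.arc ω).lipschitzOnWith R.bound R.data hle R.control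
    obtain ⟨L₂, hL₂⟩ := (hy k).lipschitzOnWith R.bound R.data hle hw
    obtain ⟨N, hN⟩ := exists_lipschitzOnWith_inner hL (hL₂.sub hL₁)
    have hder : ∀ᵐ t ∂volume.restrict (Icc P.t₀ P.T),
        HasDerivAt (fun t => inner ℝ (p t) (y k t - x t ω)) (h' k t) t := by
      filter_upwards [hpd, (R.arc ω).ae_hasDerivAt R.bound R.data hle R.control,
        (hy k).ae_hasDerivAt R.bound R.data hle hw] with t h1 h2 h3
      refine (h1.inner ℝ (h3.sub h2)).congr_deriv ?_
      simp only [h', D, adjointField, inner_neg_left, ContinuousLinearMap.adjoint_inner_left,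
        inner_sub_right, map_sub, Pi.sub_apply]
      ring
    obtain ⟨h1, h2⟩ := integral_eq_sub_of_lipschitzOnWith hN hder h0m hTm
    refine ⟨h1, ?_⟩
    rw [h2, (hy k).initial hle, (R.arc ω).initial hle, sub_self, inner_zero_right, sub_zero]
  -- After division by `l k`, the integrand is a Fréchet remainder tending to zero plus the
  -- controlled fields evaluated at `y k`, which tend to those at `x`. No linearised state equation
  -- has to be solved.
  have hlim : Tendsto (fun k => ∫ t in P.t₀..P.T, (l k)⁻¹ * h' k t) atTop
      (𝓝 (∫ t in P.t₀..P.T, inner ℝ (p t) (∑ j, (v t j - u t j) • P.f j.succ (x t ω) ω))) := by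
    refine intervalIntegral.tendsto_integral_filter_of_dominated_convergence
      (fun _ => A * (C + K * C)) (Eventually.of_forall fun k => ?_)
      (Eventually.of_forall fun k => Eventually.of_forall fun t ht => ?_)
      intervalIntegrable_const (Eventually.of_forall fun t ht => ?_)
    · exact ((hftc k).1.const_mul _).def'.aestronglyMeasurable
    · rw [uIoc_of_le hle] at ht
      have htm := Ioc_subset_Icc_self ht
      obtain ⟨h1, h2⟩ := hvar' k t htm
      have hK0 := R.bound.pos
      have h3 : ‖D t (y k t - x t ω)‖ ≤ K * (l k * C) := by
        refine (ContinuousLinearMap.le_opNorm _ _).trans ?_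
        gcongr
        · exact R.bound.norm_fderiv_dyn_le (R.control.mem t) ω _
      rw [norm_mul, norm_inv, Real.norm_of_nonneg (hl0 k).le, inv_mul_le_iff₀ (hl0 k)]
      refine (norm_inner_le_norm _ _).trans ?_
      calc _ ≤ A * (l k * C + K * (l k * C)) := by
            gcongr
            · exact hA t htm
            · exact (norm_sub_le _ _).trans (add_le_add h2 h3)
        _ = _ := by ring
    · rw [uIoc_of_le hle] at ht
      have htm := Ioc_subset_Icc_self ht
      have h1 := tendsto_expansion_of_hasFDerivAt (R.differentiableAt_dyn (u t) ω htm).hasFDerivAt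
        hl0 hl (y := fun k => y k t) (C := C) fun k => (hvar' k t htm).1
      have hyt : Tendsto (fun k => y k t) atTop (𝓝 (x t ω)) := by
        rw [tendsto_iff_norm_sub_tendsto_zero]
        refine squeeze_zero (fun _ => norm_nonneg _) (fun k => (hvar' k t htm).1) ?_
        simpa using hl.mul_const C
      have hfc : ∀ j : Fin m, Tendsto (fun k => P.f j.succ (y k t) ω) atTop
          (𝓝 (P.f j.succ (x t ω) ω)) := fun j =>
        (R.differentiableAt_f j.succ ω htm).continuousAt.tendsto.comp hyt
      have h2 : Tendsto (fun k => ∑ j, (v t j - u t j) • P.f j.succ (y k t) ω) atTop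
          (𝓝 (∑ j, (v t j - u t j) • P.f j.succ (x t ω) ω)) :=
        tendsto_finsetSum _ fun j _ => (hfc j).const_smul _
      have h3 := (tendsto_const_nhds (x := p t)).inner (𝕜 := ℝ) (h1.add h2)
      rw [zero_add] at h3
      refine h3.congr fun k => ?_
      simp only [h']
      rw [dyn_mix, ← real_inner_smul_right]
      congr 1
      rw [add_sub_right_comm, add_sub_right_comm, smul_add, smul_smul,
        inv_mul_cancel₀ (hl0 k).ne', one_smul]
  have hgd := R.regular.g_differentiable ω (x P.T ω) (Metric.mem_ball_self R.pos)
  -- The terminal condition turns the first-order term of `g` into the pairing just computed, with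
  -- the opposite sign.
  have hexp := tendsto_expansion_of_hasFDerivAt hgd.hasGradientAt.hasFDerivAt hl0 hl
    (y := fun k => y k P.T) (C := C) fun k => (hvar' k P.T hTm).1
  have hsum := hexp.sub hlim
  rw [zero_sub] at hsum
  refine hsum.congr fun k => ?_
  rw [intervalIntegral.integral_const_mul, (hftc k).2, InnerProductSpace.toDual_apply_apply, ← hpT,
    inner_neg_left, smul_eq_mul]
  ring

end IsReference

end Problem

end EnsembleControl

namespace EnsembleControl

/-! ### Averaged first-order condition. -/

namespace Problem

set_option linter.unusedSectionVars false

variable {n m : ℕ} {Ω : Type*} [MetricSpace Ω] [MeasurableSpace Ω] {P : Problem n m Ω}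
  {u : ℝ → Fin m → ℝ} {x X : ℝ → Ω → State n} {δ K : ℝ}

/-- The `L²`-valued distance takes derivatives in `t` first and the norm over `ω` at fixed `t`, so
the pathwise "a.e. `t`" has to be exchanged with "a.e. `ω`". -/
theorem IsBoxControl.ae_ae_hasDerivAt {w : ℝ → Fin m → ℝ} {y : ℝ → Ω → State n}
    (hw : P.IsBoxControl w) (hK : P.HasBound K) (h0 : P.H0) (ht : P.t₀ ≤ P.T)
    (hφ : MemLp P.φ 2 P.μ) (hy : ∀ ω, P.IsArc w ω (P.φ ω) fun t => y t ω) :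
    ∀ᵐ t ∂volume.restrict (Icc P.t₀ P.T), ∀ᵐ ω ∂P.μ,
      HasDerivAt (fun s => y s ω) (P.dyn (y t ω) (w t) ω) t := by
  have := h0.prob
  obtain ⟨Y, hYm, hYc, hY⟩ := hw.exists_measurable_version hK h0 ht hφ hy
  have hd : Measurable fun q : ℝ × Ω => P.dyn (Y q.1 q.2) (w q.1) q.2 :=
    (measurable_dyn h0).comp (hYm.prodMk ((hw.measurable.comp measurable_fst).prodMk measurable_snd))
  have hev : ∀ {ω t}, (∀ t ∈ Icc P.t₀ P.T, y t ω = Y t ω) → t ∈ Ioo P.t₀ P.T →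
      (fun s => y s ω) =ᶠ[𝓝 t] fun s => Y s ω := fun h htm => by
    filter_upwards [Ioo_mem_nhds htm.1 htm.2] with s hs using h s (Ioo_subset_Icc_self hs)
  have h1 := ae_ae_hasDerivAt_comm (ν := P.μ) (m := volume.restrict (Icc P.t₀ P.T))
    (d := fun t ω => P.dyn (Y t ω) (w t) ω) hYm hYc hd (by
      filter_upwards [hY] with ω hω
      filter_upwards [(hy ω).ae_hasDerivAt hK h0 ht hw, ae_mem_Ioo_restrict_Icc P.t₀ P.T]
        with t h2 h3
      rw [← hω t (Ioo_subset_Icc_self h3)]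
      exact h2.congr_of_eventuallyEq (hev hω h3).symm)
  filter_upwards [h1, ae_mem_Ioo_restrict_Icc P.t₀ P.T] with t h2 h3
  filter_upwards [h2, hY] with ω h4 h5
  rw [h5 t (Ioo_subset_Icc_self h3)]
  exact h4.congr_of_eventuallyEq (hev h5 h3)

namespace IsReference

/-- Optimality among small convex variations of the control. -/
theorem exists_cost_le [OpensMeasurableSpace Ω] (R : P.IsReference u x X δ K)
    (hmin : ((∃ r : ℝ, ∀ ω ∈ P.μ.support, ‖P.φ ω‖ ≤ r) ∧ ∃ ε : ℝ, 0 < ε ∧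
        ∀ v y, P.IsAdmissible v y → (∀ ω ∈ P.μ.support,
          P.arcDist (fun t => x t ω) (fun t => y t ω) ≤ ENNReal.ofReal ε) → P.cost x ≤ P.cost y) ∨
      ∃ ε : ℝ, 0 < ε ∧ ∀ v y, P.IsAdmissible v y →
        P.meanDist x y ≤ ENNReal.ofReal ε → P.cost x ≤ P.cost y) :
    ∃ l₀ : ℝ, 0 < l₀ ∧ ∀ v, P.IsBoxControl v → ∀ l ∈ Icc (0 : ℝ) 1, l ≤ l₀ →
      ∀ y : ℝ → Ω → State n, (∀ ω, P.IsArc (mix u v l) ω (P.φ ω) fun t => y t ω) →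
        P.cost x ≤ P.cost y := by
  have := R.data.prob
  have hle := R.lt.le
  obtain ⟨C, hC0, hvar⟩ := exists_variation_bound R.bound R.data hle
  have hadm : ∀ {v l} {y : ℝ → Ω → State n}, P.IsBoxControl v → l ∈ Icc (0 : ℝ) 1 →
      (∀ ω, P.IsArc (mix u v l) ω (P.φ ω) fun t => y t ω) → P.IsAdmissible (mix u v l) y :=
    fun hv hl hy => ⟨(R.control.mix hv hl).isControl, fun ω => hy ω⟩
  have hT : 0 ≤ P.T - P.t₀ := sub_nonneg.2 hle
  have hsmall : ∀ ε : ℝ, 0 < ε → ∀ A : ℝ, 0 ≤ A →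
      ∃ l₀ : ℝ, 0 < l₀ ∧ ∀ l, 0 ≤ l → l ≤ l₀ → l * A ≤ ε := fun ε hε A hA => by
    refine ⟨ε / (A + 1), by positivity, fun l hl hll => ?_⟩
    calc l * A ≤ ε / (A + 1) * (A + 1) := by gcongr; linarith
      _ = ε := by field_simp
  rcases hmin with ⟨⟨r, hr⟩, ε, hε, hopt⟩ | ⟨ε, hε, hopt⟩
  · obtain ⟨l₀, hl₀, hl₀'⟩ := hsmall ε hε (2 * (C * (1 + |r|)) * (P.T - P.t₀)) (by positivity)
    refine ⟨l₀, hl₀, fun v hv l hl hll y hy => hopt _ _ (hadm hv hl hy) fun ω hω => ?_⟩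
    have hw := R.control.mix hv hl
    have hl0 := hl.1
    have hφr : C * (1 + ‖P.φ ω‖) ≤ C * (1 + |r|) := by
      gcongr; exact (hr ω hω).trans (le_abs_self r)
    have h1 : ∫⁻ t in Icc P.t₀ P.T, ‖x t ω - y t ω‖ₑ ≤
        ∫⁻ _t in Icc P.t₀ P.T, ENNReal.ofReal (l * (C * (1 + |r|))) := by
      refine setLIntegral_mono' measurableSet_Icc fun t ht => ?_
      rw [← ofReal_norm, norm_sub_rev]
      refine ENNReal.ofReal_le_ofReal ((hvar R.control hv hl (R.arc ω) (hy ω) t ht).1.trans ?_)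
      gcongr
    have h2 : ∫⁻ t in Icc P.t₀ P.T, ‖deriv (fun t => x t ω) t - deriv (fun t => y t ω) t‖ₑ ≤
        ∫⁻ _t in Icc P.t₀ P.T, ENNReal.ofReal (l * (C * (1 + |r|))) := by
      refine lintegral_mono_ae ?_
      filter_upwards [(R.arc ω).ae_hasDerivAt R.bound R.data hle R.control,
        (hy ω).ae_hasDerivAt R.bound R.data hle hw, ae_restrict_mem measurableSet_Icc] with t h1 h2 ht
      rw [h1.deriv, h2.deriv, ← ofReal_norm, norm_sub_rev]
      refine ENNReal.ofReal_le_ofReal ((hvar R.control hv hl (R.arc ω) (hy ω) t ht).2.trans ?_)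
      gcongr
    refine (add_le_add h1 h2).trans ?_
    rw [setLIntegral_const, Real.volume_Icc, ← two_mul, ← ENNReal.ofReal_mul (by positivity),
      show (2 : ℝ≥0∞) = ENNReal.ofReal 2 by simp, ← ENNReal.ofReal_mul (by norm_num)]
    refine ENNReal.ofReal_le_ofReal ?_
    calc _ = l * (2 * (C * (1 + |r|)) * (P.T - P.t₀)) := by ring
      _ ≤ ε := hl₀' l hl0 hll
  -- In the mean sense square integrability of `φ` suffices, since only the `L²` norm of the
  -- deviation is measured.
  · have hmem : MemLp (fun ω => C * (1 + ‖P.φ ω‖)) 2 P.μ :=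
      ((memLp_const (1 : ℝ)).add R.initial.norm).const_mul C
    set A := eLpNorm (fun ω => C * (1 + ‖P.φ ω‖)) 2 P.μ with hA
    have hAtop : A ≠ ∞ := hmem.2.ne
    obtain ⟨l₀, hl₀, hl₀'⟩ := hsmall ε hε (2 * A.toReal * (P.T - P.t₀)) (by positivity)
    refine ⟨l₀, hl₀, fun v hv l hl hll y hy => hopt _ _ (hadm hv hl hy) ?_⟩
    have hw := R.control.mix hv hl
    have hl0 := hl.1
    have hscale : eLpNorm (fun ω => l * (C * (1 + ‖P.φ ω‖))) 2 P.μ = ENNReal.ofReal (l * A.toReal) := by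
      have := eLpNorm_const_smul l (fun ω => C * (1 + ‖P.φ ω‖)) 2 P.μ
      rw [ENNReal.ofReal_mul hl0, ENNReal.ofReal_toReal hAtop, ← Real.enorm_of_nonneg hl0]
      exact this
    have h1 : ∫⁻ t in Icc P.t₀ P.T, eLpNorm (fun ω => x t ω - y t ω) 2 P.μ ≤
        ∫⁻ _t in Icc P.t₀ P.T, ENNReal.ofReal (l * A.toReal) := by
      refine setLIntegral_mono' measurableSet_Icc fun t ht => ?_
      rw [← hscale]
      refine eLpNorm_mono_ae_real (Eventually.of_forall fun ω => ?_)
      rw [norm_sub_rev]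
      exact (hvar R.control hv hl (R.arc ω) (hy ω) t ht).1
    have h2 : ∫⁻ t in Icc P.t₀ P.T,
        eLpNorm (fun ω => deriv (fun s => x s ω) t - deriv (fun s => y s ω) t) 2 P.μ ≤
        ∫⁻ _t in Icc P.t₀ P.T, ENNReal.ofReal (l * A.toReal) := by
      refine lintegral_mono_ae ?_
      filter_upwards [R.control.ae_ae_hasDerivAt R.bound R.data hle R.initial R.arc,
        hw.ae_ae_hasDerivAt R.bound R.data hle R.initial hy,
        ae_restrict_mem measurableSet_Icc] with t h1 h2 ht
      rw [← hscale]
      refine eLpNorm_mono_ae_real ?_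
      filter_upwards [h1, h2] with ω h3 h4
      rw [h3.deriv, h4.deriv, norm_sub_rev]
      exact (hvar R.control hv hl (R.arc ω) (hy ω) t ht).2
    refine (add_le_add h1 h2).trans ?_
    rw [setLIntegral_const, Real.volume_Icc, ← two_mul, ← ENNReal.ofReal_mul (by positivity),
      show (2 : ℝ≥0∞) = ENNReal.ofReal 2 by simp, ← ENNReal.ofReal_mul (by norm_num)]
    refine ENNReal.ofReal_le_ofReal ?_
    calc _ = l * (2 * A.toReal * (P.T - P.t₀)) := by ring
      _ ≤ ε := hl₀' l hl0 hll

theorem aestronglyMeasurable_g (R : P.IsReference u x X δ K) {y : Ω → State n}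
    (hy : AEMeasurable y P.μ) : AEStronglyMeasurable (fun ω => P.g (y ω) ω) P.μ :=
  (R.data.g_measurable.comp_aemeasurable (hy.prodMk aemeasurable_id)).aestronglyMeasurable

theorem integrable_g (R : P.IsReference u x X δ K) {y : Ω → State n}
    (hy : AEMeasurable y P.μ) : Integrable (fun ω => P.g (y ω) ω) P.μ := by
  have := R.data.prob
  obtain ⟨M, _, hM⟩ := R.data.g_bounded
  exact Integrable.of_bound (R.aestronglyMeasurable_g hy) M (Eventually.of_forall fun ω => hM _ _)

theorem norm_state_le (R : P.IsReference u x X δ K) {t : ℝ} (ht : t ∈ Icc P.t₀ P.T) (ω : Ω) :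
    1 + ‖x t ω‖ ≤ (1 + ‖P.φ ω‖) * Real.exp (K * (P.T - P.t₀)) :=
  (R.arc ω).one_add_norm_le R.bound R.data R.lt.le R.control ht

/-- The variational inequality of the averaged problem. -/
theorem integral_integral_variation_le (R : P.IsReference u x X δ K)
    {p : ℝ → Ω → State n} {C : ℝ} (hp : P.IsRegularCostate u x p C) {l₀ : ℝ} (hl₀ : 0 < l₀)
    {v : ℝ → Fin m → ℝ} (hv : P.IsBoxControl v)
    (hmin : ∀ l ∈ Icc (0 : ℝ) 1, l ≤ l₀ →
      ∀ y : ℝ → Ω → State n, (∀ ω, P.IsArc (mix u v l) ω (P.φ ω) fun t => y t ω) →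
        P.cost x ≤ P.cost y) :
    ∫ ω, (∫ t in P.t₀..P.T,
      inner ℝ (p t ω) (∑ j, (v t j - u t j) • P.f j.succ (x t ω) ω)) ∂P.μ ≤ 0 := by
  have := R.data.prob
  have hle := R.lt.le
  have hTm : P.T ∈ Icc P.t₀ P.T := ⟨hle, le_rfl⟩
  obtain ⟨C₀, hC₀, hvar⟩ := exists_variation_bound R.bound R.data hle
  let l : ℕ → ℝ := fun k => 1 / ((k : ℝ) + 1)
  have hl0 : ∀ k, 0 < l k := fun k => Nat.one_div_pos_of_nat
  have hl1 : ∀ k, l k ≤ 1 := fun k => by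
    simp only [l]
    rw [div_le_one (by positivity)]
    linarith [(Nat.cast_nonneg k : (0 : ℝ) ≤ k)]
  have hl : Tendsto l atTop (𝓝 0) := tendsto_one_div_add_atTop_nhds_zero_nat
  have hlI : ∀ k, l k ∈ Icc (0 : ℝ) 1 := fun k => ⟨(hl0 k).le, hl1 k⟩
  have hex : ∀ k, ∃ y : ℝ → Ω → State n,
      ∀ ω, P.IsArc (mix u v (l k)) ω (P.φ ω) fun t => y t ω := fun k => by
    obtain ⟨Y, _, _, hY⟩ := (R.control.mix hv (hlI k)).exists_flow R.bound R.data hle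
    exact ⟨fun t ω => Y t (ω, P.φ ω), fun ω => hY _⟩
  choose y hy using hex
  have hyT : ∀ k, AEMeasurable (y k P.T) P.μ := fun k => by
    obtain ⟨Y, hYm, _, hY⟩ := (R.control.mix hv (hlI k)).exists_measurable_version R.bound R.data
      hle R.initial (hy k)
    exact ⟨Y P.T, hYm.comp measurable_prodMk_left, hY.mono fun ω h => h _ hTm⟩
  have hxT : AEMeasurable (x P.T) P.μ :=
    ⟨X P.T, R.measurable.comp measurable_prodMk_left, R.eq.mono fun ω h => h _ hTm⟩
  -- Dominated convergence over `ω`: Lipschitz continuity of `g` and the `O(l)` deviation bound the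
  -- quotients by a multiple of `1 + ‖φ ω‖`.
  have hlim : Tendsto (fun k => ∫ ω, (l k)⁻¹ * (P.g (y k P.T ω) ω - P.g (x P.T ω) ω) ∂P.μ) atTop
      (𝓝 (∫ ω, (-∫ t in P.t₀..P.T,
        inner ℝ (p t ω) (∑ j, (v t j - u t j) • P.f j.succ (x t ω) ω)) ∂P.μ)) := by
    refine tendsto_integral_of_dominated_convergence
      (fun ω => K * (C₀ * (1 + ‖P.φ ω‖))) (fun k => ?_) ?_ (fun k => ?_) ?_
    · exact ((R.aestronglyMeasurable_g (hyT k)).sub (R.aestronglyMeasurable_g hxT)).const_mul _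
    · exact (((integrable_const (1 : ℝ)).add
        (R.initial.integrable (by norm_num)).norm).const_mul C₀).const_mul K
    · refine Eventually.of_forall fun ω => ?_
      rw [norm_mul, norm_inv, Real.norm_of_nonneg (hl0 k).le, inv_mul_le_iff₀ (hl0 k),
        Real.norm_eq_abs]
      refine (R.bound.g_lip _ _ _).trans ?_
      have hK0 := R.bound.pos
      calc _ ≤ K * (l k * (C₀ * (1 + ‖P.φ ω‖))) := by
            gcongr
            exact (hvar R.control hv (hlI k) (R.arc ω) (hy k ω) P.T hTm).1
        _ = _ := by ring
    · filter_upwards [R.costate_arc hp, hp.terminal] with ω h1 h2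
      exact R.tendsto_cost_quotient hv (hp.continuous ω).continuousOn h1.1 h1.2 h2 hl0 hl1 hl
        fun k => hy k ω
  rw [integral_neg] at hlim
  refine neg_nonneg.1 (ge_of_tendsto hlim ?_)
  filter_upwards [hl.eventually (eventually_le_nhds hl₀)] with k hk
  rw [integral_const_mul, integral_sub (R.integrable_g (hyT k)) (R.integrable_g hxT)]
  exact mul_nonneg (inv_nonneg.2 (hl0 k).le)
    (sub_nonneg.2 (hmin (l k) (hlI k) hk (y k) (hy k)))

end IsReference

end Problem

end EnsembleControl

namespace EnsembleControl

/-! ### Integrability along the reference process and the maximum principle. -/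

namespace Problem

set_option linter.unusedSectionVars false

variable {n m : ℕ} {Ω : Type*} [MetricSpace Ω] [MeasurableSpace Ω] {P : Problem n m Ω}
  {u : ℝ → Fin m → ℝ} {x X : ℝ → Ω → State n} {δ K : ℝ}

namespace IsRegularCostate

theorem abs_inner_le {p : ℝ → Ω → State n} {C : ℝ} {ω : Ω} {t B : ℝ}
    (h : ‖p t ω‖ ≤ C) {w : State n} (hw : ‖w‖ ≤ B) : |inner ℝ (p t ω) w| ≤ C * B :=
  (abs_real_inner_le_norm _ _).trans
    (mul_le_mul h hw (norm_nonneg _) ((norm_nonneg _).trans h))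

theorem integrable_inner {p : ℝ → Ω → State n} {C : ℝ} (hp : P.IsRegularCostate u x p C)
    {w w' : ℝ → Ω → State n} (hw : Measurable fun q : ℝ × Ω => w' q.1 q.2)
    (heq : ∀ᵐ ω ∂P.μ, ∀ t ∈ Icc P.t₀ P.T, w t ω = w' t ω) {B : Ω → ℝ} (hB : Integrable B P.μ)
    (hwB : ∀ᵐ ω ∂P.μ, ∀ t ∈ Icc P.t₀ P.T, ‖w t ω‖ ≤ B ω) {t : ℝ} (ht : t ∈ Icc P.t₀ P.T) :
    Integrable (fun ω => inner ℝ (p t ω) (w t ω)) P.μ := by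
  refine (hB.const_mul C).mono' ?_ ?_
  · have h1 : AEStronglyMeasurable (fun ω => inner ℝ (p t ω) (w' t ω)) P.μ :=
      ((hp.measurable.comp measurable_prodMk_left).inner
        (hw.comp measurable_prodMk_left)).aestronglyMeasurable
    refine h1.congr ?_
    filter_upwards [heq] with ω h
    rw [h t ht]
  · filter_upwards [hp.bound, hwB] with ω h1 h2
    exact abs_inner_le (h1 t ht) (h2 t ht)

end IsRegularCostate

namespace IsReference

theorem integrable_growth (R : P.IsReference u x X δ K) :
    Integrable (fun ω => (1 + ‖P.φ ω‖) * Real.exp (K * (P.T - P.t₀))) P.μ := by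
  have := R.data.prob
  exact ((integrable_const (1 : ℝ)).add (R.initial.integrable (by norm_num)).norm).mul_const _

/-- Second-order brackets grow quadratically along the arcs; this is where `φ ∈ L²`, rather than
`L¹`, enters their integrability. -/
theorem integrable_growth_sq (R : P.IsReference u x X δ K) :
    Integrable (fun ω => ((1 + ‖P.φ ω‖) * Real.exp (K * (P.T - P.t₀))) ^ 2) P.μ := by
  have := R.data.prob
  have h1 : MemLp (fun ω => (1 + ‖P.φ ω‖) * Real.exp (K * (P.T - P.t₀))) 2 P.μ :=
    ((memLp_const (1 : ℝ)).add R.initial.norm).mul_const _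
  exact h1.integrable_sq

theorem measurable_f_version (R : P.IsReference u x X δ K) (i : Fin (m + 1)) :
    Measurable fun q : ℝ × Ω => P.f i (X q.1 q.2) q.2 :=
  (R.data.f_measurable i).comp (R.measurable.prodMk measurable_snd)

theorem norm_f_le (R : P.IsReference u x X δ K) (i : Fin (m + 1)) (ω : Ω) {t : ℝ}
    (ht : t ∈ Icc P.t₀ P.T) :
    ‖P.f i (x t ω) ω‖ ≤ K * ((1 + ‖P.φ ω‖) * Real.exp (K * (P.T - P.t₀))) := by
  have := R.bound.pos
  exact (R.bound.f_growth i _ ω).trans (by gcongr; exact R.norm_state_le ht ω)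

theorem integrable_inner_f (R : P.IsReference u x X δ K) {p : ℝ → Ω → State n} {C : ℝ}
    (hp : P.IsRegularCostate u x p C) (i : Fin (m + 1)) {t : ℝ} (ht : t ∈ Icc P.t₀ P.T) :
    Integrable (fun ω => inner ℝ (p t ω) (P.f i (x t ω) ω)) P.μ :=
  hp.integrable_inner (w := fun t ω => P.f i (x t ω) ω) (R.measurable_f_version i)
    (R.eq.mono fun ω h t ht => by rw [h t ht])
    (R.integrable_growth.const_mul K)
    (Eventually.of_forall fun ω t ht => R.norm_f_le i ω ht) ht

/-- The maximum principle: every control component with a nonzero switching function takes the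
corresponding extreme value. -/
theorem ae_bang (R : P.IsReference u x X δ K) {p : ℝ → Ω → State n} {C : ℝ}
    (hp : P.IsRegularCostate u x p C) {l₀ : ℝ} (hl₀ : 0 < l₀) (hbox : ∀ i, P.umin i ≤ P.umax i)
    (hmin : ∀ v, P.IsBoxControl v → ∀ l ∈ Icc (0 : ℝ) 1, l ≤ l₀ →
      ∀ y : ℝ → Ω → State n, (∀ ω, P.IsArc (mix u v l) ω (P.φ ω) fun t => y t ω) →
        P.cost x ≤ P.cost y) :
    ∀ᵐ t ∂volume.restrict (Icc P.t₀ P.T), ∀ j,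
      (0 < P.switching x p j t → u t j = P.umax j) ∧
      (P.switching x p j t < 0 → u t j = P.umin j) := by
  have := R.data.prob
  have hle := R.lt.le
  -- Defined with `X` in place of `x`, so that it is measurable on all of `ℝ` and can be used to
  -- build a control.
  let Ψ : Fin m → ℝ → ℝ := fun j t => ∫ ω, inner ℝ (p t ω) (P.f j.succ (X t ω) ω) ∂P.μ
  have hΨm : ∀ j, Measurable (Ψ j) := fun j => by
    have h1 : Measurable fun q : ℝ × Ω => inner ℝ (p q.1 q.2) (P.f j.succ (X q.1 q.2) q.2) :=
      hp.measurable.inner (R.measurable_f_version j.succ)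
    exact (StronglyMeasurable.integral_prod_right (ν := P.μ)
      (f := fun t ω => inner ℝ (p t ω) (P.f j.succ (X t ω) ω)) h1.stronglyMeasurable).measurable
  have hΨ : ∀ j, ∀ t ∈ Icc P.t₀ P.T, Ψ j t = P.switching x p j t := fun j t ht =>
    integral_congr_ae (by filter_upwards [R.eq] with ω h; rw [h t ht])
  classical
  -- The competitor is extreme where `Ψ_j ≠ 0` and keeps `u` where `Ψ_j = 0`. Every term `(v_j -
  -- u_j) Ψ_j` is then nonnegative, and the variational inequality forces all of them to vanish.
  let v : ℝ → Fin m → ℝ := fun t j =>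
    if 0 < Ψ j t then P.umax j else if Ψ j t < 0 then P.umin j else u t j
  have hv : P.IsBoxControl v := by
    refine ⟨measurable_pi_lambda _ fun j => ?_, fun t => ⟨fun j => ?_, fun j => ?_⟩⟩
    · refine Measurable.ite (measurableSet_lt measurable_const (hΨm j)) measurable_const ?_
      exact Measurable.ite (measurableSet_lt (hΨm j) measurable_const) measurable_const
        ((measurable_pi_apply j).comp R.control.measurable)
    · simp only [v]
      split_ifs
      exacts [hbox j, le_rfl, (R.control.mem t).1 j]
    · simp only [v]
      split_ifs
      exacts [le_rfl, hbox j, (R.control.mem t).2 j]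
  have hterm : ∀ t j, 0 ≤ (v t j - u t j) * Ψ j t := fun t j => by
    simp only [v]
    split_ifs with h1 h2
    · exact mul_nonneg (sub_nonneg.2 ((R.control.mem t).2 j)) h1.le
    · exact mul_nonneg_of_nonpos_of_nonpos (sub_nonpos.2 ((R.control.mem t).1 j)) h2.le
    · simp
  let k : ℝ → Ω → ℝ := fun t ω =>
    inner ℝ (p t ω) (∑ j, (v t j - u t j) • P.f j.succ (X t ω) ω)
  have hkm : Measurable fun q : ℝ × Ω => k q.1 q.2 := by
    refine hp.measurable.inner (Finset.measurable_sum _ fun j _ => ?_)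
    have hvj : Measurable fun q : ℝ × Ω => v q.1 j :=
      (measurable_pi_apply j).comp (hv.measurable.comp measurable_fst)
    have huj : Measurable fun q : ℝ × Ω => u q.1 j :=
      (measurable_pi_apply j).comp (R.control.measurable.comp measurable_fst)
    exact (hvj.sub huj).smul (R.measurable_f_version j.succ)
  have hkB : ∀ᵐ ω ∂P.μ, ∀ t ∈ Icc P.t₀ P.T,
      |k t ω| ≤ C * (K * ((1 + ‖P.φ ω‖) * Real.exp (K * (P.T - P.t₀)))) := by
    filter_upwards [R.eq, hp.bound] with ω h1 h2 t ht
    refine IsRegularCostate.abs_inner_le (h2 t ht) ?_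
    rw [← h1 t ht]
    refine (R.bound.diff_growth _ (R.control.mem t) _ (hv.mem t) _ ω).trans ?_
    have := R.bound.pos
    gcongr
    exact R.norm_state_le ht ω
  have hki := integrable_prod_of_ae_bound hkm.aestronglyMeasurable
    ((R.integrable_growth.const_mul K).const_mul C) hkB
  have hsum : ∀ t ∈ Icc P.t₀ P.T, ∫ ω, k t ω ∂P.μ = ∑ j, (v t j - u t j) * Ψ j t := by
    intro t ht
    have h1 : ∀ j : Fin m, Integrable (fun ω => inner ℝ (p t ω) (P.f j.succ (X t ω) ω)) P.μ :=
      fun j => (R.integrable_inner_f hp j.succ ht).congr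
        (by filter_upwards [R.eq] with ω h; rw [h t ht])
    simp only [k, inner_sum, real_inner_smul_right]
    rw [integral_finsetSum _ fun j _ => (h1 j).const_mul _]
    simp only [integral_const_mul, Ψ]
  have hvar := R.integral_integral_variation_le hp hl₀ hv (hmin v hv)
  have hvar2 : ∫ t in Icc P.t₀ P.T, ∑ j, (v t j - u t j) * Ψ j t ≤ 0 := by
    refine le_of_eq_of_le ?_ hvar
    rw [← setIntegral_congr_fun measurableSet_Icc hsum]
    rw [integral_integral_swap hki]
    refine integral_congr_ae ?_
    filter_upwards [R.eq] with ω h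
    rw [intervalIntegral.integral_of_le hle, ← integral_Icc_eq_integral_Ioc]
    refine setIntegral_congr_fun measurableSet_Icc fun t ht => ?_
    simp only [k, h t ht]
  have hsi : IntegrableOn (fun t => ∑ j, (v t j - u t j) * Ψ j t) (Icc P.t₀ P.T) :=
    (integrableOn_congr_fun hsum measurableSet_Icc).1 hki.integral_prod_left
  have hnn : 0 ≤ fun t => ∑ j, (v t j - u t j) * Ψ j t := fun t =>
    Finset.sum_nonneg fun j _ => hterm t j
  have h0 := (integral_eq_zero_iff_of_nonneg hnn hsi).1
    (le_antisymm hvar2 (integral_nonneg hnn))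
  filter_upwards [h0, ae_restrict_mem measurableSet_Icc] with t h1 ht j
  have h2 := (Finset.sum_eq_zero_iff_of_nonneg fun j _ => hterm t j).1 h1 j (Finset.mem_univ j)
  rw [← hΨ j t ht]
  constructor
  · intro h3
    have h4 := (mul_eq_zero.1 h2).resolve_right h3.ne'
    simp only [v, if_pos h3] at h4
    linarith
  · intro h3
    have h4 := (mul_eq_zero.1 h2).resolve_right h3.ne
    simp only [v, if_neg (not_lt.2 h3.le), if_pos h3] at h4
    linarith

end IsReference

end Problem

end EnsembleControl

/-! ### Differentiating the switching functions twice. -/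

namespace EnsembleControl

open VectorField

/-- The bracket `[f₀, f_i]` has no global Lipschitz bound; being `C¹` near a compact arc is enough
for a Lipschitz composition. -/
theorem exists_lipschitzOnWith_comp_of_contDiffAt {E F : Type*} [NormedAddCommGroup E]
    [NormedSpace ℝ E] [NormedAddCommGroup F] [NormedSpace ℝ F] {G : E → F} {x : ℝ → E} {a b : ℝ}
    {L : NNReal} (hx : LipschitzOnWith L x (Icc a b))
    (hG : ∀ t ∈ Icc a b, ContDiffAt ℝ 1 G (x t)) :
    ∃ N, LipschitzOnWith N (fun t => G (x t)) (Icc a b) := by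
  refine LocallyLipschitzOn.exists_lipschitzOnWith_of_compact isCompact_Icc fun t ht => ?_
  obtain ⟨N, s, hs, hN⟩ := (hG t ht).exists_lipschitzOnWith
  refine ⟨N * L, x ⁻¹' s ∩ Icc a b, inter_mem ((hx.continuousOn t ht) hs) self_mem_nhdsWithin, ?_⟩
  exact hN.comp (hx.mono inter_subset_right) fun r hr => hr.1

/-- Jacobi identity for iterated brackets with two commuting fields. -/
theorem lieBracket_lieBracket_comm {E : Type*} [NormedAddCommGroup E] [NormedSpace ℝ E]
    [CompleteSpace E] {U V W : E → E} {y : E} (hU : ContDiffAt ℝ 2 U y) (hV : ContDiffAt ℝ 2 V y)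
    (hW : ContDiffAt ℝ 2 W y) (hUW : lieBracket ℝ U W =ᶠ[𝓝 y] 0) :
    lieBracket ℝ U (lieBracket ℝ V W) y = lieBracket ℝ W (lieBracket ℝ V U) y := by
  have h1 := leibniz_identity_lieBracket (𝕜 := ℝ) (n := 2) (by simp) hU hV hW
  -- The outer bracket differentiates `[U,W]`, so this field has to vanish near `y`, not merely at
  -- `y`.
  have h2 : lieBracket ℝ V (lieBracket ℝ U W) y = 0 := by
    rw [(EventuallyEq.refl (𝓝 y) V).lieBracket_vectorField_eq hUW, lieBracket_zero_right]
    rfl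
  have h3 : lieBracket ℝ U V = -lieBracket ℝ V U := by
    funext z
    exact lieBracket_swap
  rw [h1, h2, add_zero, lieBracket_swap, h3]
  simp only [lieBracket_eq, fderiv_neg, Pi.neg_apply, map_neg, neg_apply]
  abel

namespace Problem

set_option linter.unusedSectionVars false

variable {n m : ℕ} {Ω : Type*} [MetricSpace Ω] [MeasurableSpace Ω] {P : Problem n m Ω}
  {u : ℝ → Fin m → ℝ} {x X : ℝ → Ω → State n} {δ K : ℝ}

namespace IsReference

theorem contDiffAt_f (R : P.IsReference u x X δ K) (i : Fin (m + 1)) (ω : Ω) {t : ℝ}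
    (ht : t ∈ Icc P.t₀ P.T) : ContDiffAt ℝ 2 (fun y => P.f i y ω) (x t ω) :=
  R.regular.contDiffAt R.lt (R.arc ω).1 ht (Metric.mem_ball_self R.pos) i

theorem lieBracket_eventually_eq_zero (R : P.IsReference u x X δ K) (hcomm : P.Commuting x δ)
    (i j : Fin m) (ω : Ω) {t : ℝ} (ht : t ∈ Icc P.t₀ P.T) :
    lieBracket ℝ (fun z => P.f i.succ z ω) (fun z => P.f j.succ z ω) =ᶠ[𝓝 (x t ω)] 0 := by
  filter_upwards [Metric.ball_mem_nhds (x t ω) R.pos] with y hy using hcomm i j ω t ht y hy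

/-- `W_{ij}` is symmetric for `i,j ≥ 1`, at the level of integrands. -/
theorem bracketTerm_comm (R : P.IsReference u x X δ K) (hcomm : P.Commuting x δ)
    (p : ℝ → Ω → State n) (i j : Fin m) (ω : Ω) {t : ℝ} (ht : t ∈ Icc P.t₀ P.T) :
    P.bracketTerm x p i.succ j.succ t ω = P.bracketTerm x p j.succ i.succ t ω := by
  rw [bracketTerm, bracketTerm, lieBracket_lieBracket_comm (R.contDiffAt_f i.succ ω ht)
    (R.contDiffAt_f 0 ω ht) (R.contDiffAt_f j.succ ω ht)
    (R.lieBracket_eventually_eq_zero hcomm i j ω ht)]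

/-- Derivative of `p · G(x)` along the reference arcs. -/
theorem ae_hasDerivAt_inner (R : P.IsReference u x X δ K) {p : ℝ → State n} {ω : Ω}
    (hpd : ∀ᵐ t ∂volume.restrict (Icc P.t₀ P.T), HasDerivAt p (-P.adjointField u x t ω (p t)) t)
    {G : State n → State n} (hG : ∀ t ∈ Icc P.t₀ P.T, DifferentiableAt ℝ G (x t ω)) :
    ∀ᵐ t ∂volume.restrict (Icc P.t₀ P.T), HasDerivAt (fun s => inner ℝ (p s) (G (x s ω)))
      (inner ℝ (p t) (lieBracket ℝ (fun y => P.f 0 y ω) G (x t ω)) +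
        ∑ j, u t j * inner ℝ (p t) (lieBracket ℝ (fun y => P.f j.succ y ω) G (x t ω))) t := by
  filter_upwards [hpd, (R.arc ω).ae_hasDerivAt R.bound R.data R.lt.le R.control,
    ae_restrict_mem measurableSet_Icc] with t h1 h2 ht
  have h3 := hasDerivAt_inner_lieBracket (D := fun y => P.dyn y (u t) ω) (x := fun s => x s ω)
    (hG t ht) h2 h1
  rw [lieBracket_dyn (fun i => R.differentiableAt_f i ω ht), inner_add_right, inner_sum] at h3
  simpa only [real_inner_smul_right] using h3

theorem measurable_lieBracket_version (R : P.IsReference u x X δ K) (i : Fin (m + 1)) :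
    ∃ w : ℝ → Ω → State n, (Measurable fun q : ℝ × Ω => w q.1 q.2) ∧
      ∀ᵐ ω ∂P.μ, ∀ t ∈ Icc P.t₀ P.T,
        lieBracket ℝ (fun y => P.f 0 y ω) (fun y => P.f i y ω) (x t ω) = w t ω := by
  refine ⟨fun t ω => seqBracket (fun q : State n × Ω => P.f 0 q.1 q.2)
    (fun q : State n × Ω => P.f i q.1 q.2) (X t ω, ω), ?_, ?_⟩
  · exact (measurable_seqBracket (R.data.f_measurable 0) (R.data.f_measurable i)).comp
      (R.measurable.prodMk measurable_snd)
  · filter_upwards [R.eq] with ω h t ht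
    have h0 := R.differentiableAt_f 0 ω ht
    have hi := R.differentiableAt_f i ω ht
    rw [h t ht] at h0 hi ⊢
    exact (seqBracket_eq (V := fun q : State n × Ω => P.f 0 q.1 q.2)
      (W := fun q : State n × Ω => P.f i q.1 q.2) h0 hi).symm

theorem measurable_lieBracket_lieBracket_version (R : P.IsReference u x X δ K)
    (i j : Fin (m + 1)) :
    ∃ w : ℝ → Ω → State n, (Measurable fun q : ℝ × Ω => w q.1 q.2) ∧
      ∀ᵐ ω ∂P.μ, ∀ t ∈ Icc P.t₀ P.T,
        lieBracket ℝ (fun y => P.f i y ω) (lieBracket ℝ (fun y => P.f 0 y ω)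
          (fun y => P.f j y ω)) (x t ω) = w t ω := by
  refine ⟨fun t ω => seqBracket (fun q : State n × Ω => P.f i q.1 q.2)
    (seqBracket (fun q : State n × Ω => P.f 0 q.1 q.2)
      (fun q : State n × Ω => P.f j q.1 q.2)) (X t ω, ω), ?_, ?_⟩
  · exact (measurable_seqBracket (R.data.f_measurable i)
      (measurable_seqBracket (R.data.f_measurable 0) (R.data.f_measurable j))).comp
      (R.measurable.prodMk measurable_snd)
  · filter_upwards [R.eq] with ω h t ht
    have hi := R.differentiableAt_f i ω ht
    have h0 := R.contDiffAt_f 0 ω ht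
    have hj := R.contDiffAt_f j ω ht
    rw [h t ht] at h0 hi hj ⊢
    exact (seqBracket_seqBracket_eq (U := fun q : State n × Ω => P.f i q.1 q.2)
      (V := fun q : State n × Ω => P.f 0 q.1 q.2)
      (W := fun q : State n × Ω => P.f j q.1 q.2) hi h0 hj).symm

theorem norm_lieBracket_le (R : P.IsReference u x X δ K) (i : Fin (m + 1)) (ω : Ω) {t : ℝ}
    (ht : t ∈ Icc P.t₀ P.T) :
    ‖lieBracket ℝ (fun y => P.f 0 y ω) (fun y => P.f i y ω) (x t ω)‖ ≤
      2 * K * (K * ((1 + ‖P.φ ω‖) * Real.exp (K * (P.T - P.t₀)))) := by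
  refine (EnsembleControl.norm_lieBracket_le (R.bound.norm_fderiv_f_le 0 ω _)
    (R.norm_f_le 0 ω ht) (R.bound.norm_fderiv_f_le i ω _) (R.norm_f_le i ω ht)).trans
    (le_of_eq (by ring))

section

variable [OpensMeasurableSpace Ω] [HereditarilyLindelofSpace Ω]

theorem exists_norm_lieBracket_lieBracket_le (R : P.IsReference u x X δ K) :
    ∃ B, 0 ≤ B ∧ ∀ᵐ ω ∂P.μ, ∀ i j, ∀ t ∈ Icc P.t₀ P.T,
      ‖lieBracket ℝ (fun y => P.f i y ω) (lieBracket ℝ (fun y => P.f 0 y ω)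
        (fun y => P.f j y ω)) (x t ω)‖ ≤
        B * ((1 + ‖P.φ ω‖) * Real.exp (K * (P.T - P.t₀))) ^ 2 := by
  obtain ⟨B, hB0, hB⟩ := R.regular.exists_norm_lieBracket_lieBracket_le R.pos R.lt R.bound
    fun ω => (R.arc ω).1
  refine ⟨B, hB0, ?_⟩
  filter_upwards [P.μ.support_mem_ae] with ω hω i j t ht
  refine (hB i 0 j ω hω t ht).trans ?_
  gcongr
  exact R.norm_state_le ht ω

theorem integrable_bracketTerm (R : P.IsReference u x X δ K) {p : ℝ → Ω → State n} {C : ℝ}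
    (hp : P.IsRegularCostate u x p C) (i j : Fin (m + 1)) {t : ℝ} (ht : t ∈ Icc P.t₀ P.T) :
    Integrable (P.bracketTerm x p i j t) P.μ := by
  obtain ⟨B, hB0, hB⟩ := R.exists_norm_lieBracket_lieBracket_le
  obtain ⟨w, hw, hw'⟩ := R.measurable_lieBracket_lieBracket_version i j
  exact hp.integrable_inner (w := fun t ω => lieBracket ℝ (fun y => P.f i y ω)
    (lieBracket ℝ (fun y => P.f 0 y ω) (fun y => P.f j y ω)) (x t ω)) hw hw'
    (R.integrable_growth_sq.const_mul B) (hB.mono fun ω h t ht => h i j t ht) ht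

/-- First differentiation of a vanishing switching function. -/
theorem ae_integral_lieBracket_eq_zero (R : P.IsReference u x X δ K) (hcomm : P.Commuting x δ)
    {p : ℝ → Ω → State n} {C : ℝ} (hp : P.IsRegularCostate u x p C) {a b : ℝ} (ha : P.t₀ ≤ a)
    (hab : a < b) (hb : b ≤ P.T) (i : Fin m)
    (hzero : ∀ᵐ t ∂volume.restrict (Ioo a b), P.switching x p i t = 0) :
    ∀ᵐ t ∂volume.restrict (Ioo a b), ∫ ω, inner ℝ (p t ω)
      (lieBracket ℝ (fun y => P.f 0 y ω) (fun y => P.f i.succ y ω) (x t ω)) ∂P.μ = 0 := by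
  have := R.data.prob
  obtain ⟨w, hw, hw'⟩ := R.measurable_lieBracket_version i.succ
  have hB : ∀ᵐ ω ∂P.μ, ∀ t ∈ Icc P.t₀ P.T, |inner ℝ (p t ω)
      (lieBracket ℝ (fun y => P.f 0 y ω) (fun y => P.f i.succ y ω) (x t ω))| ≤
      C * (2 * K * (K * ((1 + ‖P.φ ω‖) * Real.exp (K * (P.T - P.t₀))))) := by
    filter_upwards [hp.bound] with ω h t ht
    exact IsRegularCostate.abs_inner_le (h t ht) (R.norm_lieBracket_le i.succ ω ht)
  refine ae_integral_deriv_eq_zero ha hab hb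
    (h := fun t ω => inner ℝ (p t ω) (P.f i.succ (x t ω) ω))
    (((R.integrable_growth.const_mul K).const_mul (2 * K)).const_mul C)
    (fun t ht => R.integrable_inner_f hp i.succ ht) ?_ ?_ ?_ ?_ hzero
  · filter_upwards [R.costate_arc hp] with ω h
    obtain ⟨L, hL⟩ := h.1
    obtain ⟨L₁, hL₁⟩ := (R.arc ω).lipschitzOnWith R.bound R.data R.lt.le R.control
    have hf : LipschitzWith K.toNNReal fun y => P.f i.succ y ω :=
      LipschitzWith.of_dist_le_mul fun y z => by
        rw [dist_eq_norm, dist_eq_norm, Real.coe_toNNReal _ R.bound.pos.le]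
        exact R.bound.f_lip i.succ y z ω
    exact exists_lipschitzOnWith_inner hL (hf.comp_lipschitzOnWith hL₁)
  · filter_upwards [R.costate_arc hp] with ω h
    filter_upwards [R.ae_hasDerivAt_inner (p := fun t => p t ω) h.2
      (G := fun y => P.f i.succ y ω) fun t ht => R.differentiableAt_f i.succ ω ht,
      ae_restrict_mem measurableSet_Icc] with t h1 ht
    refine h1.congr_deriv ?_
    -- Commutativity removes every control term, leaving a derivative free of `u` that can be
    -- differentiated once more.
    rw [Finset.sum_eq_zero fun j _ => ?_, add_zero]
    rw [hcomm j i ω t ht _ (Metric.mem_ball_self R.pos), inner_zero_right, mul_zero]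
  · have h1 : AEStronglyMeasurable (fun q : ℝ × Ω => inner ℝ (p q.1 q.2) (w q.1 q.2))
        ((volume.restrict (Icc P.t₀ P.T)).prod P.μ) :=
      (hp.measurable.inner hw).aestronglyMeasurable
    refine h1.congr ?_
    filter_upwards [Measure.quasiMeasurePreserving_snd.ae hw',
      Measure.quasiMeasurePreserving_fst.ae (ae_restrict_mem measurableSet_Icc)] with q h2 h3
    rw [h2 q.1 h3]
  · filter_upwards [Measure.quasiMeasurePreserving_snd.ae hB,
      Measure.quasiMeasurePreserving_fst.ae (ae_restrict_mem measurableSet_Icc)] with q h2 h3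
    exact h2 q.1 h3

/-- Second differentiation of a vanishing switching function. -/
theorem ae_W_add_sum_eq_zero (R : P.IsReference u x X δ K) (hcomm : P.Commuting x δ)
    {p : ℝ → Ω → State n} {C : ℝ} (hp : P.IsRegularCostate u x p C) {a b : ℝ} (ha : P.t₀ ≤ a)
    (hab : a < b) (hb : b ≤ P.T) (i : Fin m)
    (hzero : ∀ᵐ t ∂volume.restrict (Ioo a b), P.switching x p i t = 0) :
    ∀ᵐ t ∂volume.restrict (Ioo a b),
      P.W x p 0 i.succ t + ∑ j : Fin m, u t j * P.W x p j.succ i.succ t = 0 := by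
  have := R.data.prob
  obtain ⟨w, hw, hw'⟩ := R.measurable_lieBracket_version i.succ
  choose z hz hz' using fun j => R.measurable_lieBracket_lieBracket_version j i.succ
  obtain ⟨B, hB0, hB⟩ := R.exists_norm_lieBracket_lieBracket_le
  set r := ∑ i, (|P.umin i| + |P.umax i|) with hr
  have hr0 : 0 ≤ r := Finset.sum_nonneg fun i _ => by positivity
  have hbt : ∀ᵐ ω ∂P.μ, ∀ j, ∀ t ∈ Icc P.t₀ P.T, |P.bracketTerm x p j i.succ t ω| ≤
      C * (B * ((1 + ‖P.φ ω‖) * Real.exp (K * (P.T - P.t₀))) ^ 2) := by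
    filter_upwards [hp.bound, hB] with ω h1 h2 j t ht
    exact IsRegularCostate.abs_inner_le (h1 t ht) (h2 j i.succ t ht)
  have hkB : ∀ᵐ ω ∂P.μ, ∀ t ∈ Icc P.t₀ P.T,
      |P.bracketTerm x p 0 i.succ t ω + ∑ j : Fin m, u t j * P.bracketTerm x p j.succ i.succ t ω| ≤
      (1 + m * r) * (C * (B * ((1 + ‖P.φ ω‖) * Real.exp (K * (P.T - P.t₀))) ^ 2)) := by
    filter_upwards [hbt] with ω h t ht
    rw [add_mul, one_mul]
    refine (abs_add_le _ _).trans (add_le_add (h 0 t ht) ?_)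
    have h1 := norm_sum_smul_le (v := fun j : Fin m => P.bracketTerm x p j.succ i.succ t ω)
      (fun j => abs_le_of_mem_box (R.control.mem t) j) (fun j => h j.succ t ht)
    rw [mul_assoc]
    exact h1
  have key : ∀ᵐ t ∂volume.restrict (Ioo a b), ∫ ω, (P.bracketTerm x p 0 i.succ t ω +
      ∑ j : Fin m, u t j * P.bracketTerm x p j.succ i.succ t ω) ∂P.μ = 0 := by
    -- The mean found to vanish by the first differentiation is now the function to differentiate.
    -- The brackets with the controlled fields survive, so `u` appears linearly, with its components
    -- bounded by `r`.
    refine ae_integral_deriv_eq_zero ha hab hb (h := fun t ω => inner ℝ (p t ω)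
      (lieBracket ℝ (fun y => P.f 0 y ω) (fun y => P.f i.succ y ω) (x t ω)))
      (((R.integrable_growth_sq.const_mul B).const_mul C).const_mul (1 + m * r))
      (fun t ht => ?_) ?_ ?_ ?_ ?_ (R.ae_integral_lieBracket_eq_zero hcomm hp ha hab hb i hzero)
    · exact hp.integrable_inner (w := fun t ω => lieBracket ℝ (fun y => P.f 0 y ω)
        (fun y => P.f i.succ y ω) (x t ω)) hw hw'
        ((R.integrable_growth.const_mul K).const_mul (2 * K))
        (Eventually.of_forall fun ω t ht => R.norm_lieBracket_le i.succ ω ht) ht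
    · filter_upwards [R.costate_arc hp] with ω h
      obtain ⟨L, hL⟩ := h.1
      obtain ⟨L₁, hL₁⟩ := (R.arc ω).lipschitzOnWith R.bound R.data R.lt.le R.control
      obtain ⟨L₂, hL₂⟩ := exists_lipschitzOnWith_comp_of_contDiffAt hL₁
        (G := lieBracket ℝ (fun y => P.f 0 y ω) (fun y => P.f i.succ y ω)) fun t ht =>
          ContDiffAt.lieBracket_vectorField (R.contDiffAt_f 0 ω ht) (R.contDiffAt_f i.succ ω ht)
            (by norm_num)
      exact exists_lipschitzOnWith_inner hL hL₂
    · filter_upwards [R.costate_arc hp] with ω h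
      exact R.ae_hasDerivAt_inner (p := fun t => p t ω) h.2
        (G := lieBracket ℝ (fun y => P.f 0 y ω) (fun y => P.f i.succ y ω)) fun t ht =>
          (ContDiffAt.lieBracket_vectorField (m := 1) (R.contDiffAt_f 0 ω ht)
            (R.contDiffAt_f i.succ ω ht) (by norm_num)).differentiableAt (by simp)
    · have h1 : Measurable fun q : ℝ × Ω => inner ℝ (p q.1 q.2) (z 0 q.1 q.2) +
          ∑ j : Fin m, u q.1 j * inner ℝ (p q.1 q.2) (z j.succ q.1 q.2) := by
        refine (hp.measurable.inner (hz 0)).add (Finset.measurable_sum _ fun j _ => ?_)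
        exact ((measurable_pi_apply j).comp (R.control.measurable.comp measurable_fst)).mul
          (hp.measurable.inner (hz j.succ))
      refine h1.aestronglyMeasurable.congr ?_
      have h2 : ∀ᵐ ω ∂P.μ, ∀ j, ∀ t ∈ Icc P.t₀ P.T, lieBracket ℝ (fun y => P.f j y ω)
          (lieBracket ℝ (fun y => P.f 0 y ω) (fun y => P.f i.succ y ω)) (x t ω) = z j t ω :=
        ae_all_iff.2 hz'
      filter_upwards [Measure.quasiMeasurePreserving_snd.ae h2,
        Measure.quasiMeasurePreserving_fst.ae (ae_restrict_mem measurableSet_Icc)] with q h3 h4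
      simp only [bracketTerm, h3 _ q.1 h4]
    · filter_upwards [Measure.quasiMeasurePreserving_snd.ae hkB,
        Measure.quasiMeasurePreserving_fst.ae (ae_restrict_mem measurableSet_Icc)] with q h2 h3
      exact h2 q.1 h3
  filter_upwards [key, ae_restrict_mem measurableSet_Ioo] with t h1 htm
  have ht : t ∈ Icc P.t₀ P.T := ⟨ha.trans htm.1.le, htm.2.le.trans hb⟩
  rw [integral_add (R.integrable_bracketTerm hp 0 i.succ ht)
    (integrable_finsetSum _ fun j _ => (R.integrable_bracketTerm hp j.succ i.succ ht).const_mul _),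
    integral_finsetSum _ fun j _ => (R.integrable_bracketTerm hp j.succ i.succ ht).const_mul _]
    at h1
  simp only [integral_const_mul] at h1
  exact h1

end

end IsReference

end Problem

end EnsembleControl

/-! ### The linear system for the singular components. -/

theorem mainTheorem3 {n m : ℕ} {Ω : Type*} [MetricSpace Ω] [CompleteSpace Ω]
    [TopologicalSpace.SeparableSpace Ω] [MeasurableSpace Ω] [BorelSpace Ω]
    (P : EnsembleControl.Problem n m Ω) (ht : P.t₀ < P.T)
    (hbox : ∀ i, P.umin i < P.umax i)
    (hφ : MemLp P.φ 2 P.μ) (h0 : P.H0)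
    (u : ℝ → Fin m → ℝ) (x : ℝ → Ω → EnsembleControl.State n)
    -- local minimality: pathwise when the initial datum is bounded on the support of the
    -- measure (for instance, known), and in the sense of `L²`-valued states in general
    (hmin : ((∃ R : ℝ, ∀ ω ∈ P.μ.support, ‖P.φ ω‖ ≤ R) ∧ P.IsLocalMinimizer u x) ∨
      P.IsMeanLocalMinimizer u x)
    (δ : ℝ) (hδ : 0 < δ) (h1 : P.H1 x δ) (hcomm : P.Commuting x δ)
    (p : ℝ → Ω → EnsembleControl.State n)
    (hp : P.IsCostate u x p ∨ P.IsMeanCostate u x p)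
    (a b : ℝ) (ha : P.t₀ ≤ a) (hab : a < b) (hb : b ≤ P.T)
    (S Bmin Bmax : Finset (Fin m))
    (hconst : ∀ᵐ t ∂(volume.restrict (Ioo a b)),
      P.singularSet u t = S ∧ P.bangMin x p t = Bmin ∧ P.bangMax x p t = Bmax)
    -- every index is singular or bang
    (hcover : S ∪ Bmin ∪ Bmax = Finset.univ) :
    ∀ᵐ t ∂(volume.restrict (Ioo a b)),
      (∀ i j : Fin (m + 1), Integrable (P.bracketTerm x p i j t) P.μ) ∧
      Matrix.mulVec (P.WS x p S t) (fun j : S => u t j) + P.bS x p S Bmin Bmax t = 0 := by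
  -- Second countability makes the support a set of full measure.
  have := UniformSpace.secondCountable_of_separable Ω
  have hadm : P.IsAdmissible u x := hmin.elim (fun h => h.2.1) fun h => h.1
  obtain ⟨u', hu', huu⟩ := hadm.1.exists_isBoxControl fun i => (hbox i).le
  have hx : ∀ ω, P.IsArc u' ω (P.φ ω) fun t => x t ω := fun ω =>
    EnsembleControl.Problem.IsArc.congr_control (hadm.2 ω) huu
  obtain ⟨X, K, R⟩ := EnsembleControl.Problem.exists_isReference h0 ht hφ hu' hx hδ h1
  obtain ⟨l₀, hl₀, hopt⟩ := R.exists_cost_le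
    (hmin.imp (fun h => ⟨h.1, h.2.2⟩) fun h => h.2)
  obtain ⟨q, C, hq⟩ := R.exists_regularCostate
  have hpq := R.ae_eq_regularCostate huu hp hq
  have hsub : Ioo a b ⊆ Icc P.t₀ P.T :=
    Ioo_subset_Icc_self.trans (Icc_subset_Icc ha hb)
  have hIoo : ∀ᵐ t ∂volume.restrict (Ioo a b), t ∈ Ioo a b := ae_restrict_mem measurableSet_Ioo
  have hsw : ∀ j, ∀ t ∈ Icc P.t₀ P.T, P.switching x p j t = P.switching x q j t := fun j t ht' =>
    integral_congr_ae (by filter_upwards [hpq t ht'] with ω h; rw [h])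
  have hbr : ∀ i j, ∀ t ∈ Icc P.t₀ P.T,
      P.bracketTerm x p i j t =ᵐ[P.μ] P.bracketTerm x q i j t := fun i j t ht' => by
    filter_upwards [hpq t ht'] with ω h
    simp only [EnsembleControl.Problem.bracketTerm, h]
  have hW : ∀ i j, ∀ t ∈ Icc P.t₀ P.T, P.W x p i j t = P.W x q i j t := fun i j t ht' =>
    integral_congr_ae (hbr i j t ht')
  have hsymm : ∀ i j : Fin m, ∀ t ∈ Icc P.t₀ P.T,
      P.W x q i.succ j.succ t = P.W x q j.succ i.succ t := fun i j t ht' =>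
    integral_congr_ae (Eventually.of_forall fun ω => R.bracketTerm_comm hcomm q i j ω ht')
  -- singular components have vanishing, bang components extreme values
  have hbang : ∀ᵐ t ∂volume.restrict (Ioo a b),
      (∀ i ∈ S, P.switching x q i t = 0) ∧ (∀ j ∈ Bmin, P.switching x q j t < 0 ∧ u t j = P.umin j) ∧
      ∀ j ∈ Bmax, 0 < P.switching x q j t ∧ u t j = P.umax j := by
    filter_upwards [hconst, hIoo, ae_restrict_of_ae_restrict_of_subset hsub huu,
      ae_restrict_of_ae_restrict_of_subset hsub (R.ae_bang hq hl₀ (fun i => (hbox i).le) hopt)]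
      with t ⟨hS, hmn, hmx⟩ htm h2 h3
    have ht' := hsub htm
    rw [h2] at h3
    refine ⟨fun i hi => ?_, fun j hj => ?_, fun j hj => ?_⟩
    · rw [← hS, EnsembleControl.Problem.singularSet, Finset.mem_filter] at hi
      -- A nonzero switching function would place the component at an end of its interval,
      -- contradicting singularity.
      rcases lt_trichotomy (P.switching x q i t) 0 with h | h | h
      · exact absurd ((h3 i).2 h) hi.2.1.ne'
      · exact h
      · exact absurd ((h3 i).1 h) hi.2.2.ne
    · rw [← hmn, EnsembleControl.Problem.bangMin, Finset.mem_filter, hsw j t ht'] at hj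
      exact ⟨hj.2, (h3 j).2 hj.2⟩
    · rw [← hmx, EnsembleControl.Problem.bangMax, Finset.mem_filter, hsw j t ht'] at hj
      exact ⟨hj.2, (h3 j).1 hj.2⟩
  have hsing : ∀ᵐ t ∂volume.restrict (Ioo a b), ∀ i ∈ S,
      P.W x q 0 i.succ t + ∑ j : Fin m, u' t j * P.W x q j.succ i.succ t = 0 := by
    refine ae_all_iff.2 fun i => ?_
    by_cases hi : i ∈ S
    · filter_upwards [R.ae_W_add_sum_eq_zero hcomm hq ha hab hb i
        (hbang.mono fun t h => h.1 i hi)] with t h _ using h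
    · exact Eventually.of_forall fun t h => absurd h hi
  filter_upwards [hbang, hsing, hIoo, ae_restrict_of_ae_restrict_of_subset hsub huu]
    with t ⟨hz, hmn, hmx⟩ hs htm huut
  have ht' := hsub htm
  refine ⟨fun i j => (R.integrable_bracketTerm hq i j ht').congr (hbr i j t ht').symm, ?_⟩
  funext i
  -- The sign of the switching function separates the three index sets, so the sum over all indices
  -- splits without repetition.
  have hd1 : Disjoint S Bmin := Finset.disjoint_left.2 fun j hj hj' =>
    (hmn j hj').1.ne (hz j hj)
  have hd2 : Disjoint (S ∪ Bmin) Bmax := Finset.disjoint_left.2 fun j hj hj' => by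
    rcases Finset.mem_union.1 hj with h | h
    · exact (hmx j hj').1.ne' (hz j h)
    · exact lt_asymm (hmx j hj').1 (hmn j h).1
  have hi := hs i i.2
  rw [huut, ← hcover, Finset.sum_union hd2, Finset.sum_union hd1] at hi
  -- Differentiation produced `W_{ji}`, the claimed system has `W_{ij}`; symmetry reconciles them.
  have e1 : ∑ j : S, P.W x p i.1.succ j.1.succ t * u t j =
      ∑ j ∈ S, u t j * P.W x q j.succ i.1.succ t := by
    rw [← Finset.sum_coe_sort S]
    refine Finset.sum_congr rfl fun j _ => ?_
    rw [hW _ _ t ht', hsymm _ _ t ht', mul_comm]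
  have e2 : ∑ j ∈ Bmin, P.W x p i.1.succ j.succ t * P.umin j =
      ∑ j ∈ Bmin, u t j * P.W x q j.succ i.1.succ t :=
    Finset.sum_congr rfl fun j hj => by
      rw [hW _ _ t ht', hsymm _ _ t ht', mul_comm, (hmn j hj).2]
  have e3 : ∑ j ∈ Bmax, P.W x p i.1.succ j.succ t * P.umax j =
      ∑ j ∈ Bmax, u t j * P.W x q j.succ i.1.succ t :=
    Finset.sum_congr rfl fun j hj => by
      rw [hW _ _ t ht', hsymm _ _ t ht', mul_comm, (hmx j hj).2]
  simp only [Pi.add_apply, Matrix.mulVec, dotProduct, EnsembleControl.Problem.WS, Matrix.of_apply,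
    EnsembleControl.Problem.bS, Pi.zero_apply]
  rw [e1, e2, e3, hW _ _ t ht']
  linarith
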